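/- Let $\mathcal H_0,\mathcal H_1$ be complex Hilbert spaces, $A_0$ and $A_1$ (possibly unbounded) selfadjoint operators in $\mathcal H_0$ and $\mathcal H_1$, $B_{10}:\mathcal H_0\to\mathcal H_1$ a bounded operator and $B_{01}=B_{10}^*$. Let $J^0=(\mu^{(1)},\mu^{(2)})$ with $-\infty\le\mu^{(1)}<\mu^{(2)}\le\infty$. Assume that the spectrum of $A_0$ is absolutely continuous and equal to the closure $\overline{J^0}$ of $J^0$ in $\mathbb R$, and that $\sigma(A_1)\subset J^0$. The transfer function is $$M_1(z)=A_1-z+V_1(z),\qquad V_1(z)=B_{10}(z-A_0)^{-1}B_{01},\qquad z\in\mathbb C\setminus\sigma(A_0),$$ with domain $\mathrm{dom}(A_1)$. Let $E_0$ be the spectral measure of $A_0$ and $K_B(\mu)=B_{10}E_0((-\infty,\mu))B_{01}$. Assume that $K_B$ is differentiable on $J^0$ in operator norm and that $K_B'$ extends continuously to $\overline{J^0}$ and has an analytic continuation from $\overline{J^0}$ to a simply connected domain $D^-$ in the open lower half-plane with $J^0\subset\partial D^-$; that is, $K_B'$ is the restriction of a function that is continuous on $D^-\cup\overline{J^0}$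 and holomorphic on $D^-$, again denoted by $K_B'$. Let $D^+=\{\bar z: z\in D^-\}$ and continue $K_B'$ to $D^+$ by $K_B'(\mu)=K_B'(\bar\mu)^*$. Let $l\in\{1,-1\}$, where $D^{+1}=D^+$ and $D^{-1}=D^-$. Let $\Gamma^l\subset D^l$ be a (locally) rectifiable Jordan curve that results from $J^0$ by a continuous deformation with fixed end points (an infinite end point means that the curves of the deformation go to infinity there), let $\Gamma^l$ carry the orientation inherited from $J^0$, and let $D(\Gamma^l)\subset D^l$ be the domain that is bounded by $J^0$ and $\Gamma^l$ and swept by the deformation. Suppose that $\Gamma^l$ is $K_B$-bounded, i.e. $\int_{\Gamma^l}|d\mu|\,\|K_B'(\mu)\|<\infty$. If $J^0$ is unbounded, suppose also that $K_B'$ grows at most polynomially in $D(\Gamma^l)$: $\|K_B'(\mu)\|\le C(1+|\mu|)^N$ for some $C,N$ and all $\mu\in D(\Gamma^l)$. Then for $z\in\mathbb C\setminus\overline{\Gamma^l}$ the integral $$V_1(z,\Gamma^l)=\int_{\Gamma^l}d\mu\,K_B'(\mu)\,(z-\mu)^{-1}$$ converges absolutely in operator norm and is holomorphic in $z$ in operator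 norm. With $$M_1(z,\Gamma^l)=A_1-z+V_1(z,\Gamma^l),\qquad \mathrm{dom}\,M_1(z,\Gamma^l)=\mathrm{dom}(A_1),$$ the function $M_1(\cdot,\Gamma^l)$ is the analytic continuation (as a holomorphic family of closed operators with constant domain) of $M_1$ from the half-plane $\{z: l\,\mathrm{Im}\,z<0\}$ through $J^0$ into $D(\Gamma^l)$, i.e. to the connected open set $\{z: l\,\mathrm{Im}\,z<0\}\cup J^0\cup D(\Gamma^l)$. Moreover $M_1(z,\Gamma^l)=M_1(z)$ for all $z\in\mathbb C\setminus\overline{D(\Gamma^l)}$, and $$M_1(z,\Gamma^l)=M_1(z)+2\pi i\,l\,K_B'(z)\qquad\text{for } z\in D^l\cap D(\Gamma^l).$$ -/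

import Mathlib

open MeasureTheory Filter Topology ComplexConjugate
open scoped ENNReal InnerProductSpace

noncomputable section

section Operators

variable {H : Type*} [NormedAddCommGroup H] [InnerProductSpace ℂ H]

/-- `R` is the bounded operator `(z - A)⁻¹` for the (possibly unbounded) operator `A`. -/
def IsResolventAt (A : H →ₗ.[ℂ] H) (z : ℂ) (R : H →L[ℂ] H) : Prop :=
  (∀ x : H, ∃ h : R x ∈ A.domain, z • R x - A ⟨R x, h⟩ = x) ∧
    ∀ x : A.domain, R (z • (x : H) - A x) = x

/-- The spectrum of a possibly unbounded operator. -/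
def opSpectrum (A : H →ₗ.[ℂ] H) : Set ℂ :=
  {z | ¬ ∃ R : H →L[ℂ] H, IsResolventAt A z R}

open Classical in
/-- The resolvent `(z - A)⁻¹`; it is `0` by convention for `z` in the spectrum of `A`. -/
def opResolvent (A : H →ₗ.[ℂ] H) (z : ℂ) : H →L[ℂ] H :=
  if h : ∃ R : H →L[ℂ] H, IsResolventAt A z R then h.choose else 0

/-- A family of closed operators with a common domain that is holomorphic on `U`
(a holomorphic family of type (A)). -/
def HolomorphicFamilyOn (M : ℂ → H →ₗ.[ℂ] H) (U : Set ℂ) : Prop :=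
  ∃ 𝒟 : Submodule ℂ H, (∀ z ∈ U, (M z).IsClosed ∧ (M z).domain = 𝒟) ∧
    ∀ x ∈ 𝒟, ∃ F : ℂ → H, DifferentiableOn ℂ F U ∧
      ∀ z ∈ U, ∀ y : (M z).domain, (y : H) = x → M z y = F z

/-- `N`, on the domain `W`, is the analytic continuation of `M`, given on the open set `U`. -/
structure IsAnalyticContinuation (M N : ℂ → H →ₗ.[ℂ] H) (U W : Set ℂ) : Prop where
  isOpen : IsOpen U
  nonempty : U.Nonempty
  subset : U ⊆ W
  isOpen' : IsOpen W
  isConnected' : IsConnected W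
  holomorphic : HolomorphicFamilyOn N W
  eqOn : ∀ z ∈ U, N z = M z

end Operators

section SpectralMeasure

/-- Projection-valued measures on the Borel sets of the real line. -/
structure ProjectionValuedMeasure (H : Type*) [NormedAddCommGroup H] [InnerProductSpace ℂ H]
    [CompleteSpace H] where
  proj : Set ℝ → H →L[ℂ] H
  isStarProjection : ∀ S, MeasurableSet S → IsStarProjection (proj S)
  proj_univ : proj Set.univ = 1
  proj_inter : ∀ S T, MeasurableSet S → MeasurableSet T → proj (S ∩ T) = proj S * proj T
  hasSum : ∀ S : ℕ → Set ℝ, (∀ n, MeasurableSet (S n)) → Pairwise (Function.onFun Disjoint S) →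
    ∀ x, HasSum (fun n => proj (S n) x) (proj (⋃ n, S n) x)

variable {H : Type*} [NormedAddCommGroup H] [InnerProductSpace ℂ H] [CompleteSpace H]

namespace ProjectionValuedMeasure

theorem proj_empty (E : ProjectionValuedMeasure H) (x : H) : E.proj ∅ x = 0 := by
  have h := E.hasSum (fun _ => ∅) (fun _ => MeasurableSet.empty)
    (fun _ _ _ => by simp [Function.onFun]) x
  have h2 := h.summable.tendsto_atTop_zero
  exact tendsto_nhds_unique tendsto_const_nhds h2

theorem re_inner_nonneg (E : ProjectionValuedMeasure H) {S : Set ℝ} (hS : MeasurableSet S)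
    (x : H) : 0 ≤ (⟪x, E.proj S x⟫_ℂ).re := by
  have hp := E.isStarProjection S hS
  have h1 : E.proj S x = E.proj S (E.proj S x) := by
    have := congrArg (fun T : H →L[ℂ] H => T x) hp.isIdempotentElem
    simpa using this.symm
  have h2 : ⟪x, E.proj S x⟫_ℂ = ⟪E.proj S x, E.proj S x⟫_ℂ := by
    conv_lhs => rw [h1]
    rw [← ContinuousLinearMap.adjoint_inner_left]
    rw [hp.isSelfAdjoint.adjoint_eq]
  rw [h2]
  exact inner_self_nonneg (𝕜 := ℂ)

/-- The finite positive Borel measure `S ↦ ⟪x, E(S) x⟫`. -/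
def scalarMeasure (E : ProjectionValuedMeasure H) (x : H) : Measure ℝ :=
  Measure.ofMeasurable (fun S _ => ENNReal.ofReal (⟪x, E.proj S x⟫_ℂ).re)
    (by simp [E.proj_empty])
    (by
      intro S hS hd
      have h := E.hasSum S hS hd x
      have h2 := (Complex.reCLM.hasSum ((innerSL ℂ x).hasSum h))
      have h3 : HasSum (fun n => (⟪x, E.proj (S n) x⟫_ℂ).re) (⟪x, E.proj (⋃ n, S n) x⟫_ℂ).re := by
        simpa using h2
      rw [← h3.tsum_eq]
      exact ENNReal.ofReal_tsum_of_nonneg (fun n => E.re_inner_nonneg (hS n) x) h3.summable)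

end ProjectionValuedMeasure

/-- `E` is the spectral measure of `A`, that is `A = ∫ λ dE(λ)`: the domain of `A` consists of
the `x` with `∫ λ² d⟪x, E(λ) x⟫ < ∞`, and `⟪x, A x⟫ = ∫ λ d⟪x, E(λ) x⟫` for these `x`. -/
structure IsSpectralMeasure (A : H →ₗ.[ℂ] H) (E : ProjectionValuedMeasure H) : Prop where
  mem_domain_iff : ∀ x : H, x ∈ A.domain ↔ ∫⁻ s, ‖s‖ₑ ^ 2 ∂(E.scalarMeasure x) < ∞
  inner_apply : ∀ x : A.domain,
    ⟪(x : H), A x⟫_ℂ = ((∫ s, s ∂(E.scalarMeasure (x : H)) : ℝ) : ℂ)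

end SpectralMeasure

section Contours

/-- The open interval `(a, b)` of the real line with end points in `[-∞, ∞]`. -/
def realInterval (a b : EReal) : Set ℝ := {t | a < (t : EReal) ∧ (t : EReal) < b}

open Classical in
/-- Convergence in the complex plane to an end point: to the point itself if it is finite,
to infinity otherwise. -/
def endFilter (e : EReal) : Filter ℂ :=
  if e = ⊥ ∨ e = ⊤ then cocompact ℂ else 𝓝 (e.toReal : ℂ)

/-- `γ`, defined on the interval `J = (a, b)`, parametrizes a (locally) rectifiable Jordan curve
`Γ = γ(J)` in `D` which results from `J` by a continuous deformation `h s`, `0 ≤ s ≤ 1`, with fixed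
end points, and `Ω` is the domain, contained in `D`, which is bounded by `J` and `Γ` and which is
swept by the deformation. Rectifiability is expressed through a locally Lipschitz
parametrization (for instance by a multiple of the arc length). -/
structure IsDeformedInterval (a b : EReal) (D : Set ℂ) (γ : ℝ → ℂ) (Ω : Set ℂ) : Prop where
  locallyLipschitz : LocallyLipschitzOn (realInterval a b) γ
  maps : Set.MapsTo γ (realInterval a b) D
  isOpen : IsOpen Ω
  subset : Ω ⊆ D
  frontier_eq : frontier Ω =
    (fun t : ℝ => (t : ℂ)) '' closure (realInterval a b) ∪ γ '' realInterval a b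
  deformation : ∃ h : ℝ × ℝ → ℂ,
    ContinuousOn h (Set.Icc 0 1 ×ˢ realInterval a b) ∧
    Set.InjOn h (Set.Icc 0 1 ×ˢ realInterval a b) ∧
    (∀ t ∈ realInterval a b, h (0, t) = (t : ℂ)) ∧
    (∀ t ∈ realInterval a b, h (1, t) = γ t) ∧
    h '' (Set.Ioo 0 1 ×ˢ realInterval a b) = Ω ∧
    Tendsto h (𝓟 (Set.Icc 0 1) ×ˢ comap Real.toEReal (𝓝[>] a)) (endFilter a) ∧
    Tendsto h (𝓟 (Set.Icc 0 1) ×ˢ comap Real.toEReal (𝓝[<] b)) (endFilter b)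

/-- The domain `D^l`: `D` itself for `l = -1`, its mirror image for `l = 1`. -/
def sheetDomain (D : Set ℂ) (l : ℤ) : Set ℂ := if l = 1 then {z | conj z ∈ D} else D

end Contours

section Transfer

variable {H₀ H₁ : Type*} [NormedAddCommGroup H₀] [InnerProductSpace ℂ H₀] [CompleteSpace H₀]
  [NormedAddCommGroup H₁] [InnerProductSpace ℂ H₁] [CompleteSpace H₁]

/-- `K_B(μ) = B₁₀ E⁰(μ) B₀₁`, where `E⁰(μ) = E((-∞, μ))` and `B₀₁` is the adjoint of
`B = B₁₀`. -/
def kernelFunction (E : ProjectionValuedMeasure H₀) (B : H₀ →L[ℂ] H₁) (μ : ℝ) : H₁ →L[ℂ] H₁ :=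
  B ∘L E.proj (Set.Iio μ) ∘L B.adjoint

/-- The operator function `K` is differentiable on the interval `(a, b)` in operator norm, and `G`
is its derivative, continuous on the closed interval, together with the analytic continuation of
the derivative from the closed interval to the simply connected domain `D` in the lower half-plane,
whose boundary contains the interval. -/
structure IsContinuedDerivative (K : ℝ → H₁ →L[ℂ] H₁) (a b : EReal) (D : Set ℂ)
    (G : ℂ → H₁ →L[ℂ] H₁) : Prop where
  isOpen : IsOpen D
  simplyConnected : IsSimplyConnected D
  lower : ∀ z ∈ D, z.im < 0
  interval_subset : (fun t : ℝ => (t : ℂ)) '' realInterval a b ⊆ frontier D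
  hasDerivAt : ∀ μ ∈ realInterval a b, HasDerivAt K (G (μ : ℂ)) μ
  continuousOn : ContinuousOn G (D ∪ (fun t : ℝ => (t : ℂ)) '' closure (realInterval a b))
  differentiableOn : DifferentiableOn ℂ G D

open Classical in
/-- The extension of the continued derivative `G` to the mirror image of its domain,
by `G(μ) = G(conj μ)^*` in the upper half-plane. -/
def reflectedKernel (G : ℂ → H₁ →L[ℂ] H₁) (μ : ℂ) : H₁ →L[ℂ] H₁ :=
  if μ.im ≤ 0 then G μ else (G (conj μ)).adjoint

/-- The variation `∫_Γ |dμ| ‖G(μ)‖` along the curve `Γ = γ(J)`. -/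
def kernelVariation (G : ℂ → H₁ →L[ℂ] H₁) (J : Set ℝ) (γ : ℝ → ℂ) : ℝ≥0∞ :=
  ∫⁻ t in J, ‖deriv γ t‖ₑ * ‖G (γ t)‖ₑ

/-- `V₁(z) = B₁₀ (z - A₀)⁻¹ B₀₁`. -/
def physicalV (A₀ : H₀ →ₗ.[ℂ] H₀) (B : H₀ →L[ℂ] H₁) (z : ℂ) : H₁ →L[ℂ] H₁ :=
  B ∘L opResolvent A₀ z ∘L B.adjoint

/-- The integrand of `∫_Γ dμ G(μ) (z - μ)⁻¹` in the parametrization `γ` of `Γ`. -/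
def contourIntegrand (G : ℂ → H₁ →L[ℂ] H₁) (γ : ℝ → ℂ) (z : ℂ) (t : ℝ) : H₁ →L[ℂ] H₁ :=
  deriv γ t • ((z - γ t)⁻¹ • G (γ t))

/-- `V₁(z, Γ) = ∫_Γ dμ G(μ) (z - μ)⁻¹`, where `Γ = γ(J)`. -/
def contourV (G : ℂ → H₁ →L[ℂ] H₁) (J : Set ℝ) (γ : ℝ → ℂ) (z : ℂ) : H₁ →L[ℂ] H₁ :=
  ∫ t in J, contourIntegrand G γ z t

/-- The operator `A₁ - z + V(z)` with the domain of `A₁`. -/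
def transferFunction (A₁ : H₁ →ₗ.[ℂ] H₁) (V : ℂ → H₁ →L[ℂ] H₁) (z : ℂ) : H₁ →ₗ.[ℂ] H₁ :=
  ((V z - z • (1 : H₁ →L[ℂ] H₁) : H₁ →L[ℂ] H₁) : H₁ →ₗ[ℂ] H₁) +ᵥ A₁

end Transfer

end

/-!
The quadratic forms reduce everything to scalar functions. For `x` in `H₁` put
`q z = ⟪x, K_B'(z) x⟫`. The spectral theorem, in the form of `IsSpectralMeasure.inner_resolvent`,
and the fact that the derivative of `K_B` is the density of the measure `⟪B* x, E(·) B* x⟫`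
(`IsContinuedDerivative.restrict_scalarMeasure`) show that `⟪x, V₁(z) x⟫` is the Cauchy transform
`∫ (z - t)⁻¹ q t dt` over the interval `J`. Since `q` is real on `J`, the Schwarz reflection
principle makes it holomorphic across `J`, so `q` is holomorphic on a neighbourhood of
everything that the deformation sweeps, the interval and the curve included. A bounded operator is
determined by its quadratic form, so it suffices to compare the Cauchy transforms of `q` over `J`
and over the curve `Γ`.

Outside the closure of the swept domain `Ω` they agree by Cauchy's theorem
(`IsDeformation.setIntegral_eq`). No winding numbers are needed: on a compact rectangle of the
deformation parameters, a holomorphic function has a primitive along the deformation, which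
expresses the integrals over pieces of `J` and of `Γ` as differences of its values. The ends of the
pieces are joined by arcs in `Ω` of circles around the end points of `J`. Such an arc has
length at most `π r`, so its contribution vanishes in the limit if `(w - e) f w → 0` at the end
points `e`. At a finite end point this holds because `q` is bounded there. At infinity it is
enforced by the factor `(1 - i σ ε w)^{-(N+1)}`, which beats the polynomial growth of `q` and is
removed by dominated convergence as `ε → 0`.

Inside `Ω` the two transforms differ by a residue (`IsDeformation.cauchyTransform_sub_eq`). Near a
point of `J` the Cauchy transform over `J` is `N ∓ π i q` above and below the real line with the
same holomorphic `N`, because `∫ (q t - q z) / (z - t) dt` is holomorphic across `J` and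
`∫ dt / (z - t)` is a difference of logarithms. The transform over `Γ` is holomorphic across `J` and
agrees with the one over `J` on the side away from `Ω`. This gives the difference `2 π i l q` near
the point, and the identity theorem extends it to the connected set `Ω`.

The operator-valued integral itself converges in norm by the assumption on the variation of the
kernel, and it is holomorphic off the closure of `Γ`, which is disjoint from the domain of
continuation (`IsDeformation.disjoint_union_closure_curve`).
-/

noncomputable section

/-! ### Projection-valued measures and self-adjoint operators -/

section SpectralTheory

variable {H : Type*} [NormedAddCommGroup H] [InnerProductSpace ℂ H] [CompleteSpace H]

namespace ProjectionValuedMeasure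

variable (E : ProjectionValuedMeasure H)

theorem proj_proj {S T : Set ℝ} (hS : MeasurableSet S) (hT : MeasurableSet T) (x : H) :
    E.proj S (E.proj T x) = E.proj (S ∩ T) x := by
  rw [E.proj_inter S T hS hT]; rfl

theorem proj_self {S : Set ℝ} (hS : MeasurableSet S) (x : H) :
    E.proj S (E.proj S x) = E.proj S x := by
  rw [E.proj_proj hS hS, Set.inter_self]

theorem inner_proj_left {S : Set ℝ} (hS : MeasurableSet S) (x y : H) :
    ⟪E.proj S x, y⟫_ℂ = ⟪x, E.proj S y⟫_ℂ := by
  rw [← ContinuousLinearMap.adjoint_inner_right, (E.isStarProjection S hS).isSelfAdjoint.adjoint_eq]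

theorem inner_proj_self {S : Set ℝ} (hS : MeasurableSet S) (x : H) :
    ⟪x, E.proj S x⟫_ℂ = ((‖E.proj S x‖ ^ 2 : ℝ) : ℂ) := by
  rw [← E.proj_self hS, ← E.inner_proj_left hS, E.proj_self hS, inner_self_eq_norm_sq_to_K]
  norm_cast

theorem scalarMeasure_apply {S : Set ℝ} (hS : MeasurableSet S) (x : H) :
    E.scalarMeasure x S = ENNReal.ofReal (‖E.proj S x‖ ^ 2) := by
  rw [scalarMeasure, Measure.ofMeasurable_apply S hS, E.inner_proj_self hS, Complex.ofReal_re]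

instance isFiniteMeasure_scalarMeasure (x : H) : IsFiniteMeasure (E.scalarMeasure x) :=
  ⟨by rw [E.scalarMeasure_apply MeasurableSet.univ]; exact ENNReal.ofReal_lt_top⟩

theorem measureReal_scalarMeasure {S : Set ℝ} (hS : MeasurableSet S) (x : H) :
    (E.scalarMeasure x).real S = ‖E.proj S x‖ ^ 2 := by
  rw [Measure.real, E.scalarMeasure_apply hS, ENNReal.toReal_ofReal (by positivity)]

theorem scalarMeasure_proj {S : Set ℝ} (hS : MeasurableSet S) (x : H) :
    E.scalarMeasure (E.proj S x) = (E.scalarMeasure x).restrict S := by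
  ext T hT
  rw [Measure.restrict_apply hT, E.scalarMeasure_apply hT, E.scalarMeasure_apply (hT.inter hS),
    E.proj_proj hT hS]

/-- The projection of a vector vanishes exactly on the null sets of its scalar measure, since
`⟪x, E(S) x⟫ = ‖E(S) x‖ ^ 2`. -/
theorem proj_eq_zero_iff {S : Set ℝ} (hS : MeasurableSet S) (x : H) :
    E.proj S x = 0 ↔ E.scalarMeasure x S = 0 := by
  rw [E.scalarMeasure_apply hS, ENNReal.ofReal_eq_zero]
  constructor
  · intro h; simp [h]
  · intro h
    have : ‖E.proj S x‖ ^ 2 = 0 := le_antisymm h (by positivity)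
    simpa using this

theorem hasSum_proj {ι : Type*} [Countable ι] [Infinite ι] {S : ι → Set ℝ}
    (hS : ∀ i, MeasurableSet (S i)) (hd : Pairwise (Function.onFun Disjoint S)) (x : H) :
    HasSum (fun i => E.proj (S i) x) (E.proj (⋃ i, S i) x) := by
  obtain ⟨_⟩ := nonempty_denumerable ι
  have e : ι ≃ ℕ := Denumerable.eqv ι
  have := E.hasSum (S ∘ e.symm) (fun n => hS _) (fun m n hmn => hd (e.symm.injective.ne hmn)) x
  rw [← e.hasSum_iff] at this
  · have h2 : (⋃ n, (S ∘ e.symm) n) = ⋃ i, S i := e.symm.surjective.iUnion_comp S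
    rw [h2] at this
    simpa [Function.comp_def] using this

theorem proj_add_proj_compl {S : Set ℝ} (hS : MeasurableSet S) (x : H) :
    E.proj S x + E.proj Sᶜ x = x := by
  -- the vector `x - E(S) x - E(Sᶜ) x` has vanishing norm by additivity of the scalar measure
  have h0 : E.proj S (E.proj Sᶜ x) = 0 := by
    rw [E.proj_proj hS hS.compl, Set.inter_compl_self, E.proj_empty]
  have h0' : E.proj Sᶜ (E.proj S x) = 0 := by
    rw [E.proj_proj hS.compl hS, Set.compl_inter_self, E.proj_empty]
  set w := x - E.proj S x - E.proj Sᶜ x with hw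
  have h1 : E.proj S w = 0 := by simp [hw, h0, E.proj_self hS]
  have h2 : E.proj Sᶜ w = 0 := by simp [hw, h0', E.proj_self hS.compl]
  have h3 : E.scalarMeasure w Set.univ = 0 := by
    rw [← measure_add_measure_compl hS, (E.proj_eq_zero_iff hS w).1 h1,
      (E.proj_eq_zero_iff hS.compl w).1 h2, add_zero]
  rw [← E.proj_eq_zero_iff MeasurableSet.univ, E.proj_univ] at h3
  have h4 : w = 0 := h3
  rw [hw, sub_sub, sub_eq_zero] at h4
  exact h4.symm

theorem integral_scalarMeasure_proj {F : Type*} [NormedAddCommGroup F] [NormedSpace ℝ F]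
    {S : Set ℝ} (hS : MeasurableSet S) (x : H) (φ : ℝ → F) :
    ∫ s, φ s ∂(E.scalarMeasure (E.proj S x)) = ∫ s in S, φ s ∂(E.scalarMeasure x) := by
  rw [E.scalarMeasure_proj hS]

end ProjectionValuedMeasure

namespace IsSpectralMeasure

variable {A : H →ₗ.[ℂ] H} {E : ProjectionValuedMeasure H}

theorem proj_mem_domain (hE : IsSpectralMeasure A E) {S : Set ℝ} (hS : MeasurableSet S) {x : H}
    (hx : x ∈ A.domain) : E.proj S x ∈ A.domain := by
  rw [hE.mem_domain_iff] at hx ⊢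
  rw [E.scalarMeasure_proj hS]
  exact (setLIntegral_le_lintegral _ _).trans_lt hx

theorem proj_mem_domain_of_bounded (hE : IsSpectralMeasure A E) {S : Set ℝ} (hS : MeasurableSet S)
    {r : ℝ} (hr : ∀ s ∈ S, |s| ≤ r) (x : H) : E.proj S x ∈ A.domain := by
  rw [hE.mem_domain_iff, E.scalarMeasure_proj hS]
  calc ∫⁻ s in S, ‖s‖ₑ ^ 2 ∂(E.scalarMeasure x)
      ≤ ∫⁻ s in S, ENNReal.ofReal r ^ 2 ∂(E.scalarMeasure x) := by
        refine setLIntegral_mono measurable_const fun s hs => ?_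
        gcongr
        rw [Real.enorm_eq_ofReal_abs]
        exact ENNReal.ofReal_le_ofReal (hr s hs)
    _ < ∞ := by
        rw [setLIntegral_const]
        exact ENNReal.mul_lt_top (by simp) (measure_lt_top _ _)

theorem integrable_id (hE : IsSpectralMeasure A E) {x : H} (hx : x ∈ A.domain) :
    Integrable (fun s : ℝ => s) (E.scalarMeasure x) := by
  have h : MemLp (fun s : ℝ => s) 2 (E.scalarMeasure x) := by
    refine ⟨aestronglyMeasurable_id, ?_⟩
    rw [eLpNorm_lt_top_iff_lintegral_rpow_enorm_lt_top (by norm_num) (by norm_num)]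
    simpa using (hE.mem_domain_iff x).1 hx
  exact h.integrable (by norm_num)

/-- The cross terms of the quadratic form of `A` with respect to the decomposition
`1 = E(S) + E(Sᶜ)` vanish. -/
theorem inner_apply_eq_zero (hE : IsSpectralMeasure A E) {S : Set ℝ} (hS : MeasurableSet S)
    (p n : A.domain) (hp : E.proj S p = p) (hn : E.proj S n = 0) : ⟪(p : H), A n⟫_ℂ = 0 := by
  -- the measure of `p + n` is the sum of those of `p` and `n`, hence so is the quadratic form
  have key : ∀ p n : A.domain, E.proj S p = p → E.proj S n = 0 →
      ⟪(p : H), A n⟫_ℂ + ⟪(n : H), A p⟫_ℂ = 0 := by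
    intro p n hp hn
    have hpc : E.proj Sᶜ (p : H) = 0 := by
      have := E.proj_add_proj_compl hS (p : H)
      rw [hp] at this
      simpa using this
    have hnc : E.proj Sᶜ (n : H) = n := by
      have := E.proj_add_proj_compl hS (n : H)
      rw [hn] at this
      simpa using this
    have h1 := hE.inner_apply (p + n)
    have h2 := hE.inner_apply p
    have h3 := hE.inner_apply n
    have e1 : E.proj S ((p + n : A.domain) : H) = p := by simp [hp, hn]
    have e2 : E.proj Sᶜ ((p + n : A.domain) : H) = n := by simp [hpc, hnc]
    rw [← integral_add_compl hS (hE.integrable_id (p + n).2),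
      ← E.integral_scalarMeasure_proj hS, ← E.integral_scalarMeasure_proj hS.compl, e1, e2,
      Complex.ofReal_add, ← h2, ← h3, A.map_add, Submodule.coe_add, inner_add_left, inner_add_right,
      inner_add_right] at h1
    linear_combination h1
  have h1 := key p n hp hn
  -- replacing `p` by `i p` separates the two cross terms
  have h2 := key (Complex.I • p) n (by simp [hp]) hn
  rw [A.map_smul, Submodule.coe_smul, inner_smul_left, inner_smul_right, Complex.conj_I] at h2
  have h3 : Complex.I * (⟪(p : H), A n⟫_ℂ - ⟪(n : H), A p⟫_ℂ) = 0 := by linear_combination -h2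
  have h4 := (mul_eq_zero.1 h3).resolve_left Complex.I_ne_zero
  linear_combination (h1 + h4) / 2

/-- The spectral projections commute with `A`. -/
theorem apply_proj (hA : IsSelfAdjoint A) (hE : IsSpectralMeasure A E) {S : Set ℝ}
    (hS : MeasurableSet S) (u : A.domain) (h : E.proj S (u : H) ∈ A.domain) :
    A ⟨E.proj S u, h⟩ = E.proj S (A u) := by
  have hz : ∀ (T : Set ℝ), MeasurableSet T → ∀ n : A.domain, E.proj T (n : H) = 0 →
      E.proj T (A n) = 0 := by
    intro T hT n hn
    refine hA.dense_domain.eq_zero_of_inner_right ℂ fun v hv => ?_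
    rw [← E.inner_proj_left hT]
    exact hE.inner_apply_eq_zero hT ⟨_, hE.proj_mem_domain hT hv⟩ n (E.proj_self hT v) hn
  have hc := hE.proj_mem_domain hS.compl u.2
  have hu : u = ⟨E.proj S u, h⟩ + ⟨E.proj Sᶜ u, hc⟩ :=
    Subtype.ext (E.proj_add_proj_compl hS (u : H)).symm
  have h1 : E.proj S (A ⟨E.proj Sᶜ u, hc⟩) = 0 := hz S hS _ (by
    rw [E.proj_proj hS hS.compl, Set.inter_compl_self, E.proj_empty])
  have h2 : E.proj Sᶜ (A ⟨E.proj S u, h⟩) = 0 := hz Sᶜ hS.compl _ (by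
    rw [E.proj_proj hS.compl hS, Set.compl_inter_self, E.proj_empty])
  have h3 := E.proj_add_proj_compl hS (A ⟨E.proj S u, h⟩)
  rw [h2, add_zero] at h3
  conv_rhs => rw [hu, A.map_add, map_add, h1, add_zero, h3]

theorem _root_.IsSelfAdjoint.inner_pmap_left (hA : IsSelfAdjoint A) (x y : A.domain) :
    ⟪A x, (y : H)⟫_ℂ = ⟪(x : H), A y⟫_ℂ := by
  have h := LinearPMap.adjoint_isFormalAdjoint hA.dense_domain
  rw [(LinearPMap.isSelfAdjoint_def.1 hA : A.adjoint = A)] at h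
  exact h x y

/-- On the range of `E(S)`, where `S` lies within `ε` of `c`, the operator `A` is within `ε`
of multiplication by `c`. -/
theorem norm_apply_sub_le (hA : IsSelfAdjoint A) (hE : IsSpectralMeasure A E) {S : Set ℝ}
    (hS : MeasurableSet S) {c ε : ℝ} (hε : 0 ≤ ε) (hc : ∀ s ∈ S, |s - c| ≤ ε) (u : A.domain)
    (hu : E.proj S (u : H) = u) : ‖A u - (c : ℂ) • (u : H)‖ ≤ ε * ‖(u : H)‖ := by
  -- the quadratic form of `A - c` on the range of `E(S)`
  have hq : ∀ v : A.domain, E.proj S (v : H) = v →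
      |(⟪(v : H), A v - (c : ℂ) • (v : H)⟫_ℂ).re| ≤ ε * ‖(v : H)‖ ^ 2 := by
    intro v hv
    have h1 := hE.inner_apply v
    have hi := hE.integrable_id v.2
    have hn : (E.scalarMeasure (v : H)).real Set.univ = ‖(v : H)‖ ^ 2 := by
      rw [E.measureReal_scalarMeasure MeasurableSet.univ, E.proj_univ]; rfl
    have h2 : (⟪(v : H), A v - (c : ℂ) • (v : H)⟫_ℂ).re
        = ∫ s, (s - c) ∂(E.scalarMeasure (v : H)) := by
      rw [inner_sub_right, inner_smul_right, h1, inner_self_eq_norm_sq_to_K,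
        integral_sub hi (integrable_const _), integral_const, hn]
      norm_cast
      simp only [Complex.coe_algebraMap, smul_eq_mul, Complex.sub_re, Complex.ofReal_re,
        Complex.re_ofReal_mul]
      rw [mul_comm]
    have hae : ∀ᵐ s ∂(E.scalarMeasure (v : H)), ‖s - c‖ ≤ ε := by
      rw [← hv, E.scalarMeasure_proj hS]
      exact (ae_restrict_iff' hS).2 (Eventually.of_forall fun s hs => hc s hs)
    rw [h2, ← Real.norm_eq_abs]
    calc _ ≤ ε * (E.scalarMeasure (v : H)).real Set.univ := norm_integral_le_of_norm_le_const hae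
      _ = _ := by rw [hn]
  obtain ⟨T, hT⟩ : ∃ T : A.domain → H, ∀ v, T v = A v - (c : ℂ) • (v : H) := ⟨_, fun _ => rfl⟩
  simp only [← hT] at hq ⊢
  have hTadd : ∀ v w, T (v + w) = T v + T w := by
    intro v w; simp only [hT, A.map_add, Submodule.coe_add, smul_add]; abel
  have hTsub : ∀ v w, T (v - w) = T v - T w := by
    intro v w; simp only [hT, A.map_sub, Submodule.coe_sub, smul_sub]; abel
  have hsym : ∀ v w : A.domain, (⟪(v : H), T w⟫_ℂ).re = (⟪(w : H), T v⟫_ℂ).re := by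
    intro v w
    simp only [hT, inner_sub_right, inner_smul_right, Complex.sub_re]
    rw [← hA.inner_pmap_left, ← inner_conj_symm, Complex.conj_re, Complex.re_ofReal_mul,
      Complex.re_ofReal_mul, ← inner_conj_symm (v : H) (w : H), Complex.conj_re]
  -- polarization
  have hpol : ∀ v w : A.domain, E.proj S (v : H) = v → E.proj S (w : H) = w →
      2 * (⟪(v : H), T w⟫_ℂ).re ≤ ε * (‖(v : H)‖ ^ 2 + ‖(w : H)‖ ^ 2) := by
    intro v w hv hw
    have h1 := (abs_le.1 (hq (v + w) (by simp [hv, hw]))).2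
    have h2 := (abs_le.1 (hq (v - w) (by simp [hv, hw]))).1
    have h3 := parallelogram_law_with_norm ℂ (v : H) (w : H)
    rw [hTadd, Submodule.coe_add, inner_add_left, inner_add_right, inner_add_right] at h1
    rw [hTsub, Submodule.coe_sub, inner_sub_left, inner_sub_right, inner_sub_right] at h2
    simp only [Complex.add_re, Complex.sub_re] at h1 h2
    have h4 := hsym v w
    nlinarith
  -- test with the multiple of `T u` that has the norm of `u`
  have hTu : E.proj S (T u) = T u := by
    have h := hE.apply_proj hA hS u (hE.proj_mem_domain hS u.2)
    have h' : (⟨E.proj S u, hE.proj_mem_domain hS u.2⟩ : A.domain) = u := Subtype.ext hu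
    rw [h'] at h
    simp only [hT, map_sub, map_smul, hu, ← h]
  have hb : ∀ s ∈ S, |s| ≤ |c| + ε := by
    intro s hs
    have := hc s hs
    have h2 := abs_add_le (s - c) c
    rw [sub_add_cancel] at h2
    linarith
  have hdom : T u ∈ A.domain := hTu ▸ hE.proj_mem_domain_of_bounded hS hb (T u)
  by_cases h0 : T u = 0
  · rw [h0, norm_zero]; positivity
  have hpos : 0 < ‖T u‖ := norm_pos_iff.2 h0
  set r : ℝ := ‖(u : H)‖ / ‖T u‖ with hr
  have h1 := hpol ((r : ℂ) • ⟨T u, hdom⟩) u (by simp [hTu]) hu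
  have hrn : ‖(((r : ℂ) • (⟨T u, hdom⟩ : A.domain) : A.domain) : H)‖ = ‖(u : H)‖ := by
    rw [Submodule.coe_smul, norm_smul, Complex.norm_real, Real.norm_of_nonneg (by positivity), hr]
    field_simp
  rw [hrn, Submodule.coe_smul, inner_smul_left, Complex.conj_ofReal,
    inner_self_eq_norm_sq_to_K] at h1
  have h2 : (((r : ℝ) : ℂ) * ((‖T u‖ : ℝ) : ℂ) ^ 2).re = ‖(u : H)‖ * ‖T u‖ := by
    rw [hr]; norm_cast; field_simp
  have h3 : 2 * (‖(u : H)‖ * ‖T u‖) ≤ ε * (‖(u : H)‖ ^ 2 + ‖(u : H)‖ ^ 2) := by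
    rw [← h2]; exact h1
  rcases (norm_nonneg (u : H)).eq_or_lt with h | h
  · exfalso
    have : u = 0 := Subtype.ext (norm_eq_zero.1 h.symm)
    apply h0
    simp [hT, this]
  · nlinarith

end IsSpectralMeasure
end SpectralTheory

/-! ### Quadratic forms of the resolvent -/

section Resolvent

variable {H : Type*} [NormedAddCommGroup H] [InnerProductSpace ℂ H] [CompleteSpace H]
  {A : H →ₗ.[ℂ] H} {E : ProjectionValuedMeasure H}

namespace IsSpectralMeasure

/-- The spectral measure vanishes near a real point of the resolvent set: on the range of the
projection to a small interval around the point, `A` is too close to a scalar. -/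
theorem scalarMeasure_compl_eq_zero (hA : IsSelfAdjoint A) (hE : IsSpectralMeasure A E) {C : Set ℝ}
    (hC : ∀ c ∉ C, ∃ R : H →L[ℂ] H, IsResolventAt A (c : ℂ) R) (y : H) :
    E.scalarMeasure y Cᶜ = 0 := by
  refine measure_null_of_locally_null _ fun c hc => ?_
  obtain ⟨R, hR⟩ := hC c hc
  -- any `ε` with `‖R‖ ε < 1` will do
  set ε : ℝ := (‖R‖ + 1)⁻¹ with hε
  have hpos : 0 < ε := by positivity
  refine ⟨Metric.closedBall c ε, mem_nhdsWithin_of_mem_nhds (Metric.closedBall_mem_nhds c hpos), ?_⟩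
  have hS : MeasurableSet (Metric.closedBall c ε) := Metric.isClosed_closedBall.measurableSet
  rw [← E.proj_eq_zero_iff hS]
  have hb : ∀ s ∈ Metric.closedBall c ε, |s - c| ≤ ε := fun s hs => by
    rwa [Metric.mem_closedBall, Real.dist_eq] at hs
  have hb' : ∀ s ∈ Metric.closedBall c ε, |s| ≤ |c| + ε := fun s hs => by
    have := hb s hs
    have h2 := abs_add_le (s - c) c
    rw [sub_add_cancel] at h2
    linarith
  set u : A.domain := ⟨_, hE.proj_mem_domain_of_bounded hS hb' y⟩ with hu
  have h1 := hE.norm_apply_sub_le hA hS hpos.le hb u (E.proj_self hS y)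
  have h2 := hR.2 u
  have h3 : ‖(u : H)‖ ≤ ‖R‖ * (ε * ‖(u : H)‖) := by
    conv_lhs => rw [← h2]
    refine (R.le_opNorm _).trans ?_
    rw [norm_sub_rev]
    gcongr
  have h4 : ‖R‖ * ε < 1 := by
    rw [hε, ← div_eq_mul_inv, div_lt_one (by positivity)]; linarith
  by_contra h0
  have : 0 < ‖(u : H)‖ := norm_pos_iff.2 h0
  nlinarith

/-- On a small set `S`, the resolvent is close to multiplication by `(z - c)⁻¹`. -/
theorem norm_inner_proj_resolvent_sub_le (hA : IsSelfAdjoint A) (hE : IsSpectralMeasure A E)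
    {C : Set ℝ} {y : H} (hC : E.scalarMeasure y Cᶜ = 0) {z : ℂ} {R : H →L[ℂ] H}
    (hR : IsResolventAt A z R) {d : ℝ} (hd : 0 < d) (hdC : ∀ c ∈ C, d ≤ ‖z - c‖) {S : Set ℝ}
    (hS : MeasurableSet S) {ε : ℝ} (hε : 0 ≤ ε) (hSε : ∀ s ∈ S, ∀ t ∈ S, |s - t| ≤ ε) :
    ‖⟪y, E.proj S (R y)⟫_ℂ - ∫ t in S, (z - t)⁻¹ ∂(E.scalarMeasure y)‖
      ≤ ((‖R‖ / d + 1 / d ^ 2) * ε) * (E.scalarMeasure y).real S := by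
  -- if `S` misses `C`, then both terms vanish; otherwise compare with `(z - c)⁻¹` for some
  -- `c` in `S ∩ C`
  rcases (S ∩ C).eq_empty_or_nonempty with h0 | ⟨c, hcS, hcC⟩
  · have hz : E.scalarMeasure y S = 0 :=
      measure_mono_null (fun s hs hsC => (h0 ▸ ⟨hs, hsC⟩ : s ∈ (∅ : Set ℝ))) hC
    rw [← E.inner_proj_left hS, (E.proj_eq_zero_iff hS y).2 hz, inner_zero_left,
      Measure.restrict_eq_zero.2 hz, integral_zero_measure, sub_zero, norm_zero]
    positivity
  have hb : ∀ s ∈ S, |s - c| ≤ ε := fun s hs => hSε s hs c hcS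
  have hb' : ∀ s ∈ S, |s| ≤ |c| + ε := fun s hs => by
    have := hb s hs
    have h2 := abs_add_le (s - c) c
    rw [sub_add_cancel] at h2
    linarith
  have hdc := hdC c hcC
  have hzc : z - c ≠ 0 := norm_pos_iff.1 (hd.trans_le hdc)
  obtain ⟨hu, hzu⟩ := hR.1 y
  have hv := hE.proj_mem_domain hS hu
  have hw := hE.proj_mem_domain_of_bounded hS hb' y
  set w : A.domain := ⟨E.proj S y, hw⟩ with hw_def
  have hwS : E.proj S (w : H) = w := E.proj_self hS y
  set v : A.domain := ⟨E.proj S (R y), hv⟩ with hv_def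
  have hzv : z • (v : H) - A v = w := by
    rw [hE.apply_proj hA hS ⟨R y, hu⟩ hv, ← map_smul, ← map_sub, hzu]
  have hRw : R w = v := by rw [← hzv]; exact hR.2 v
  have he := hE.norm_apply_sub_le hA hS hε hb w hwS
  set e := A w - (c : ℂ) • (w : H) with he_def
  -- apply `R` to `(z - c) w = (z - A) w + (A - c) w`
  have hw2 : (w : H) = (z - c) • (v : H) - R e := by
    rw [← hRw, ← map_smul, ← map_sub, he_def]
    conv_lhs => rw [← hR.2 w]
    congr 1
    module
  have hn : (E.scalarMeasure y).real S = ‖(w : H)‖ ^ 2 := E.measureReal_scalarMeasure hS y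
  have h1 : ⟪y, E.proj S (R y)⟫_ℂ = ⟪(w : H), v⟫_ℂ := by
    rw [← E.proj_self hS, ← E.inner_proj_left hS]
  have h2 : ⟪(w : H), (v : H)⟫_ℂ - (z - c)⁻¹ * ((‖(w : H)‖ ^ 2 : ℝ) : ℂ)
      = (z - c)⁻¹ * ⟪(w : H), R e⟫_ℂ := by
    have h3 : ((‖(w : H)‖ ^ 2 : ℝ) : ℂ) = ⟪(w : H), w⟫_ℂ := by
      rw [inner_self_eq_norm_sq_to_K]; norm_cast
    have h4 : ⟪(w : H), w⟫_ℂ = (z - c) * ⟪(w : H), v⟫_ℂ - ⟪(w : H), R e⟫_ℂ := by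
      conv_lhs => rw [hw2, inner_sub_right, inner_smul_right]
      rw [← hw2]
    rw [h3, h4]
    field_simp
    ring
  have hinv : ‖(z - c)⁻¹‖ ≤ d⁻¹ := by
    rw [norm_inv]; gcongr
  have h5 : ‖⟪(w : H), (v : H)⟫_ℂ - (z - c)⁻¹ * ((‖(w : H)‖ ^ 2 : ℝ) : ℂ)‖
      ≤ ‖R‖ / d * ε * ‖(w : H)‖ ^ 2 := by
    rw [h2, norm_mul]
    calc _ ≤ d⁻¹ * (‖(w : H)‖ * (‖R‖ * (ε * ‖(w : H)‖))) := by
          gcongr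
          exact (norm_inner_le_norm _ _).trans (by gcongr; exact (R.le_opNorm _).trans (by gcongr))
      _ = _ := by ring
  have hae : ∀ᵐ t : ℝ ∂((E.scalarMeasure y).restrict S),
      ‖(z - t)⁻¹ - (z - c)⁻¹‖ ≤ 1 / d ^ 2 * ε := by
    have h6 : ∀ᵐ t : ℝ ∂(E.scalarMeasure y), t ∈ C := hC
    filter_upwards [ae_restrict_of_ae h6, ae_restrict_mem hS] with t htC htS
    have hdt := hdC t htC
    have hzt : z - t ≠ 0 := norm_pos_iff.1 (hd.trans_le hdt)
    have h7 : (z - t)⁻¹ - (z - c)⁻¹ = (z - t)⁻¹ * (z - c)⁻¹ * ((t - c : ℝ) : ℂ) := by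
      push_cast
      field_simp
      ring
    have hinv' : ‖(z - t)⁻¹‖ ≤ d⁻¹ := by
      rw [norm_inv]; gcongr
    rw [h7, norm_mul, norm_mul, Complex.norm_real]
    calc _ ≤ d⁻¹ * d⁻¹ * ε := by gcongr; exact hb t htS
      _ = _ := by ring
  have hint : Integrable (fun t : ℝ => (z - t)⁻¹) ((E.scalarMeasure y).restrict S) := by
    refine Integrable.of_bound (C := d⁻¹) (by fun_prop) ?_
    have h6 : ∀ᵐ t : ℝ ∂(E.scalarMeasure y), t ∈ C := hC
    filter_upwards [ae_restrict_of_ae h6] with t htC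
    have hdt := hdC t htC
    rw [norm_inv]; gcongr
  have h8 : ‖(∫ t in S, (z - t)⁻¹ ∂(E.scalarMeasure y)) - (z - c)⁻¹ * ((‖(w : H)‖ ^ 2 : ℝ) : ℂ)‖
      ≤ 1 / d ^ 2 * ε * ‖(w : H)‖ ^ 2 := by
    have h9 := norm_integral_le_of_norm_le_const hae
    rw [integral_sub hint (integrable_const _), integral_const] at h9
    simp only [measureReal_restrict_apply_univ, hn] at h9
    rw [mul_comm ((z - c : ℂ)⁻¹)]
    exact h9
  rw [h1, hn]
  calc _ = ‖(⟪(w : H), (v : H)⟫_ℂ - (z - c)⁻¹ * ((‖(w : H)‖ ^ 2 : ℝ) : ℂ)) -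
        ((∫ t in S, (z - t)⁻¹ ∂(E.scalarMeasure y)) - (z - c)⁻¹ * ((‖(w : H)‖ ^ 2 : ℝ) : ℂ))‖ := by
          congr 1; ring
    _ ≤ _ := (norm_sub_le _ _).trans (add_le_add h5 h8)
    _ = _ := by ring

/-- The spectral representation of the quadratic form of the resolvent. -/
theorem inner_resolvent (hA : IsSelfAdjoint A) (hE : IsSpectralMeasure A E)
    {C : Set ℝ} {y : H} (hC : E.scalarMeasure y Cᶜ = 0) {z : ℂ} {R : H →L[ℂ] H}
    (hR : IsResolventAt A z R) {d : ℝ} (hd : 0 < d) (hdC : ∀ c ∈ C, d ≤ ‖z - c‖) :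
    ⟪y, R y⟫_ℂ = ∫ t, (z - t)⁻¹ ∂(E.scalarMeasure y) := by
  have hint : Integrable (fun t : ℝ => (z - t)⁻¹) (E.scalarMeasure y) := by
    refine Integrable.of_bound (C := d⁻¹) (by fun_prop) ?_
    have h6 : ∀ᵐ t : ℝ ∂(E.scalarMeasure y), t ∈ C := hC
    filter_upwards [h6] with t htC
    have hdt := hdC t htC
    rw [norm_inv]; gcongr
  -- sum the local estimates over a partition of the line into intervals of length `ε`
  have key : ∀ ε : ℝ, 0 < ε → ‖⟪y, R y⟫_ℂ - ∫ t, (z - t)⁻¹ ∂(E.scalarMeasure y)‖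
      ≤ ((‖R‖ / d + 1 / d ^ 2) * ε) * ‖y‖ ^ 2 := by
    intro ε hε
    set S : ℤ → Set ℝ := fun n => Set.Ico (0 + n • ε) (0 + (n + 1) • ε) with hS_def
    have hS : ∀ n, MeasurableSet (S n) := fun n => measurableSet_Ico
    have hdj : Pairwise (Function.onFun Disjoint S) := Set.pairwise_disjoint_Ico_add_zsmul 0 ε
    have hU : ⋃ n, S n = Set.univ := iUnion_Ico_add_zsmul hε 0
    have h1 := (innerSL ℂ y).hasSum (E.hasSum_proj hS hdj (R y))
    have h2 : HasSum (fun n => ∫ t in S n, (z - t)⁻¹ ∂(E.scalarMeasure y)) _ :=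
      hasSum_integral_iUnion hS hdj hint.integrableOn
    have h3 : HasSum (fun n => (E.scalarMeasure y).real (S n)) (‖y‖ ^ 2) := by
      have := Complex.hasSum_re ((innerSL ℂ y).hasSum (E.hasSum_proj hS hdj y))
      rw [hU, E.proj_univ] at this
      simp only [innerSL_apply_apply, E.inner_proj_self (hS _),
        Complex.ofReal_re, ← E.measureReal_scalarMeasure (hS _)] at this
      convert this using 1
      change _ = (⟪y, y⟫_ℂ).re
      rw [inner_self_eq_norm_sq_to_K]
      norm_cast
    rw [hU] at h1 h2
    rw [E.proj_univ] at h1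
    rw [setIntegral_univ] at h2
    refine (h1.sub h2).norm_le_of_bounded (h3.mul_left _) fun n => ?_
    refine hE.norm_inner_proj_resolvent_sub_le hA hC hR hd hdC (hS n) hε.le ?_
    intro s hs t ht
    simp only [hS_def, Set.mem_Ico, zero_add, add_smul, one_smul] at hs ht
    rw [abs_le]
    constructor <;> linarith [hs.1, hs.2, ht.1, ht.2]
  have hlim : Tendsto (fun ε : ℝ => ((‖R‖ / d + 1 / d ^ 2) * ε) * ‖y‖ ^ 2) (𝓝[>] 0) (𝓝 0) := by
    have : Continuous (fun ε : ℝ => ((‖R‖ / d + 1 / d ^ 2) * ε) * ‖y‖ ^ 2) := by fun_prop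
    have h := this.tendsto 0
    simp only [mul_zero, zero_mul] at h
    exact h.mono_left nhdsWithin_le_nhds
  have := ge_of_tendsto hlim (eventually_mem_nhdsWithin.mono key)
  exact sub_eq_zero.1 (norm_le_zero_iff.1 this)

end IsSpectralMeasure
end Resolvent

/-! ### The density of the kernel -/

section Interval

variable {a b : EReal}

theorem isOpen_realInterval : IsOpen (realInterval a b) :=
  (isOpen_Ioi.preimage continuous_coe_real_ereal).inter
    (isOpen_Iio.preimage continuous_coe_real_ereal)

theorem ordConnected_realInterval : (realInterval a b).OrdConnected :=
  ⟨fun _ hx _ hy _ hz => ⟨hx.1.trans_le (EReal.coe_le_coe_iff.2 hz.1),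
    (EReal.coe_le_coe_iff.2 hz.2).trans_lt hy.2⟩⟩

theorem measurableSet_realInterval : MeasurableSet (realInterval a b) :=
  isOpen_realInterval.measurableSet

theorem isPreconnected_realInterval : IsPreconnected (realInterval a b) :=
  ordConnected_realInterval.isPreconnected

theorem nonempty_realInterval (hab : a < b) : (realInterval a b).Nonempty := by
  obtain ⟨x, h1, h2⟩ := EReal.lt_iff_exists_real_btwn.1 hab
  exact ⟨x, h1, h2⟩

theorem volume_closure_realInterval_diff :
    volume (closure (realInterval a b) \ realInterval a b) = 0 := by
  rw [← isOpen_realInterval.frontier_eq]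
  exact ordConnected_realInterval.convex.addHaar_frontier volume

end Interval

section Density

/-- A finite measure on an open interval whose distribution function is continuously
differentiable has the derivative as its density. -/
theorem restrict_eq_withDensity_of_hasDerivAt {μ : Measure ℝ} [IsFiniteMeasure μ] {J : Set ℝ}
    (hJ : IsOpen J) {g : ℝ → ℝ} (hg : ContinuousOn g J)
    (hg0 : ∀ t ∈ J, 0 ≤ g t)
    (hd : ∀ t ∈ J, HasDerivAt (fun t => μ.real (Set.Iio t)) (g t) t) :
    μ.restrict J = (volume.restrict J).withDensity (fun t => ENNReal.ofReal (g t)) := by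
  -- the two measures agree on the intervals `[c, d)` contained in `J`
  have hI : ∀ c d : ℝ, c ≤ d → Set.Icc c d ⊆ J → μ (Set.Ico c d)
      = ∫⁻ t in Set.Ico c d, ENNReal.ofReal (g t) := by
    intro c d hcd hsub
    have hgc : ContinuousOn g (Set.Icc c d) := hg.mono hsub
    have h1 : ∫ t in c..d, g t = μ.real (Set.Iio d) - μ.real (Set.Iio c) :=
      intervalIntegral.integral_eq_sub_of_hasDerivAt
        (fun t ht => hd t (hsub (Set.uIcc_of_le hcd ▸ ht)))
        (hgc.intervalIntegrable_of_Icc hcd)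
    have h2 : μ.real (Set.Ico c d) = μ.real (Set.Iio d) - μ.real (Set.Iio c) := by
      rw [← Set.Iio_sdiff_Iio, measureReal_sdiff (Set.Iio_subset_Iio hcd) measurableSet_Iio]
    rw [intervalIntegral.integral_of_le hcd, ← integral_Ico_eq_integral_Ioc] at h1
    have h3 : ∫⁻ t in Set.Ico c d, ENNReal.ofReal (g t)
        = ENNReal.ofReal (∫ t in Set.Ico c d, g t) := by
      rw [ofReal_integral_eq_lintegral_ofReal]
      · exact (hgc.integrableOn_Icc).mono_set Set.Ico_subset_Icc_self
      · exact (ae_restrict_iff' measurableSet_Ico).2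
          (Eventually.of_forall fun t ht => hg0 t (hsub (Set.Ico_subset_Icc_self ht)))
    rw [h3, h1, ← h2, ofReal_measureReal]
  set ν : Measure ℝ := (volume.restrict J).withDensity (fun t => ENNReal.ofReal (g t)) with hν
  have hνI : ∀ c d : ℝ, c ≤ d → Set.Icc c d ⊆ J → ν (Set.Ico c d) = μ (Set.Ico c d) := by
    intro c d hcd hsub
    rw [hI c d hcd hsub, hν, withDensity_apply _ measurableSet_Ico, Measure.restrict_restrict
      measurableSet_Ico, Set.inter_eq_self_of_subset_left (Set.Ico_subset_Icc_self.trans hsub)]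
  have hνJ : ν = ν.restrict J := by
    rw [hν, restrict_withDensity hJ.measurableSet, Measure.restrict_restrict hJ.measurableSet,
      Set.inter_self]
  rw [hνJ]
  -- exhaust `J` by intervals with rational end points
  set S : {p : ℚ × ℚ // Set.Icc (p.1 : ℝ) p.2 ⊆ J} → Set ℝ := fun p => Set.Ico p.1.1 p.1.2 with hS
  have hU : J = ⋃ p, S p := by
    apply Set.Subset.antisymm
    · intro t ht
      obtain ⟨ε, hε, hb⟩ := Metric.isOpen_iff.1 hJ t ht
      obtain ⟨p, hp1, hp2⟩ := exists_rat_btwn (show t - ε < t by linarith)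
      obtain ⟨q, hq1, hq2⟩ := exists_rat_btwn (show t < t + ε by linarith)
      have hsub : Set.Icc (p : ℝ) q ⊆ J := fun s hs => hb (by
        rw [Metric.mem_ball, Real.dist_eq, abs_lt]
        constructor <;> linarith [hs.1, hs.2])
      exact Set.mem_iUnion.2 ⟨⟨(p, q), hsub⟩, hp2.le, hq1⟩
    · exact Set.iUnion_subset fun p => Set.Ico_subset_Icc_self.trans p.2
  rw [hU, Measure.restrict_iUnion_congr]
  rintro ⟨⟨p, q⟩, hpq⟩
  refine Measure.ext_of_Ico _ _ fun c d hcd => ?_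
  rw [Measure.restrict_apply measurableSet_Ico, Measure.restrict_apply measurableSet_Ico,
    hS, Set.Ico_inter_Ico]
  rcases le_total (max c (p : ℝ)) (min d (q : ℝ)) with h | h
  · exact (hνI _ _ h ((Set.Icc_subset_Icc (le_max_right _ _) (min_le_right _ _)).trans hpq)).symm
  · rw [Set.Ico_eq_empty (not_lt.2 h), measure_empty, measure_empty]

end Density

section Kernel

variable {H₀ H₁ : Type*} [NormedAddCommGroup H₀] [InnerProductSpace ℂ H₀] [CompleteSpace H₀]
  [NormedAddCommGroup H₁] [InnerProductSpace ℂ H₁] [CompleteSpace H₁]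
  {E : ProjectionValuedMeasure H₀} {B : H₀ →L[ℂ] H₁} {a b : EReal} {D : Set ℂ}
  {G : ℂ → H₁ →L[ℂ] H₁}

theorem inner_kernelFunction (x : H₁) (t : ℝ) :
    ⟪x, kernelFunction E B t x⟫_ℂ
      = (((E.scalarMeasure (B.adjoint x)).real (Set.Iio t) : ℝ) : ℂ) := by
  rw [E.measureReal_scalarMeasure measurableSet_Iio, ← E.inner_proj_self measurableSet_Iio,
    ContinuousLinearMap.adjoint_inner_left]
  rfl

namespace IsContinuedDerivative

variable (hG : IsContinuedDerivative (kernelFunction E B) a b D G)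
include hG

theorem hasDerivAt_inner (x : H₁) {t : ℝ} (ht : t ∈ realInterval a b) :
    HasDerivAt (fun t : ℝ => (((E.scalarMeasure (B.adjoint x)).real (Set.Iio t) : ℝ) : ℂ))
      ⟪x, G t x⟫_ℂ t := by
  have h := (((innerSL ℂ x).comp (ContinuousLinearMap.apply ℂ H₁ x)).restrictScalars
    ℝ).hasFDerivAt.comp_hasDerivAt t (hG.hasDerivAt t ht)
  exact h.congr_of_eventuallyEq (Eventually.of_forall fun s => (inner_kernelFunction x s).symm)

theorem hasDerivAt_measureReal (x : H₁) {t : ℝ} (ht : t ∈ realInterval a b) :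
    HasDerivAt (fun t : ℝ => (E.scalarMeasure (B.adjoint x)).real (Set.Iio t))
      (⟪x, G t x⟫_ℂ).re t := by
  have h := Complex.reCLM.hasFDerivAt.comp_hasDerivAt t (hG.hasDerivAt_inner x ht)
  exact h

/-- The quadratic form of the kernel is the derivative of a real function. -/
theorem inner_im_eq_zero (x : H₁) {t : ℝ} (ht : t ∈ realInterval a b) :
    (⟪x, G t x⟫_ℂ).im = 0 := by
  have h := Complex.imCLM.hasFDerivAt.comp_hasDerivAt t (hG.hasDerivAt_inner x ht)
  exact h.unique (hasDerivAt_const t (0 : ℝ))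

theorem inner_re_nonneg (x : H₁) {t : ℝ} (ht : t ∈ realInterval a b) :
    0 ≤ (⟪x, G t x⟫_ℂ).re := by
  rw [← (hG.hasDerivAt_measureReal x ht).deriv]
  refine Monotone.deriv_nonneg (fun s t hst => ?_)
  exact measureReal_mono (Set.Iio_subset_Iio hst)

theorem continuousOn_inner (x : H₁) :
    ContinuousOn (fun μ => ⟪x, G μ x⟫_ℂ)
      (D ∪ (fun t : ℝ => (t : ℂ)) '' closure (realInterval a b)) :=
  ((innerSL ℂ x).comp (ContinuousLinearMap.apply ℂ H₁ x)).continuous.comp_continuousOn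
    hG.continuousOn

theorem differentiableOn_inner (x : H₁) : DifferentiableOn ℂ (fun μ => ⟪x, G μ x⟫_ℂ) D :=
  ((innerSL ℂ x).comp (ContinuousLinearMap.apply ℂ H₁ x)).differentiable.comp_differentiableOn
    hG.differentiableOn

theorem continuousOn_inner_real (x : H₁) :
    ContinuousOn (fun t : ℝ => ⟪x, G t x⟫_ℂ) (realInterval a b) :=
  (hG.continuousOn_inner x).comp Complex.continuous_ofReal.continuousOn
    fun t ht => Or.inr ⟨t, subset_closure ht, rfl⟩

/-- The derivative of the kernel is the density of the measures `⟪B₀₁ x, E(·) B₀₁ x⟫`. -/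
theorem restrict_scalarMeasure (x : H₁) :
    (E.scalarMeasure (B.adjoint x)).restrict (realInterval a b)
      = (volume.restrict (realInterval a b)).withDensity
        (fun t => ENNReal.ofReal (⟪x, G t x⟫_ℂ).re) :=
  restrict_eq_withDensity_of_hasDerivAt isOpen_realInterval
    (Complex.continuous_re.comp_continuousOn (hG.continuousOn_inner_real x))
    (fun _ ht => hG.inner_re_nonneg x ht) (fun _ ht => hG.hasDerivAt_measureReal x ht)

theorem aemeasurable_density (x : H₁) :
    AEMeasurable (fun t : ℝ => ENNReal.ofReal (⟪x, G t x⟫_ℂ).re)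
      (volume.restrict (realInterval a b)) :=
  ((Complex.continuous_re.comp_continuousOn (hG.continuousOn_inner_real x)).aemeasurable
    measurableSet_realInterval).ennreal_ofReal

theorem integrableOn_inner (x : H₁) :
    IntegrableOn (fun t : ℝ => ⟪x, G t x⟫_ℂ) (realInterval a b) := by
  refine ⟨(hG.continuousOn_inner_real x).aestronglyMeasurable measurableSet_realInterval, ?_⟩
  have h1 : ∫⁻ t in realInterval a b, ‖⟪x, G t x⟫_ℂ‖ₑ
      = ∫⁻ t in realInterval a b, ENNReal.ofReal (⟪x, G t x⟫_ℂ).re := by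
    refine setLIntegral_congr_fun measurableSet_realInterval fun t ht => ?_
    have h2 : ⟪x, G t x⟫_ℂ = (((⟪x, G t x⟫_ℂ).re : ℝ) : ℂ) :=
      Complex.ext (by simp) (by simp [hG.inner_im_eq_zero x ht])
    rw [← ofReal_norm, h2, Complex.norm_real, Real.norm_of_nonneg (hG.inner_re_nonneg x ht),
      Complex.ofReal_re]
  rw [HasFiniteIntegral, h1]
  have h3 := congrArg (fun μ : Measure ℝ => μ Set.univ) (hG.restrict_scalarMeasure x)
  simp only [withDensity_apply _ MeasurableSet.univ, Measure.restrict_univ] at h3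
  rw [← h3]
  exact measure_lt_top _ _

/-- The quadratic form of `V₁(z)` is the Cauchy transform of the density. -/
theorem inner_physicalV {A₀ : H₀ →ₗ.[ℂ] H₀} (hA₀ : IsSelfAdjoint A₀)
    (hE : IsSpectralMeasure A₀ E) (hac : ∀ x, (E.scalarMeasure x).AbsolutelyContinuous volume)
    (hσ₀ : opSpectrum A₀ = (fun t : ℝ => (t : ℂ)) '' closure (realInterval a b)) (x : H₁) {z : ℂ}
    (hz : z ∉ (fun t : ℝ => (t : ℂ)) '' closure (realInterval a b)) :
    ⟪x, physicalV A₀ B z x⟫_ℂ = ∫ t in realInterval a b, (z - t)⁻¹ * ⟪x, G t x⟫_ℂ := by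
  have hres : ∀ w ∉ (fun t : ℝ => (t : ℂ)) '' closure (realInterval a b),
      ∃ R : H₀ →L[ℂ] H₀, IsResolventAt A₀ w R := by
    intro w hw
    rw [← hσ₀] at hw
    simpa [opSpectrum] using hw
  have hR : IsResolventAt A₀ z (opResolvent A₀ z) := by
    rw [opResolvent, dif_pos (hres z hz)]
    exact (hres z hz).choose_spec
  set y := B.adjoint x with hy
  have hC : E.scalarMeasure y (closure (realInterval a b))ᶜ = 0 :=
    hE.scalarMeasure_compl_eq_zero hA₀ (fun c hc => hres c (by
      rintro ⟨t, ht, h⟩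
      exact hc (Complex.ofReal_injective h ▸ ht))) y
  have hcl : IsClosed ((fun t : ℝ => (t : ℂ)) '' closure (realInterval a b)) :=
    Complex.isometry_ofReal.isClosedEmbedding.isClosedMap _ isClosed_closure
  obtain ⟨d, hd, hdz⟩ := Metric.isOpen_iff.1 hcl.isOpen_compl z hz
  have hdC : ∀ c ∈ closure (realInterval a b), d ≤ ‖z - c‖ := by
    intro c hc
    by_contra! h
    have h' : (c : ℂ) ∈ Metric.ball z d := by
      rwa [Metric.mem_ball, dist_eq_norm, norm_sub_rev]
    exact hdz h' ⟨c, hc, rfl⟩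
  have h1 := hE.inner_resolvent hA₀ hC hR hd hdC
  have h2 : ⟪x, physicalV A₀ B z x⟫_ℂ = ⟪y, opResolvent A₀ z y⟫_ℂ := by
    rw [hy, ContinuousLinearMap.adjoint_inner_left]; rfl
  -- absolute continuity removes the end points of the interval
  have hJ : E.scalarMeasure y (realInterval a b)ᶜ = 0 := by
    refine measure_mono_null (t := (closure (realInterval a b))ᶜ ∪
      (closure (realInterval a b) \ realInterval a b)) ?_
      (measure_union_null hC (hac y volume_closure_realInterval_diff))
    intro t ht
    by_cases h : t ∈ closure (realInterval a b)
    · exact Or.inr ⟨h, ht⟩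
    · exact Or.inl h
  have h3 : (E.scalarMeasure y).restrict (realInterval a b) = E.scalarMeasure y :=
    Measure.restrict_eq_self_of_ae_mem hJ
  rw [h2, h1, ← h3, hG.restrict_scalarMeasure x,
    integral_withDensity_eq_integral_toReal_smul₀ (hG.aemeasurable_density x)
      (Eventually.of_forall fun _ => ENNReal.ofReal_lt_top)]
  refine setIntegral_congr_fun measurableSet_realInterval fun t ht => ?_
  have h2 : ⟪x, G t x⟫_ℂ = (((⟪x, G t x⟫_ℂ).re : ℝ) : ℂ) :=
    Complex.ext (by simp) (by simp [hG.inner_im_eq_zero x ht])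
  rw [ENNReal.toReal_ofReal (hG.inner_re_nonneg x ht), Complex.real_smul, ← h2, mul_comm]

end IsContinuedDerivative
end Kernel

/-! ### Topology of the deformation -/

section Deformation

/-- The data of a deformation `h` of the interval `(a, b)` into the curve `γ`, sweeping the domain
`Ω` on one side of the real axis: the upper side for `σ > 0`, the lower one for `σ < 0`. -/
structure IsDeformation (a b : EReal) (σ : ℝ) (h : ℝ × ℝ → ℂ) (γ : ℝ → ℂ) (Ω : Set ℂ) : Prop where
  lt : a < b
  continuousOn : ContinuousOn h (Set.Icc 0 1 ×ˢ realInterval a b)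
  injOn : Set.InjOn h (Set.Icc 0 1 ×ˢ realInterval a b)
  bottom : ∀ t ∈ realInterval a b, h (0, t) = (t : ℂ)
  top : ∀ t ∈ realInterval a b, h (1, t) = γ t
  image : h '' (Set.Ioo 0 1 ×ˢ realInterval a b) = Ω
  tendsto_left : Tendsto h (𝓟 (Set.Icc 0 1) ×ˢ comap Real.toEReal (𝓝[>] a)) (endFilter a)
  tendsto_right : Tendsto h (𝓟 (Set.Icc 0 1) ×ˢ comap Real.toEReal (𝓝[<] b)) (endFilter b)
  isOpen : IsOpen Ω
  frontier_eq : frontier Ω =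
    (fun t : ℝ => (t : ℂ)) '' closure (realInterval a b) ∪ γ '' realInterval a b
  side : ∀ z ∈ Ω, 0 < σ * z.im
  side' : ∀ t ∈ realInterval a b, 0 < σ * (γ t).im

theorem disjoint_nhds_endFilter {e : EReal} {w : ℂ}
    (hw : e ≠ ⊥ → e ≠ ⊤ → w ≠ (e.toReal : ℂ)) : Disjoint (𝓝 w) (endFilter e) := by
  unfold endFilter
  split_ifs with he
  · exact disjoint_nhds_cocompact w
  · rw [not_or] at he
    exact disjoint_nhds_nhds.2 (hw he.1 he.2)

variable {a b : EReal} {σ : ℝ} {h : ℝ × ℝ → ℂ} {γ : ℝ → ℂ} {Ω : Set ℂ}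

theorem ne_toReal_left {t : ℝ} (ht : t ∈ realInterval a b) (h1 : a ≠ ⊥) (h2 : a ≠ ⊤) :
    a.toReal < t := by
  have := ht.1
  rwa [← EReal.coe_toReal h2 h1, EReal.coe_lt_coe_iff] at this

theorem ne_toReal_right {t : ℝ} (ht : t ∈ realInterval a b) (h1 : b ≠ ⊥) (h2 : b ≠ ⊤) :
    t < b.toReal := by
  have := ht.2
  rwa [← EReal.coe_toReal h2 h1, EReal.coe_lt_coe_iff] at this

namespace IsDeformation

theorem nonempty (hd : IsDeformation a b σ h γ Ω) : (realInterval a b).Nonempty :=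
  nonempty_realInterval hd.lt

theorem apply_cases (hd : IsDeformation a b σ h γ Ω) {p : ℝ × ℝ}
    (hp : p ∈ Set.Icc (0 : ℝ) 1 ×ˢ realInterval a b) :
    h p = (p.2 : ℂ) ∨ h p = γ p.2 ∨ h p ∈ Ω := by
  obtain ⟨s, t⟩ := p
  obtain ⟨⟨h0, h1⟩, ht⟩ := hp
  rcases h0.eq_or_lt with h0 | h0
  · left
    change 0 = s at h0
    rw [← h0]; exact hd.bottom t ht
  rcases h1.eq_or_lt with h1 | h1
  · right; left
    change s = 1 at h1
    rw [h1]; exact hd.top t ht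
  · right; right
    rw [← hd.image]
    exact ⟨(s, t), ⟨⟨h0, h1⟩, ht⟩, rfl⟩

theorem image_eq (hd : IsDeformation a b σ h γ Ω) :
    h '' (Set.Icc (0 : ℝ) 1 ×ˢ realInterval a b) =
      Ω ∪ (fun t : ℝ => (t : ℂ)) '' realInterval a b ∪ γ '' realInterval a b := by
  apply Set.Subset.antisymm
  · rintro _ ⟨p, hp, rfl⟩
    rcases hd.apply_cases hp with h1 | h1 | h1
    · exact Or.inl (Or.inr ⟨p.2, hp.2, h1.symm⟩)
    · exact Or.inr ⟨p.2, hp.2, h1.symm⟩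
    · exact Or.inl (Or.inl h1)
  · rintro w ((hw | ⟨t, ht, rfl⟩) | ⟨t, ht, rfl⟩)
    · rw [← hd.image] at hw
      exact Set.image_mono (Set.prod_mono Set.Ioo_subset_Icc_self subset_rfl) hw
    · exact ⟨(0, t), ⟨⟨le_rfl, zero_le_one⟩, ht⟩, hd.bottom t ht⟩
    · exact ⟨(1, t), ⟨⟨zero_le_one, le_rfl⟩, ht⟩, hd.top t ht⟩

/-- An end point is not attained by the deformation. -/
theorem disjoint_left (hd : IsDeformation a b σ h γ Ω) {w : ℂ}
    (hw : w ∈ h '' (Set.Icc (0 : ℝ) 1 ×ˢ realInterval a b)) : Disjoint (𝓝 w) (endFilter a) := by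
  refine disjoint_nhds_endFilter fun h1 h2 he => ?_
  rw [hd.image_eq] at hw
  rcases hw with (hw | ⟨t, ht, rfl⟩) | ⟨t, ht, rfl⟩
  · have := hd.side w hw
    simp [he] at this
  · exact (ne_toReal_left ht h1 h2).ne' (Complex.ofReal_injective he)
  · have := hd.side' t ht
    simp [he] at this

theorem disjoint_right (hd : IsDeformation a b σ h γ Ω) {w : ℂ}
    (hw : w ∈ h '' (Set.Icc (0 : ℝ) 1 ×ˢ realInterval a b)) : Disjoint (𝓝 w) (endFilter b) := by
  refine disjoint_nhds_endFilter fun h1 h2 he => ?_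
  rw [hd.image_eq] at hw
  rcases hw with (hw | ⟨t, ht, rfl⟩) | ⟨t, ht, rfl⟩
  · have := hd.side w hw
    simp [he] at this
  · exact (ne_toReal_right ht h1 h2).ne (Complex.ofReal_injective he)
  · have := hd.side' t ht
    simp [he] at this

/-- Near the left end of the parameter interval, the whole deformation is near the end point. -/
theorem eventually_left (hd : IsDeformation a b σ h γ Ω) {V : Set ℂ} (hV : V ∈ endFilter a) :
    ∃ c ∈ realInterval a b, ∀ s ∈ Set.Icc (0 : ℝ) 1, ∀ t ∈ realInterval a b, t ≤ c →
      h (s, t) ∈ V := by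
  have h1 := hd.tendsto_left hV
  rw [mem_map, mem_prod_iff] at h1
  obtain ⟨S, hS, T, hT, hST⟩ := h1
  obtain ⟨T', hT', hTT'⟩ := mem_comap.1 hT
  obtain ⟨u, hu, huT⟩ := (mem_nhdsGT_iff_exists_Ioo_subset' hd.lt).1 hT'
  obtain ⟨c, hc1, hc2⟩ := EReal.lt_iff_exists_real_btwn.1 (lt_min hu hd.lt)
  refine ⟨c, ⟨hc1, hc2.trans_le (min_le_right _ _)⟩, fun s hs t ht htc => ?_⟩
  refine hST (Set.mk_mem_prod (hS hs) (hTT' (huT ⟨ht.1, ?_⟩)))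
  exact (EReal.coe_le_coe_iff.2 htc).trans_lt (hc2.trans_le (min_le_left _ _))

/-- Near the right end of the parameter interval, the whole deformation is near the end point. -/
theorem eventually_right (hd : IsDeformation a b σ h γ Ω) {V : Set ℂ} (hV : V ∈ endFilter b) :
    ∃ c ∈ realInterval a b, ∀ s ∈ Set.Icc (0 : ℝ) 1, ∀ t ∈ realInterval a b, c ≤ t →
      h (s, t) ∈ V := by
  have h1 := hd.tendsto_right hV
  rw [mem_map, mem_prod_iff] at h1
  obtain ⟨S, hS, T, hT, hST⟩ := h1
  obtain ⟨T', hT', hTT'⟩ := mem_comap.1 hT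
  obtain ⟨u, hu, huT⟩ := (mem_nhdsLT_iff_exists_Ioo_subset' hd.lt).1 hT'
  obtain ⟨c, hc1, hc2⟩ := EReal.lt_iff_exists_real_btwn.1 (max_lt hu hd.lt)
  refine ⟨c, ⟨(le_max_right _ _).trans_lt hc1, hc2⟩, fun s hs t ht htc => ?_⟩
  refine hST (Set.mk_mem_prod (hS hs) (hTT' (huT ⟨?_, ht.2⟩)))
  exact ((le_max_left _ _).trans_lt hc1).trans_le (EReal.coe_le_coe_iff.2 htc)

/-- The deformation is proper away from the end points. -/
theorem exists_nhds_preimage_subset (hd : IsDeformation a b σ h γ Ω) {w : ℂ}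
    (ha : Disjoint (𝓝 w) (endFilter a)) (hb : Disjoint (𝓝 w) (endFilter b)) :
    ∃ V ∈ 𝓝 w, ∃ c ∈ realInterval a b, ∃ d ∈ realInterval a b,
      ∀ p ∈ Set.Icc (0 : ℝ) 1 ×ˢ realInterval a b, h p ∈ V → p.2 ∈ Set.Icc c d := by
  obtain ⟨V₁, hV₁, U₁, hU₁, h1⟩ := Filter.disjoint_iff.1 ha
  obtain ⟨V₂, hV₂, U₂, hU₂, h2⟩ := Filter.disjoint_iff.1 hb
  obtain ⟨c, hc, hc'⟩ := hd.eventually_left hU₁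
  obtain ⟨d, hdJ, hd'⟩ := hd.eventually_right hU₂
  refine ⟨V₁ ∩ V₂, inter_mem hV₁ hV₂, c, hc, d, hdJ, fun p hp hpV => ⟨?_, ?_⟩⟩
  · by_contra! hlt
    exact Set.disjoint_left.1 h1 hpV.1 (hc' p.1 hp.1 p.2 hp.2 hlt.le)
  · by_contra! hlt
    exact Set.disjoint_left.1 h2 hpV.2 (hd' p.1 hp.1 p.2 hp.2 hlt.le)

theorem Icc_prod_subset {c d : ℝ} (hc : c ∈ realInterval a b) (hd : d ∈ realInterval a b) :
    Set.Icc (0 : ℝ) 1 ×ˢ Set.Icc c d ⊆ Set.Icc (0 : ℝ) 1 ×ˢ realInterval a b :=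
  Set.prod_mono subset_rfl (ordConnected_realInterval.out hc hd)

/-- The inverse of the deformation is continuous: by properness, the inverse images of points near
`w` stay in a compact set, and by injectivity they have only one cluster point. -/
theorem continuousOn_invFunOn (hd : IsDeformation a b σ h γ Ω) :
    ContinuousOn (Function.invFunOn h (Set.Icc (0 : ℝ) 1 ×ˢ realInterval a b))
      (h '' (Set.Icc (0 : ℝ) 1 ×ˢ realInterval a b)) := by
  set Q := Set.Icc (0 : ℝ) 1 ×ˢ realInterval a b with hQ
  set k := Function.invFunOn h Q with hk
  intro w hw
  obtain ⟨V, hV, c, hc, d, hdJ, hVcd⟩ :=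
    hd.exists_nhds_preimage_subset (hd.disjoint_left hw) (hd.disjoint_right hw)
  have hkQ : ∀ x ∈ h '' Q, k x ∈ Q := fun x hx => Function.invFunOn_mem hx
  have hhk : ∀ x ∈ h '' Q, h (k x) = x := fun x hx => Function.invFunOn_eq hx
  have hK : IsCompact (Set.Icc (0 : ℝ) 1 ×ˢ Set.Icc c d) := isCompact_Icc.prod isCompact_Icc
  refine hK.tendsto_nhds_of_unique_mapClusterPt ?_ fun y hy hcl => ?_
  · filter_upwards [self_mem_nhdsWithin, mem_nhdsWithin_of_mem_nhds hV] with x hx hxV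
    exact ⟨(hkQ x hx).1, hVcd _ (hkQ x hx) (by rwa [hhk x hx])⟩
  · have hyQ : y ∈ Q := Icc_prod_subset hc hdJ hy
    refine hd.injOn hyQ (hkQ w hw) ?_
    rw [hhk w hw]
    by_contra hne
    obtain ⟨U, hU, V', hV', hUV⟩ := Filter.disjoint_iff.1 (disjoint_nhds_nhds.2 hne)
    have h1 : ∀ᶠ p in 𝓝 y, p ∈ Q → h p ∈ U :=
      eventually_nhdsWithin_iff.1 (hd.continuousOn y hyQ hU)
    have h2 := hcl.frequently h1
    have h3 : ∀ᶠ x in 𝓝[h '' Q] w, x ∈ h '' Q ∧ x ∈ V' :=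
      eventually_mem_nhdsWithin.and (mem_nhdsWithin_of_mem_nhds hV')
    obtain ⟨x, hx1, hx2, hx3⟩ := (h2.and_eventually h3).exists
    have := hx1 (hkQ x hx2)
    rw [hhk x hx2] at this
    exact Set.disjoint_left.1 hUV this hx3

theorem continuousOn_curve (hd : IsDeformation a b σ h γ Ω) :
    ContinuousOn γ (realInterval a b) := by
  have h1 : ContinuousOn (fun t : ℝ => h (1, t)) (realInterval a b) :=
    hd.continuousOn.comp (by fun_prop) fun t ht => ⟨⟨zero_le_one, le_rfl⟩, ht⟩
  exact h1.congr fun t ht => (hd.top t ht).symm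

/-- The curve is closed away from the end points. -/
theorem mem_curve_of_mem_closure (hd : IsDeformation a b σ h γ Ω) {w : ℂ}
    (hw : w ∈ closure (γ '' realInterval a b))
    (ha : Disjoint (𝓝 w) (endFilter a)) (hb : Disjoint (𝓝 w) (endFilter b)) :
    w ∈ γ '' realInterval a b := by
  obtain ⟨V, hV, c, hc, d, hdJ, hVcd⟩ := hd.exists_nhds_preimage_subset ha hb
  have hsub := ordConnected_realInterval.out hc hdJ
  have hK : IsCompact (γ '' Set.Icc c d) :=
    isCompact_Icc.image_of_continuousOn (hd.continuousOn_curve.mono hsub)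
  have h1 : w ∈ closure (γ '' Set.Icc c d) := by
    rw [mem_closure_iff_nhds] at hw ⊢
    intro U hU
    obtain ⟨_, ⟨hxU, hxV⟩, t, ht, rfl⟩ := hw (U ∩ V) (inter_mem hU hV)
    exact ⟨_, hxU, t, hVcd (1, t) ⟨⟨zero_le_one, le_rfl⟩, ht⟩ (by rwa [hd.top t ht]), rfl⟩
  rw [hK.isClosed.closure_eq] at h1
  exact Set.image_mono hsub h1

theorem isClosed_side : IsClosed {w : ℂ | 0 ≤ σ * w.im} :=
  isClosed_le continuous_const (by fun_prop)

theorem closure_subset_side (hd : IsDeformation a b σ h γ Ω) :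
    closure Ω ⊆ {w : ℂ | 0 ≤ σ * w.im} :=
  closure_minimal (fun w hw => (hd.side w hw).le) isClosed_side

theorem closure_curve_subset_frontier (hd : IsDeformation a b σ h γ Ω) :
    closure (γ '' realInterval a b) ⊆ frontier Ω :=
  closure_minimal (hd.frontier_eq ▸ Set.subset_union_right) isClosed_frontier

theorem disjoint_closure_curve (hd : IsDeformation a b σ h γ Ω) {w : ℂ} (hw : w ∈ Ω) :
    w ∉ closure (γ '' realInterval a b) := fun hw' =>
  Set.disjoint_left.1 (disjoint_frontier_iff_isOpen.2 hd.isOpen)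
    (hd.closure_curve_subset_frontier hw') hw

theorem ofReal_notMem_closure_curve (hd : IsDeformation a b σ h γ Ω) {t : ℝ}
    (ht : t ∈ realInterval a b) : (t : ℂ) ∉ closure (γ '' realInterval a b) := by
  intro hw
  have hQ : (t : ℂ) ∈ h '' (Set.Icc (0 : ℝ) 1 ×ˢ realInterval a b) := by
    rw [hd.image_eq]; exact Or.inl (Or.inr ⟨t, ht, rfl⟩)
  obtain ⟨s, hs, hst⟩ := hd.mem_curve_of_mem_closure hw (hd.disjoint_left hQ) (hd.disjoint_right hQ)
  have := hd.side' s hs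
  simp [hst] at this

theorem convex_side : Convex ℝ {w : ℂ | 0 < σ * w.im} :=
  convex_halfSpace_gt (f := fun w : ℂ => σ * w.im)
    ⟨fun x y => by simp [mul_add], fun c x => by simp; ring⟩ 0

theorem subset_of_disjoint_frontier {S : Set ℂ} (hS : IsPreconnected S)
    (hSΩ : (S ∩ Ω).Nonempty) (hΩ : IsOpen Ω) (hd : Disjoint S (frontier Ω)) : S ⊆ Ω := by
  refine hS.subset_left_of_subset_union hΩ isClosed_closure.isOpen_compl
    (Set.disjoint_left.2 fun x hx hx' => hx' (subset_closure hx)) (fun x hx => ?_) hSΩ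
  by_cases h1 : x ∈ Ω
  · exact Or.inl h1
  · refine Or.inr fun h2 => Set.disjoint_left.1 hd hx ?_
    rw [hΩ.frontier_eq]
    exact ⟨h2, h1⟩

/-- Near an interior point of the interval, the domain `Ω` fills one side of the real axis. -/
theorem exists_halfBall_subset (hd : IsDeformation a b σ h γ Ω) {t : ℝ}
    (ht : t ∈ realInterval a b) :
    ∃ r > 0, (∀ s : ℝ, |s - t| < r → s ∈ realInterval a b) ∧
      Metric.ball (t : ℂ) r ∩ {w : ℂ | 0 < σ * w.im} ⊆ Ω := by
  obtain ⟨r₁, hr₁, h1⟩ := Metric.isOpen_iff.1 isOpen_realInterval t ht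
  obtain ⟨r₂, hr₂, h2⟩ := Metric.isOpen_iff.1 isClosed_closure.isOpen_compl (t : ℂ)
    (hd.ofReal_notMem_closure_curve ht)
  refine ⟨min r₁ r₂, lt_min hr₁ hr₂, fun s hs => h1 ?_, ?_⟩
  · rw [Metric.mem_ball, Real.dist_eq]
    exact hs.trans_le (min_le_left _ _)
  have hball : Metric.ball (t : ℂ) (min r₁ r₂) ∈ 𝓝 (t : ℂ) :=
    Metric.ball_mem_nhds _ (lt_min hr₁ hr₂)
  -- the half disk is connected, meets `Ω`, and misses both parts of the frontier
  refine subset_of_disjoint_frontier ((convex_ball _ _).inter convex_side).isPreconnected ?_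
    hd.isOpen ?_
  · have h3 : (t : ℂ) ∈ closure Ω := frontier_subset_closure
      (hd.frontier_eq ▸ Or.inl ⟨t, subset_closure ht, rfl⟩)
    obtain ⟨w, hw1, hw2⟩ := mem_closure_iff_nhds.1 h3 _ hball
    exact ⟨w, ⟨hw1, hd.side w hw2⟩, hw2⟩
  · rw [Set.disjoint_left]
    rintro w ⟨hw1, hw2⟩ hw
    rw [hd.frontier_eq] at hw
    rcases hw with ⟨s, hs, rfl⟩ | hw
    · simp at hw2
    · exact h2 (Metric.ball_subset_ball (min_le_right _ _) hw1) (subset_closure hw)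

theorem isPreconnected (hd : IsDeformation a b σ h γ Ω) : IsPreconnected Ω := by
  rw [← hd.image]
  exact (isPreconnected_Ioo.prod isPreconnected_realInterval).image _
    (hd.continuousOn.mono (Set.prod_mono Set.Ioo_subset_Icc_self subset_rfl))

/-- The set to which the transfer function is continued is open. -/
theorem isOpen_union (hd : IsDeformation a b σ h γ Ω) :
    IsOpen ({z : ℂ | σ * z.im < 0} ∪ (fun t : ℝ => (t : ℂ)) '' realInterval a b ∪ Ω) := by
  rw [isOpen_iff_mem_nhds]
  rintro w ((hw | ⟨t, ht, rfl⟩) | hw)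
  · exact mem_of_superset ((isOpen_lt (by fun_prop) continuous_const).mem_nhds hw)
      (fun x hx => Or.inl (Or.inl hx))
  · obtain ⟨r, hr, h1, h2⟩ := hd.exists_halfBall_subset ht
    refine mem_of_superset (Metric.ball_mem_nhds _ hr) fun w hw => ?_
    rcases lt_trichotomy (σ * w.im) 0 with h3 | h3 | h3
    · exact Or.inl (Or.inl h3)
    · have hσ : σ ≠ 0 := by
        rintro rfl
        have := hd.side' t ht
        simp at this
      have him : w.im = 0 := (mul_eq_zero.1 h3).resolve_left hσ
      have hw' : w = (w.re : ℂ) := Complex.ext (by simp) (by simp [him])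
      refine Or.inl (Or.inr ⟨w.re, h1 _ ?_, hw'.symm⟩)
      rw [Metric.mem_ball, hw', dist_eq_norm, ← Complex.ofReal_sub, Complex.norm_real] at hw
      exact hw
    · exact Or.inr (h2 ⟨hw, h3⟩)
  · exact mem_of_superset (hd.isOpen.mem_nhds hw) (fun x hx => Or.inr hx)

theorem isConnected_union (hd : IsDeformation a b σ h γ Ω) :
    IsConnected ({z : ℂ | σ * z.im < 0} ∪ (fun t : ℝ => (t : ℂ)) '' realInterval a b ∪ Ω) := by
  obtain ⟨t, ht⟩ := hd.nonempty
  have hσ : σ ≠ 0 := by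
    rintro rfl
    have := hd.side' t ht
    simp at this
  refine ⟨⟨t, Or.inl (Or.inr ⟨t, ht, rfl⟩)⟩, ?_⟩
  have h1 : IsPreconnected {z : ℂ | σ * z.im < 0} :=
    (convex_halfSpace_lt (f := fun w : ℂ => σ * w.im)
      ⟨fun x y => by simp [mul_add], fun c x => by simp; ring⟩ 0).isPreconnected
  have h2 : IsPreconnected ({z : ℂ | σ * z.im < 0} ∪
      (fun t : ℝ => (t : ℂ)) '' realInterval a b) := by
    refine h1.subset_closure Set.subset_union_left ?_
    rintro w (hw | ⟨s, hs, rfl⟩)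
    · exact subset_closure hw
    · -- approach `s` along a line orthogonal to the real axis
      have h3 : Tendsto (fun x : ℝ => (s : ℂ) - (x * σ : ℝ) * Complex.I) (𝓝[>] 0) (𝓝 (s : ℂ)) := by
        have : Continuous (fun x : ℝ => (s : ℂ) - (x * σ : ℝ) * Complex.I) := by fun_prop
        have h := this.tendsto 0
        simp only [zero_mul, Complex.ofReal_zero, sub_zero] at h
        exact h.mono_left nhdsWithin_le_nhds
      refine mem_closure_of_tendsto h3 ?_
      filter_upwards [self_mem_nhdsWithin] with x hx
      have hx : 0 < x := hx
      have h4 : 0 < σ * σ := mul_self_pos.2 hσ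
      simp
      nlinarith
  have h3 : IsPreconnected ((fun t : ℝ => (t : ℂ)) '' realInterval a b ∪ Ω) := by
    refine hd.isPreconnected.subset_closure Set.subset_union_right ?_
    rintro w (⟨s, hs, rfl⟩ | hw)
    · exact frontier_subset_closure (hd.frontier_eq ▸ Or.inl ⟨s, subset_closure hs, rfl⟩)
    · exact subset_closure hw
  have h4 := IsPreconnected.union (t : ℂ) (Or.inr ⟨t, ht, rfl⟩) (Or.inl ⟨t, ht, rfl⟩) h2 h3
  convert h4 using 1
  ext w
  simp only [Set.mem_union]
  tauto

/-- The domain of continuation does not meet the singularities of the contour integral. -/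
theorem disjoint_union_closure_curve (hd : IsDeformation a b σ h γ Ω) {w : ℂ}
    (hw : w ∈ {z : ℂ | σ * z.im < 0} ∪ (fun t : ℝ => (t : ℂ)) '' realInterval a b ∪ Ω) :
    w ∉ closure (γ '' realInterval a b) := by
  rcases hw with (hw | ⟨t, ht, rfl⟩) | hw
  · intro h1
    have : 0 ≤ σ * w.im :=
      hd.closure_subset_side (frontier_subset_closure (hd.closure_curve_subset_frontier h1))
    have hw : σ * w.im < 0 := hw
    linarith
  · exact hd.ofReal_notMem_closure_curve ht
  · exact hd.disjoint_closure_curve hw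

end IsDeformation
end Deformation

/-! ### Primitives along a continuous rectangle -/

section Primitive

/-- On the set `R`, the function `Φ` is near `p` the composition of `h` with a local primitive
of `f`. -/
def IsPrimitiveAlong {X : Type*} [TopologicalSpace X] (f : ℂ → ℂ) (h : X → ℂ) (R : Set X)
    (Φ : X → ℂ) (p : X) : Prop :=
  ∃ F : ℂ → ℂ, (∀ᶠ w in 𝓝 (h p), HasDerivAt F (f w) w) ∧ ∀ᶠ q in 𝓝[R] p, Φ q = F (h q)

theorem eventually_sub_eq_of_hasDerivAt {f F₁ F₂ : ℂ → ℂ} {w : ℂ}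
    (h1 : ∀ᶠ v in 𝓝 w, HasDerivAt F₁ (f v) v) (h2 : ∀ᶠ v in 𝓝 w, HasDerivAt F₂ (f v) v) :
    ∀ᶠ v in 𝓝 w, F₁ v - F₂ v = F₁ w - F₂ w := by
  obtain ⟨r, hr, hb⟩ := Metric.eventually_nhds_iff_ball.1 (h1.and h2)
  filter_upwards [Metric.ball_mem_nhds w hr] with v hv
  have := (convex_ball w r).norm_image_sub_le_of_norm_hasDerivWithin_le (f := fun v => F₁ v - F₂ v)
    (f' := fun _ => 0) (C := 0) (fun x hx => by
      have := ((hb x hx).1.sub (hb x hx).2).hasDerivWithinAt (s := Metric.ball w r)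
      rwa [sub_self] at this) (fun x _ => by simp) (Metric.mem_ball_self hr) hv
  rw [zero_mul, norm_le_zero_iff, sub_eq_zero] at this
  exact this

/-- Primitives along a map on two closed sets with connected intersection can be glued after adding
a constant to one of them. -/
theorem exists_isPrimitiveAlong_union {X : Type*} [TopologicalSpace X] {f : ℂ → ℂ} {h : X → ℂ}
    {R₁ R₂ : Set X} (hR₁ : IsClosed R₁) (hR₂ : IsClosed R₂) (hh : ContinuousOn h (R₁ ∪ R₂))
    (hc : IsConnected (R₁ ∩ R₂)) {Φ₁ Φ₂ : X → ℂ} (h₁ : ∀ p ∈ R₁, IsPrimitiveAlong f h R₁ Φ₁ p)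
    (h₂ : ∀ p ∈ R₂, IsPrimitiveAlong f h R₂ Φ₂ p) :
    ∃ Φ : X → ℂ, ∀ p ∈ R₁ ∪ R₂, IsPrimitiveAlong f h (R₁ ∪ R₂) Φ p := by
  classical
  obtain ⟨⟨p₀, hp₀⟩, hpre⟩ := hc
  -- the difference is locally constant, hence constant, on the intersection
  have hloc : ∀ p ∈ R₁ ∩ R₂, ∀ᶠ q in 𝓝[R₁ ∩ R₂] p, Φ₁ p - Φ₂ p = Φ₁ q - Φ₂ q := by
    intro p hp
    obtain ⟨F₁, hF₁, hΦ₁⟩ := h₁ p hp.1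
    obtain ⟨F₂, hF₂, hΦ₂⟩ := h₂ p hp.2
    have ht : Tendsto h (𝓝[R₁ ∩ R₂] p) (𝓝 (h p)) :=
      (hh p (Or.inl hp.1)).mono_left (nhdsWithin_mono _ (fun x hx => Or.inl hx.1))
    filter_upwards [ht.eventually (eventually_sub_eq_of_hasDerivAt hF₁ hF₂),
      hΦ₁.filter_mono (nhdsWithin_mono _ Set.inter_subset_left),
      hΦ₂.filter_mono (nhdsWithin_mono _ Set.inter_subset_right)] with q hq1 hq2 hq3
    rw [hq2, hq3, hq1, hΦ₁.self_of_nhdsWithin hp.1, hΦ₂.self_of_nhdsWithin hp.2]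
  set c := Φ₁ p₀ - Φ₂ p₀ with hc_def
  have hconst : ∀ q ∈ R₁ ∩ R₂, Φ₁ q - Φ₂ q = c := fun q hq =>
    (hpre.induction₂ (fun x y => Φ₁ x - Φ₂ x = Φ₁ y - Φ₂ y) hloc
      (fun _ _ _ _ _ _ h h' => h.trans h') (fun _ _ _ _ h => h.symm) hp₀ hq).symm
  set Φ : X → ℂ := fun q => if q ∈ R₁ then Φ₁ q else Φ₂ q + c with hΦ
  have e1 : ∀ q ∈ R₁, Φ q = Φ₁ q := fun q hq => if_pos hq
  have e2 : ∀ q ∈ R₂, Φ q = Φ₂ q + c := by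
    intro q hq
    by_cases hq1 : q ∈ R₁
    · rw [e1 q hq1, ← hconst q ⟨hq1, hq⟩]; ring
    · exact if_neg hq1
  refine ⟨Φ, fun p hp => ?_⟩
  by_cases hp1 : p ∈ R₁
  · obtain ⟨F₁, hF₁, hΦ₁⟩ := h₁ p hp1
    refine ⟨F₁, hF₁, ?_⟩
    rw [nhdsWithin_union, eventually_sup]
    constructor
    · filter_upwards [hΦ₁, eventually_mem_nhdsWithin] with q hq hq1
      rw [e1 q hq1, hq]
    by_cases hp2 : p ∈ R₂
    · obtain ⟨F₂, hF₂, hΦ₂⟩ := h₂ p hp2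
      have ht : Tendsto h (𝓝[R₂] p) (𝓝 (h p)) :=
        (hh p hp).mono_left (nhdsWithin_mono _ Set.subset_union_right)
      filter_upwards [ht.eventually (eventually_sub_eq_of_hasDerivAt hF₁ hF₂), hΦ₂,
        eventually_mem_nhdsWithin] with q hq1 hq2 hq3
      have := hconst p ⟨hp1, hp2⟩
      rw [hΦ₁.self_of_nhdsWithin hp1, hΦ₂.self_of_nhdsWithin hp2, ← hq1] at this
      rw [e2 q hq3, hq2, ← this]
      ring
    · rw [(notMem_closure_iff_nhdsWithin_eq_bot).1 (by rwa [hR₂.closure_eq])]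
      exact eventually_bot
  · have hp2 : p ∈ R₂ := hp.resolve_left hp1
    obtain ⟨F₂, hF₂, hΦ₂⟩ := h₂ p hp2
    refine ⟨fun w => F₂ w + c, hF₂.mono fun w hw => hw.add_const c, ?_⟩
    rw [nhdsWithin_union, eventually_sup]
    constructor
    · rw [(notMem_closure_iff_nhdsWithin_eq_bot).1 (by rwa [hR₁.closure_eq])]
      exact eventually_bot
    · filter_upwards [hΦ₂, eventually_mem_nhdsWithin] with q hq hq1
      rw [e2 q hq1, hq]

/-- A relation that holds for short intervals and is stable under concatenation holds for
all intervals. -/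
theorem Icc_subdivision_induction {P : ℝ → ℝ → Prop} {a b : ℝ} (hab : a ≤ b)
    (htrans : ∀ x y z, a ≤ x → x ≤ y → y ≤ z → z ≤ b → P x y → P y z → P x z)
    (hloc : ∀ x ∈ Set.Icc a b, ∃ δ > 0, ∀ u ∈ Set.Icc a b, ∀ v ∈ Set.Icc a b,
      |u - x| < δ → |v - x| < δ → u ≤ v → P u v) : P a b := by
  choose! δ hδ hP using hloc
  obtain ⟨ε, hε, hL⟩ := lebesgue_number_lemma_of_metric (s := Set.Icc a b)
    (c := fun x : Set.Icc a b => Metric.ball (x : ℝ) (δ x)) isCompact_Icc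
    (fun _ => Metric.isOpen_ball)
    (fun x hx => Set.mem_iUnion.2 ⟨⟨x, hx⟩, Metric.mem_ball_self (hδ x hx)⟩)
  have hshort : ∀ u v, a ≤ u → u ≤ v → v ≤ b → v - u < ε → P u v := by
    intro u v hau huv hvb hlt
    obtain ⟨x, hx⟩ := hL u ⟨hau, huv.trans hvb⟩
    have h1 := hx (Metric.mem_ball_self hε)
    have h2 := hx (a := v) (by rw [Metric.mem_ball, Real.dist_eq, abs_of_nonneg] <;> linarith)
    rw [Metric.mem_ball, Real.dist_eq] at h1 h2
    exact hP x x.2 u ⟨hau, huv.trans hvb⟩ v ⟨hau.trans huv, hvb⟩ h1 h2 huv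
  obtain ⟨N, hN⟩ := exists_nat_gt ((b - a) / ε)
  have hN0 : (0 : ℝ) < N := lt_of_le_of_lt (div_nonneg (sub_nonneg.2 hab) hε.le) hN
  set η := (b - a) / N with hη
  have hη0 : 0 ≤ η := div_nonneg (sub_nonneg.2 hab) hN0.le
  have hηε : η < ε := by
    rw [hη, div_lt_iff₀ hN0]
    rw [div_lt_iff₀ hε] at hN
    linarith
  have hNη : N * η = b - a := by rw [hη]; field_simp
  have key : ∀ n : ℕ, n ≤ N → P a (a + n * η) := by
    intro n
    induction n with
    | zero =>
      intro _
      simpa using hshort a a le_rfl le_rfl hab (by simpa using hε)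
    | succ n ih =>
      intro hn
      have hn' : ((n + 1 : ℕ) : ℝ) ≤ N := by exact_mod_cast hn
      have h1 : ((n + 1 : ℕ) : ℝ) * η ≤ b - a := by
        rw [← hNη]; gcongr
      push_cast at h1 ⊢
      have h2 : 0 ≤ (n : ℝ) * η := by positivity
      refine htrans a (a + n * η) _ le_rfl (by linarith) (by linarith) (by linarith)
        (ih (by omega)) (hshort _ _ (by linarith) (by linarith) (by linarith) (by linarith))
  have := key N le_rfl
  rwa [hNη, add_sub_cancel] at this

/-- A continuous map from a rectangle to the domain of a holomorphic function `f` has a primitive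
of `f` along it. -/
theorem exists_isPrimitiveAlong_rectangle {f : ℂ → ℂ} {U : Set ℂ} (hU : IsOpen U)
    (hf : DifferentiableOn ℂ f U) {h : ℝ × ℝ → ℂ} {s₁ s₂ t₁ t₂ : ℝ} (hs : s₁ ≤ s₂) (ht : t₁ ≤ t₂)
    (hh : ContinuousOn h (Set.Icc s₁ s₂ ×ˢ Set.Icc t₁ t₂))
    (hm : Set.MapsTo h (Set.Icc s₁ s₂ ×ˢ Set.Icc t₁ t₂) U) :
    ∃ Φ : ℝ × ℝ → ℂ, ∀ p ∈ Set.Icc s₁ s₂ ×ˢ Set.Icc t₁ t₂,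
      IsPrimitiveAlong f h (Set.Icc s₁ s₂ ×ˢ Set.Icc t₁ t₂) Φ p := by
  set good : ℝ → ℝ → ℝ → ℝ → Prop := fun x y u v => ∃ Φ : ℝ × ℝ → ℂ,
    ∀ p ∈ Set.Icc x y ×ˢ Set.Icc u v, IsPrimitiveAlong f h (Set.Icc x y ×ˢ Set.Icc u v) Φ p
    with hgood
  have hclosed : ∀ x y u v : ℝ, IsClosed (Set.Icc x y ×ˢ Set.Icc u v) :=
    fun x y u v => isClosed_Icc.prod isClosed_Icc
  -- sufficiently small rectangles
  have hsmall : ∀ x ∈ Set.Icc s₁ s₂, ∀ u ∈ Set.Icc t₁ t₂, ∃ δ > 0,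
      ∀ x₁ ∈ Set.Icc s₁ s₂, ∀ x₂ ∈ Set.Icc s₁ s₂, ∀ u₁ ∈ Set.Icc t₁ t₂, ∀ u₂ ∈ Set.Icc t₁ t₂,
      |x₁ - x| < δ → |x₂ - x| < δ → |u₁ - u| < δ → |u₂ - u| < δ → good x₁ x₂ u₁ u₂ := by
    intro x hx u hu
    have hxu : (x, u) ∈ Set.Icc s₁ s₂ ×ˢ Set.Icc t₁ t₂ := ⟨hx, hu⟩
    obtain ⟨ρ, hρ, hb⟩ := Metric.isOpen_iff.1 hU _ (hm hxu)
    obtain ⟨F, hF⟩ := (hf.mono hb).isExactOn_ball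
    obtain ⟨δ, hδ, hδ'⟩ := Metric.continuousWithinAt_iff.1 (hh _ hxu) ρ hρ
    refine ⟨δ, hδ, fun x₁ hx₁ x₂ hx₂ u₁ hu₁ u₂ hu₂ h1 h2 h3 h4 => ⟨fun q => F (h q), ?_⟩⟩
    rintro ⟨p₁, p₂⟩ ⟨hp₁, hp₂⟩
    refine ⟨F, ?_, Eventually.of_forall fun _ => rfl⟩
    have hp : h (p₁, p₂) ∈ Metric.ball (h (x, u)) ρ := by
      refine hδ' ⟨⟨hx₁.1.trans hp₁.1, hp₁.2.trans hx₂.2⟩, ⟨hu₁.1.trans hp₂.1, hp₂.2.trans hu₂.2⟩⟩ ?_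
      rw [abs_lt] at h1 h2 h3 h4
      rw [Prod.dist_eq, max_lt_iff, Real.dist_eq, Real.dist_eq, abs_lt, abs_lt]
      obtain ⟨hp11, hp12⟩ := hp₁
      obtain ⟨hp21, hp22⟩ := hp₂
      dsimp only at *
      refine ⟨⟨?_, ?_⟩, ?_, ?_⟩ <;> linarith
    filter_upwards [Metric.isOpen_ball.mem_nhds hp] with w hw using hF w hw
  -- concatenation in the two directions
  refine Icc_subdivision_induction (P := fun u v => good s₁ s₂ u v) ht ?_ ?_
  · rintro u v w hu huv hvw hw ⟨Φ₁, h1⟩ ⟨Φ₂, h2⟩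
    have hun : Set.Icc s₁ s₂ ×ˢ Set.Icc u w
        = Set.Icc s₁ s₂ ×ˢ Set.Icc u v ∪ Set.Icc s₁ s₂ ×ˢ Set.Icc v w := by
      rw [← Set.prod_union, Set.Icc_union_Icc_eq_Icc huv hvw]
    simp only [hgood, hun]
    refine exists_isPrimitiveAlong_union (hclosed _ _ _ _) (hclosed _ _ _ _) ?_ ?_ h1 h2
    · rw [← hun]
      exact hh.mono (Set.prod_mono subset_rfl (Set.Icc_subset_Icc hu hw))
    · rw [Set.prod_inter_prod, Set.inter_self, Set.Icc_inter_Icc_eq_singleton huv hvw]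
      exact (isConnected_Icc hs).prod isConnected_singleton
  · intro u hu
    obtain ⟨δ, hδ, h1⟩ : ∃ δ > 0, ∀ u₁ ∈ Set.Icc t₁ t₂, ∀ u₂ ∈ Set.Icc t₁ t₂,
        |u₁ - u| < δ → |u₂ - u| < δ → u₁ ≤ u₂ → good s₁ s₂ u₁ u₂ := by
      refine Icc_subdivision_induction (P := fun x y => ∃ δ > 0, ∀ u₁ ∈ Set.Icc t₁ t₂,
        ∀ u₂ ∈ Set.Icc t₁ t₂, |u₁ - u| < δ → |u₂ - u| < δ → u₁ ≤ u₂ → good x y u₁ u₂) hs ?_ ?_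
      · rintro x y z hx hxy hyz hz ⟨δ₁, hδ₁, h1⟩ ⟨δ₂, hδ₂, h2⟩
        refine ⟨min δ₁ δ₂, lt_min hδ₁ hδ₂, fun u₁ hu₁ u₂ hu₂ hd1 hd2 hle => ?_⟩
        rw [lt_min_iff] at hd1 hd2
        obtain ⟨Φ₁, h1⟩ := h1 u₁ hu₁ u₂ hu₂ hd1.1 hd2.1 hle
        obtain ⟨Φ₂, h2⟩ := h2 u₁ hu₁ u₂ hu₂ hd1.2 hd2.2 hle
        have hun : Set.Icc x z ×ˢ Set.Icc u₁ u₂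
            = Set.Icc x y ×ˢ Set.Icc u₁ u₂ ∪ Set.Icc y z ×ˢ Set.Icc u₁ u₂ := by
          rw [← Set.union_prod, Set.Icc_union_Icc_eq_Icc hxy hyz]
        simp only [hgood, hun]
        refine exists_isPrimitiveAlong_union (hclosed _ _ _ _) (hclosed _ _ _ _) ?_ ?_ h1 h2
        · rw [← hun]
          exact hh.mono (Set.prod_mono (Set.Icc_subset_Icc hx hz) (Set.Icc_subset_Icc hu₁.1 hu₂.2))
        · rw [Set.prod_inter_prod, Set.inter_self, Set.Icc_inter_Icc_eq_singleton hxy hyz]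
          exact isConnected_singleton.prod (isConnected_Icc hle)
      · intro x hx
        obtain ⟨δ, hδ, h1⟩ := hsmall x hx u hu
        exact ⟨δ, hδ, fun x₁ hx₁ x₂ hx₂ hd1 hd2 _ => ⟨δ, hδ, fun u₁ hu₁ u₂ hu₂ hd3 hd4 _ =>
          h1 x₁ hx₁ x₂ hx₂ u₁ hu₁ u₂ hu₂ hd1 hd2 hd3 hd4⟩⟩
    exact ⟨δ, hδ, fun u₁ hu₁ u₂ hu₂ hd1 hd2 hle => h1 u₁ hu₁ u₂ hu₂ hd1 hd2 hle⟩

end Primitive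

/-! ### Line integrals of locally Lipschitz curves -/

section LineIntegrals

/-- The fundamental theorem of calculus for a complex valued Lipschitz function. -/
theorem LipschitzOnWith.integral_eq_sub_of_ae_hasDerivAt {u v : ℝ} (huv : u ≤ v) {ψ ψ' : ℝ → ℂ}
    {K : NNReal} (hψ : LipschitzOnWith K ψ (Set.Icc u v))
    (hint : IntervalIntegrable ψ' volume u v)
    (hd : ∀ᵐ t, t ∈ Set.Ioo u v → HasDerivAt ψ (ψ' t) t) : ∫ t in u..v, ψ' t = ψ v - ψ u := by
  have hne : ∀ᵐ t : ℝ, t ≠ v := by simp [ae_iff, measure_singleton]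
  -- apply a real linear functional
  have key : ∀ L : ℂ →L[ℝ] ℝ, L (∫ t in u..v, ψ' t) = L (ψ v - ψ u) := by
    intro L
    have h1 : LipschitzOnWith (‖L‖₊ * K) (fun t => L (ψ t)) (Set.uIcc u v) := by
      rw [Set.uIcc_of_le huv]
      exact L.lipschitz.comp_lipschitzOnWith hψ
    have h2 := h1.absolutelyContinuousOnInterval.integral_deriv_eq_sub
    rw [map_sub, ← h2, ← L.intervalIntegral_comp_comm hint]
    refine intervalIntegral.integral_congr_ae ?_
    filter_upwards [hd, hne] with t ht htv htI
    rw [Set.uIoc_of_le huv] at htI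
    exact ((L.hasFDerivAt.comp_hasDerivAt t (ht ⟨htI.1, htI.2.lt_of_ne htv⟩)).deriv).symm
  exact Complex.ext (key Complex.reCLM) (key Complex.imCLM)

/-- A function that is locally the composition of a curve with a primitive of `f` computes the
integral of `f` along the curve. -/
theorem intervalIntegral_eq_sub_of_isPrimitiveAlong {f : ℂ → ℂ} {U : Set ℂ} (hU : IsOpen U)
    (hf : ContinuousOn f U) {g : ℝ → ℂ} {J : Set ℝ} (hJ : IsOpen J) (hg : LocallyLipschitzOn J g)
    {u v : ℝ} (huv : u ≤ v) (hJuv : Set.Icc u v ⊆ J) (hgU : Set.MapsTo g (Set.Icc u v) U)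
    {φ : ℝ → ℂ} (hφ : ∀ x ∈ Set.Icc u v, IsPrimitiveAlong f g (Set.Icc u v) φ x)
    (hint : IntervalIntegrable (fun t => deriv g t * f (g t)) volume u v) :
    ∫ t in u..v, deriv g t * f (g t) = φ v - φ u := by
  have hintm : ∀ x y, u ≤ x → x ≤ y → y ≤ v →
      IntervalIntegrable (fun t => deriv g t * f (g t)) volume x y := fun x y hx hxy hy =>
    hint.mono_set (by
      rw [Set.uIcc_of_le hxy, Set.uIcc_of_le huv]
      exact Set.Icc_subset_Icc hx hy)
  refine Icc_subdivision_induction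
    (P := fun x y => ∫ t in x..y, deriv g t * f (g t) = φ y - φ x) huv ?_ ?_
  · intro x y z hx hxy hyz hz h1 h2
    rw [← intervalIntegral.integral_add_adjacent_intervals (hintm x y hx hxy (hyz.trans hz))
      (hintm y z (hx.trans hxy) hyz hz), h1, h2]
    ring
  · intro x hx
    obtain ⟨F, hF, hφF⟩ := hφ x hx
    -- a ball around `g x` on which `F` is Lipschitz
    have hfb : ∀ᶠ w in 𝓝 (g x), ‖f w‖ < ‖f (g x)‖ + 1 := by
      have h1 : ContinuousAt f (g x) := hf.continuousAt (hU.mem_nhds (hgU hx))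
      exact h1.norm.eventually_lt_const (by linarith)
    obtain ⟨ρ, hρ, hb⟩ := Metric.eventually_nhds_iff_ball.1 (hF.and hfb)
    have hFL : LipschitzOnWith (‖f (g x)‖₊ + 1) F (Metric.ball (g x) ρ) :=
      (convex_ball _ _).lipschitzOnWith_of_nnnorm_hasDerivWithin_le
        (fun w hw => (hb w hw).1.hasDerivWithinAt) (fun w hw => by
          rw [← NNReal.coe_le_coe]; push_cast; exact (hb w hw).2.le)
    obtain ⟨K, s, hs, hK⟩ := hg (hJuv hx)
    rw [nhdsWithin_eq_nhds.2 (hJ.mem_nhds (hJuv hx))] at hs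
    have hgc : ContinuousAt g x := (hK.continuousOn).continuousAt hs
    have hgb : ∀ᶠ t in 𝓝 x, g t ∈ Metric.ball (g x) ρ := hgc (Metric.ball_mem_nhds _ hρ)
    have hφ' : ∀ᶠ t in 𝓝 x, t ∈ Set.Icc u v → φ t = F (g t) := eventually_nhdsWithin_iff.1 hφF
    obtain ⟨δ, hδ, hδ'⟩ := Metric.eventually_nhds_iff_ball.1 (hgb.and (hφ'.and hs))
    refine ⟨δ, hδ, fun y hy z hz hyx hzx hyz => ?_⟩
    have hsub : Set.Icc y z ⊆ Metric.ball x δ := fun t ht => by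
      rw [Metric.mem_ball, Real.dist_eq, abs_lt]
      rw [abs_lt] at hyx hzx
      constructor <;> linarith [ht.1, ht.2]
    rw [(hδ' z (hsub ⟨hyz, le_rfl⟩)).2.1 hz, (hδ' y (hsub ⟨le_rfl, hyz⟩)).2.1 hy]
    have hL : LipschitzOnWith ((‖f (g x)‖₊ + 1) * K) (fun t => F (g t)) (Set.Icc y z) :=
      hFL.comp (hK.mono fun t ht => (hδ' t (hsub ht)).2.2) fun t ht => (hδ' t (hsub ht)).1
    refine hL.integral_eq_sub_of_ae_hasDerivAt hyz (hintm y z hy.1 hyz hz.2) ?_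
    have hae := (hK.mono (s := Set.Icc y z)
      fun t ht => (hδ' t (hsub ht)).2.2).ae_differentiableWithinAt_of_mem (μ := volume)
    filter_upwards [hae] with t ht htI
    have h1 : HasDerivAt g (deriv g t) t :=
      ((ht (Set.Ioo_subset_Icc_self htI)).differentiableAt (Icc_mem_nhds htI.1 htI.2)).hasDerivAt
    have h2 := (hb _ (hδ' t (hsub (Set.Ioo_subset_Icc_self htI))).1).1
    have h3 := h2.scomp t h1
    rwa [smul_eq_mul] at h3

/-- The integral over a set is approximated by the integrals over large compact intervals. -/
theorem exists_norm_setIntegral_sub_le {F : Type*} [NormedAddCommGroup F] [NormedSpace ℝ F]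
    {J : Set ℝ} (hJ : IsOpen J) (hJc : J.OrdConnected) (hne : J.Nonempty) {φ : ℝ → F}
    (hφ : IntegrableOn φ J) {η : ℝ} (hη : 0 < η) :
    ∃ T₁ ∈ J, ∃ T₂ ∈ J, T₁ ≤ T₂ ∧ ∀ c ∈ J, ∀ d ∈ J, c ≤ T₁ → T₂ ≤ d →
      ‖(∫ t in J, φ t) - ∫ t in c..d, φ t‖ ≤ η := by
  set ν : Measure ℝ := (volume.restrict J).withDensity (fun t => ‖φ t‖ₑ) with hν
  have hfin : IsFiniteMeasure ν := isFiniteMeasure_withDensity hφ.2.ne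
  obtain ⟨K, hKJ, hK, hKη⟩ := hJ.measurableSet.exists_isCompact_sdiff_lt (μ := ν)
    (measure_ne_top _ _) (ENNReal.ofReal_pos.2 hη).ne'
  obtain ⟨t₀, ht₀⟩ := hne
  have hK' : IsCompact (insert t₀ K) := hK.insert t₀
  have hsubJ : insert t₀ K ⊆ J := Set.insert_subset ht₀ hKJ
  obtain ⟨T₁, hT₁, hmin⟩ := hK'.exists_isLeast (Set.insert_nonempty _ _)
  obtain ⟨T₂, hT₂, hmax⟩ := hK'.exists_isGreatest (Set.insert_nonempty _ _)
  refine ⟨T₁, hsubJ hT₁, T₂, hsubJ hT₂, hmin hT₂, fun c hc d hd hcT hTd => ?_⟩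
  have hcd : c ≤ d := hcT.trans ((hmin hT₂).trans hTd)
  have hsub : Set.Icc c d ⊆ J := hJc.out hc hd
  rw [intervalIntegral.integral_of_le hcd, ← integral_Icc_eq_integral_Ioc,
    ← setIntegral_sdiff measurableSet_Icc hφ hsub]
  have h1 : ν (J \ Set.Icc c d) ≤ ENNReal.ofReal η := by
    refine (measure_mono (Set.sdiff_subset_sdiff_right fun t ht => ?_)).trans hKη.le
    exact ⟨hcT.trans (hmin (Set.mem_insert_of_mem _ ht)),
      (hmax (Set.mem_insert_of_mem _ ht)).trans hTd⟩
  have hm : MeasurableSet (J \ Set.Icc c d) := hJ.measurableSet.diff measurableSet_Icc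
  rw [hν, withDensity_apply _ hm, Measure.restrict_restrict hm,
    Set.inter_eq_self_of_subset_left Set.sdiff_subset] at h1
  have h2 := (enorm_integral_le_lintegral_enorm (μ := volume.restrict (J \ Set.Icc c d)) φ).trans h1
  rw [← ofReal_norm, ENNReal.ofReal_le_ofReal_iff hη.le] at h2
  exact h2

end LineIntegrals

/-! ### Crosscuts near the end points -/

section Crosscuts

/-- The circle of radius `r` around the real point `p`, parametrized so that it starts on the real
axis at `p + δ r` (with `δ = 1` or `δ = -1`) and enters the side of the axis given by `σ`. -/
def circleArc (p r δ σ θ : ℝ) : ℂ := ⟨p + δ * r * Real.cos θ, σ * r * Real.sin θ⟩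

theorem hasDerivAt_circleArc (p r δ σ θ : ℝ) :
    HasDerivAt (circleArc p r δ σ) ⟨-(δ * r * Real.sin θ), σ * r * Real.cos θ⟩ θ := by
  have h1 : HasDerivAt (fun θ => p + δ * r * Real.cos θ) (-(δ * r * Real.sin θ)) θ := by
    have := ((Real.hasDerivAt_cos θ).const_mul (δ * r)).const_add p
    rwa [mul_neg] at this
  have h2 : HasDerivAt (fun θ => σ * r * Real.sin θ) (σ * r * Real.cos θ) θ :=
    (Real.hasDerivAt_sin θ).const_mul (σ * r)
  have h3 := (h1.ofReal_comp).add ((h2.ofReal_comp).mul_const Complex.I)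
  rw [Complex.mk_eq_add_mul_I, show circleArc p r δ σ = _ from
    funext fun x => Complex.mk_eq_add_mul_I _ _]
  exact h3

theorem continuous_circleArc (p r δ σ : ℝ) : Continuous (circleArc p r δ σ) :=
  continuous_iff_continuousAt.2 fun θ => (hasDerivAt_circleArc p r δ σ θ).continuousAt

theorem norm_eq_of_sq_add_sq {x y r : ℝ} (hr : 0 ≤ r) (h : x ^ 2 + y ^ 2 = r ^ 2) :
    ‖(⟨x, y⟩ : ℂ)‖ = r := by
  rw [Complex.norm_def, Complex.normSq_mk, ← Real.sqrt_sq hr, ← h]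
  ring_nf

theorem norm_circleArc_sub {p r δ σ : ℝ} (hr : 0 ≤ r) (hδ : δ ^ 2 = 1) (hσ : σ ^ 2 = 1) (θ : ℝ) :
    ‖circleArc p r δ σ θ - p‖ = r := by
  have h1 : circleArc p r δ σ θ - p = ⟨δ * r * Real.cos θ, σ * r * Real.sin θ⟩ := by
    simp [circleArc, Complex.ext_iff]
  rw [h1]
  refine norm_eq_of_sq_add_sq hr ?_
  rw [mul_pow, mul_pow, mul_pow, mul_pow, hδ, hσ]
  linear_combination r ^ 2 * Real.cos_sq_add_sin_sq θ

theorem norm_deriv_circleArc {r δ σ : ℝ} (hr : 0 ≤ r) (hδ : δ ^ 2 = 1) (hσ : σ ^ 2 = 1) (θ : ℝ) :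
    ‖(⟨-(δ * r * Real.sin θ), σ * r * Real.cos θ⟩ : ℂ)‖ = r := by
  refine norm_eq_of_sq_add_sq hr ?_
  rw [neg_sq, mul_pow, mul_pow, mul_pow, mul_pow, hδ, hσ]
  linear_combination r ^ 2 * Real.cos_sq_add_sin_sq θ

/-- Every point of the open half circle lies on the arc, with `θ` in `(0, π)`. -/
theorem exists_circleArc_eq {p r δ σ : ℝ} (hr : 0 < r) (hδ : δ ^ 2 = 1) (hσ : σ ^ 2 = 1) {w : ℂ}
    (hw : ‖w - p‖ = r) (hws : 0 < σ * w.im) :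
    ∃ θ ∈ Set.Ioo 0 Real.pi, circleArc p r δ σ θ = w := by
  have h1 : (w.re - p) ^ 2 + w.im ^ 2 = r ^ 2 := by
    rw [← hw, ← Complex.normSq_eq_norm_sq, Complex.normSq_apply]
    simp
    ring
  have him : 0 < w.im ^ 2 := by
    have : w.im ≠ 0 := by rintro h; simp [h] at hws
    positivity
  set x := δ * (w.re - p) / r with hx
  have hx2 : x ^ 2 = (w.re - p) ^ 2 / r ^ 2 := by rw [hx, div_pow, mul_pow, hδ, one_mul]
  have hx1 : x ^ 2 < 1 := by
    rw [hx2, div_lt_one (by positivity)]; linarith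
  obtain ⟨hxl, hxu⟩ := abs_lt.1 ((sq_lt_one_iff_abs_lt_one x).1 hx1)
  have hcos := Real.cos_arccos hxl.le hxu.le
  have hsin : Real.sin (Real.arccos x) = σ * w.im / r := by
    rw [Real.sin_arccos, hx2]
    have : 1 - (w.re - p) ^ 2 / r ^ 2 = (σ * w.im / r) ^ 2 := by
      rw [div_pow, mul_pow, hσ]
      field_simp
      linarith
    rw [this, Real.sqrt_sq (by positivity)]
  refine ⟨Real.arccos x, ⟨Real.arccos_pos.2 hxu, ?_⟩, ?_⟩
  · refine lt_of_le_of_ne (Real.arccos_le_pi _) fun h => ?_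
    rw [Real.arccos_eq_pi] at h
    linarith
  · apply Complex.ext
    · simp only [circleArc, hcos]
      rw [hx]
      field_simp
      linear_combination (w.re - p) * hδ
    · simp only [circleArc, hsin]
      field_simp
      linear_combination w.im * hσ

variable {a b : EReal} {σ : ℝ} {h : ℝ × ℝ → ℂ} {γ : ℝ → ℂ} {Ω : Set ℂ}

namespace IsDeformation

/-- A circle that meets both the interval and the curve contains a crosscut of `Ω`. -/
theorem exists_crosscut (hd : IsDeformation a b σ h γ Ω) (hσ : σ ^ 2 = 1) {p r δ : ℝ} (hr : 0 < r)
    (hδ : δ ^ 2 = 1) (hc : p + δ * r ∈ realInterval a b) {t₁ : ℝ} (ht₁ : t₁ ∈ realInterval a b)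
    (hγ : ‖γ t₁ - p‖ = r) :
    ∃ θ ∈ Set.Ioo 0 Real.pi, ∃ τ ∈ realInterval a b, circleArc p r δ σ θ = γ τ ∧
      (∀ x ∈ Set.Ioo 0 θ, circleArc p r δ σ x ∈ Ω) := by
  set α := circleArc p r δ σ with hα
  have hαc : Continuous α := continuous_circleArc p r δ σ
  have hα0 : α 0 = ((p + δ * r : ℝ) : ℂ) := by simp [hα, circleArc, Complex.ext_iff]
  have hαs : ∀ x ∈ Set.Ioo 0 Real.pi, 0 < σ * (α x).im := by
    intro x hx
    have := Real.sin_pos_of_pos_of_lt_pi hx.1 hx.2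
    have h2 : σ * (α x).im = r * Real.sin x := by
      simp only [hα, circleArc]
      linear_combination (r * Real.sin x) * hσ
    rw [h2]; positivity
  obtain ⟨θ₁, hθ₁, hαθ₁⟩ := exists_circleArc_eq hr hδ hσ hγ (hd.side' t₁ ht₁)
  -- the first point of the arc on the curve
  set S := Set.Icc 0 θ₁ ∩ α ⁻¹' closure (γ '' realInterval a b) with hS
  have hSc : IsCompact S := isCompact_Icc.inter_right (isClosed_closure.preimage hαc)
  have hSn : S.Nonempty :=
    ⟨θ₁, ⟨hθ₁.1.le, le_rfl⟩, subset_closure ⟨t₁, ht₁, hαθ₁.symm⟩⟩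
  obtain ⟨θ, ⟨⟨hθ0, hθ1⟩, hθcl⟩, hmin⟩ := hSc.exists_isLeast hSn
  have hθpos : 0 < θ := by
    refine hθ0.lt_of_ne fun h0 => ?_
    rw [← h0, Set.mem_preimage, hα0] at hθcl
    exact hd.ofReal_notMem_closure_curve hc hθcl
  have hθπ : θ < Real.pi := hθ1.trans_lt hθ₁.2
  have hne : ∀ e : EReal, e ≠ ⊥ → e ≠ ⊤ → α θ ≠ (e.toReal : ℂ) := by
    intro e _ _ he
    have := hαs θ ⟨hθpos, hθπ⟩
    simp [he] at this
  obtain ⟨τ, hτ, hτθ⟩ := hd.mem_curve_of_mem_closure hθcl (disjoint_nhds_endFilter (hne a))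
    (disjoint_nhds_endFilter (hne b))
  refine ⟨θ, ⟨hθpos, hθπ⟩, τ, hτ, hτθ.symm, ?_⟩
  have hsub : α '' Set.Ioo 0 θ ⊆ Ω := by
    refine subset_of_disjoint_frontier (isPreconnected_Ioo.image _ hαc.continuousOn) ?_ hd.isOpen ?_
    · obtain ⟨ρ, hρ, _, hball⟩ := hd.exists_halfBall_subset hc
      have h1 : ∀ᶠ x in 𝓝[>] (0 : ℝ), α x ∈ Metric.ball ((p + δ * r : ℝ) : ℂ) ρ :=
        (hαc.tendsto' 0 _ hα0).mono_left nhdsWithin_le_nhds (Metric.ball_mem_nhds _ hρ)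
      have h2 : ∀ᶠ x in 𝓝[>] (0 : ℝ), x ∈ Set.Ioo 0 θ := Ioo_mem_nhdsGT hθpos
      obtain ⟨x, hx1, hx2⟩ := (h1.and h2).exists
      exact ⟨α x, ⟨x, hx2, rfl⟩, hball ⟨hx1, hαs x ⟨hx2.1, hx2.2.trans hθπ⟩⟩⟩
    · rw [Set.disjoint_left]
      rintro _ ⟨x, hx, rfl⟩ hfr
      rw [hd.frontier_eq] at hfr
      rcases hfr with ⟨s, hs, hsx⟩ | hfr
      · have := hαs x ⟨hx.1, hx.2.trans hθπ⟩
        simp [← hsx] at this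
      · have := hmin ⟨⟨hx.1.le, hx.2.le.trans hθ1⟩, subset_closure hfr⟩
        exact absurd hx.2 (not_lt.2 this)
  exact fun x hx => hsub ⟨x, hx, rfl⟩

/-- There are circles around an end point, within any given neighbourhood of the end point, that
meet the curve but not the image of a given line `t = T`. -/
theorem exists_radius (hd : IsDeformation a b σ h γ Ω) {e : EReal} {V : Set ℂ}
    (hV : V ∈ endFilter e) (hev : ∀ V' ∈ endFilter e, ∃ c ∈ realInterval a b, γ c ∈ V')
    {T : ℝ} (hT : T ∈ realInterval a b)
    (hdis : ∀ w ∈ h '' (Set.Icc (0 : ℝ) 1 ×ˢ realInterval a b), Disjoint (𝓝 w) (endFilter e))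
    (hTe : e ≠ ⊥ → e ≠ ⊤ → T ≠ e.toReal) :
    ∃ r > 0, (∀ w : ℂ, ‖w - e.toReal‖ = r → w ∈ V) ∧
      (e = ⊥ ∨ e = ⊤ → |T| < r) ∧ (¬ (e = ⊥ ∨ e = ⊤) → r < |e.toReal - T|) ∧
      (∀ s ∈ Set.Icc (0 : ℝ) 1, ‖h (s, T) - e.toReal‖ ≠ r) ∧
      ∃ t ∈ realInterval a b, ‖γ t - e.toReal‖ = r := by
  have hKc : IsCompact (h '' (Set.Icc (0 : ℝ) 1 ×ˢ {T})) :=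
    (isCompact_Icc.prod isCompact_singleton).image_of_continuousOn
      (hd.continuousOn.mono (Set.prod_mono subset_rfl (Set.singleton_subset_iff.2 hT)))
  have hcont : ContinuousOn (fun t => ‖γ t - e.toReal‖) (realInterval a b) :=
    (hd.continuousOn_curve.sub continuousOn_const).norm
  have hT1 : h (1, T) = γ T := hd.top T hT
  by_cases he : e = ⊥ ∨ e = ⊤
  · -- at infinity, large circles around the junk value `e.toReal = 0` serve
    have hz : e.toReal = 0 := by rcases he with rfl | rfl <;> simp
    simp only [endFilter, he, if_true] at hV hev
    simp only [hz, Complex.ofReal_zero, sub_zero] at hcont ⊢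
    obtain ⟨R₁, hR₁⟩ := hKc.isBounded.exists_norm_le
    obtain ⟨R₂, -, hR₂⟩ := (hasBasis_cobounded_norm (E := ℂ)).mem_iff.1
      (by rwa [Metric.cobounded_eq_cocompact])
    set r := max (max R₁ R₂) |T| + 1 with hr
    have hrR₁ : R₁ < r := by
      have := (le_max_left R₁ R₂).trans (le_max_left (max R₁ R₂) |T|); linarith
    have hrR₂ : R₂ ≤ r := by
      have := (le_max_right R₁ R₂).trans (le_max_left (max R₁ R₂) |T|); linarith
    have hrT : |T| < r := by
      have := le_max_right (max R₁ R₂) |T|; linarith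
    have hr0 : 0 < r := (abs_nonneg T).trans_lt hrT
    have hKr : ∀ s ∈ Set.Icc (0 : ℝ) 1, ‖h (s, T)‖ < r := fun s hs =>
      (hR₁ _ ⟨(s, T), ⟨hs, rfl⟩, rfl⟩).trans_lt hrR₁
    refine ⟨r, hr0, fun w hw => hR₂ (by simpa [hw] using hrR₂), fun _ => hrT,
      fun hn => absurd he hn, fun s hs => (hKr s hs).ne, ?_⟩
    obtain ⟨c, hc, hcγ⟩ := hev {w : ℂ | r ≤ ‖w‖} (by
      rw [← Metric.cobounded_eq_cocompact]
      exact (hasBasis_cobounded_norm (E := ℂ)).mem_of_mem trivial)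
    have hTγ : ‖γ T‖ ≤ r := by
      rw [← hT1]; exact (hKr 1 ⟨zero_le_one, le_rfl⟩).le
    exact isPreconnected_realInterval.intermediate_value hT hc hcont ⟨hTγ, hcγ⟩
  · have he2 := not_or.1 he
    simp only [endFilter, he, if_false] at hV hev hdis
    obtain ⟨ε, hε, hεV⟩ := Metric.mem_nhds_iff.1 hV
    have hTb : 0 < |e.toReal - T| := abs_pos.2 (sub_ne_zero.2 (hTe he2.1 he2.2).symm)
    have hnot : (e.toReal : ℂ) ∈ (h '' (Set.Icc (0 : ℝ) 1 ×ˢ {T}))ᶜ := by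
      intro hmem
      have h2 := hdis _
        (Set.image_mono (Set.prod_mono subset_rfl (Set.singleton_subset_iff.2 hT)) hmem)
      rw [disjoint_self] at h2
      exact (NeBot.ne inferInstance) h2
    obtain ⟨ε', hε', hεK⟩ := Metric.isOpen_iff.1 hKc.isClosed.isOpen_compl _ hnot
    set r := min (min ε ε') |e.toReal - T| / 2 with hr
    have hm : 0 < min (min ε ε') |e.toReal - T| := lt_min (lt_min hε hε') hTb
    have hr0 : 0 < r := by positivity
    have hrε : r < ε := by
      have := (min_le_left (min ε ε') |e.toReal - T|).trans (min_le_left _ _); linarith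
    have hrε' : r < ε' := by
      have := (min_le_left (min ε ε') |e.toReal - T|).trans (min_le_right _ _); linarith
    have hrT : r < |e.toReal - T| := by
      have := (min_le_right (min ε ε') |e.toReal - T|); linarith
    have hKr : ∀ s ∈ Set.Icc (0 : ℝ) 1, r < ‖h (s, T) - e.toReal‖ := by
      intro s hs
      by_contra! hle
      have h1 : h (s, T) ∈ Metric.ball (e.toReal : ℂ) ε' := by
        rw [Metric.mem_ball, dist_eq_norm]; exact hle.trans_lt hrε'
      exact hεK h1 ⟨(s, T), ⟨hs, rfl⟩, rfl⟩
    refine ⟨r, hr0, fun w hw => hεV ?_, fun hn => absurd hn he, fun _ => hrT,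
      fun s hs => (hKr s hs).ne', ?_⟩
    · rw [Metric.mem_ball, dist_eq_norm, hw]; exact hrε
    · obtain ⟨c, hc, hcγ⟩ := hev _ (Metric.closedBall_mem_nhds (e.toReal : ℂ) hr0)
      rw [Metric.mem_closedBall, dist_eq_norm] at hcγ
      have hTγ : r ≤ ‖γ T - e.toReal‖ := by
        rw [← hT1]; exact (hKr 1 ⟨zero_le_one, le_rfl⟩).le
      exact isPreconnected_realInterval.intermediate_value hc hT hcont ⟨hcγ, hTγ⟩

/-- A crosscut, with its end points, lies in the image of the deformation. -/
theorem circleArc_mem_image (hd : IsDeformation a b σ h γ Ω) {p r δ θ τ : ℝ}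
    (hc : p + δ * r ∈ realInterval a b) (hτ : τ ∈ realInterval a b)
    (hθτ : circleArc p r δ σ θ = γ τ) (hΩ : ∀ x ∈ Set.Ioo 0 θ, circleArc p r δ σ x ∈ Ω) :
    ∀ x ∈ Set.Icc 0 θ,
      circleArc p r δ σ x ∈ h '' (Set.Icc (0 : ℝ) 1 ×ˢ realInterval a b) := by
  intro x hx
  rw [hd.image_eq]
  rcases hx.1.eq_or_lt with h0 | h0
  · refine Or.inl (Or.inr ⟨p + δ * r, hc, ?_⟩)
    rw [← h0]
    simp [circleArc, Complex.ext_iff]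
  rcases hx.2.eq_or_lt with h1 | h1
  · exact Or.inr ⟨τ, hτ, by rw [h1, hθτ]⟩
  · exact Or.inl (Or.inl (hΩ x ⟨h0, h1⟩))

theorem invFunOn_bottom (hd : IsDeformation a b σ h γ Ω) {t : ℝ} (ht : t ∈ realInterval a b) :
    Function.invFunOn h (Set.Icc (0 : ℝ) 1 ×ˢ realInterval a b) (t : ℂ) = (0, t) := by
  rw [← hd.bottom t ht]
  exact hd.injOn.leftInvOn_invFunOn ⟨⟨le_rfl, zero_le_one⟩, ht⟩

theorem invFunOn_top (hd : IsDeformation a b σ h γ Ω) {t : ℝ} (ht : t ∈ realInterval a b) :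
    Function.invFunOn h (Set.Icc (0 : ℝ) 1 ×ˢ realInterval a b) (γ t) = (1, t) := by
  rw [← hd.top t ht]
  exact hd.injOn.leftInvOn_invFunOn ⟨⟨zero_le_one, le_rfl⟩, ht⟩

theorem invFunOn_ne_of_norm_ne {p r T : ℝ} {w : ℂ}
    (hw : w ∈ h '' (Set.Icc (0 : ℝ) 1 ×ˢ realInterval a b)) (hwr : ‖w - p‖ = r)
    (hT : ∀ s ∈ Set.Icc (0 : ℝ) 1, ‖h (s, T) - p‖ ≠ r) :
    (Function.invFunOn h (Set.Icc (0 : ℝ) 1 ×ˢ realInterval a b) w).2 ≠ T := by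
  intro he
  have h1 := Function.invFunOn_mem hw
  have h2 := Function.invFunOn_eq hw
  refine hT _ h1.1 ?_
  rw [← he, Prod.mk.eta, h2, hwr]

/-- Crosscuts of `Ω` along circles close to the right end point: in the deformation parameters they
stay to the right of a given line `t = T`. -/
theorem exists_crosscut_right (hd : IsDeformation a b σ h γ Ω) (hσ : σ ^ 2 = 1) {V : Set ℂ}
    (hV : V ∈ endFilter b) {T : ℝ} (hT : T ∈ realInterval a b) :
    ∃ r > 0, ∃ δ : ℝ, δ ^ 2 = 1 ∧ (∀ w : ℂ, ‖w - b.toReal‖ = r → w ∈ V) ∧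
      b.toReal + δ * r ∈ realInterval a b ∧
      ∃ θ ∈ Set.Ioo 0 Real.pi, ∃ τ ∈ realInterval a b, circleArc b.toReal r δ σ θ = γ τ ∧
        (∀ x ∈ Set.Ioo 0 θ, circleArc b.toReal r δ σ x ∈ Ω) ∧
        ∀ x ∈ Set.Icc 0 θ, T < (Function.invFunOn h (Set.Icc (0 : ℝ) 1 ×ˢ realInterval a b)
          (circleArc b.toReal r δ σ x)).2 := by
  obtain ⟨r, hr, hrV, hinf, hfin, hTr, t₁, ht₁, hγ⟩ := hd.exists_radius hV (fun V' hV' => by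
      obtain ⟨c, hc, hc'⟩ := hd.eventually_right hV'
      exact ⟨c, hc, hd.top c hc ▸ hc' 1 ⟨zero_le_one, le_rfl⟩ c hc le_rfl⟩) hT
    (fun w hw => hd.disjoint_right hw) (fun h1 h2 => (ne_toReal_right hT h1 h2).ne)
  obtain ⟨δ, hδ, hc, hTc⟩ : ∃ δ : ℝ, δ ^ 2 = 1 ∧ b.toReal + δ * r ∈ realInterval a b ∧
      T < b.toReal + δ * r := by
    by_cases hb : b = ⊥ ∨ b = ⊤
    · have hb' : b = ⊤ := hb.resolve_left (ne_bot_of_gt hd.lt)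
      have h1 : T < b.toReal + 1 * r := by
        rw [hb', EReal.toReal_top, zero_add, one_mul]
        exact (le_abs_self T).trans_lt (hinf hb)
      exact ⟨1, one_pow 2, ⟨hT.1.trans (EReal.coe_lt_coe_iff.2 h1), hb' ▸ EReal.coe_lt_top _⟩, h1⟩
    · have hb2 := not_or.1 hb
      have hTb := ne_toReal_right hT hb2.1 hb2.2
      have h2 := hfin hb
      rw [abs_of_pos (sub_pos.2 hTb)] at h2
      have h1 : T < b.toReal + -1 * r := by linarith
      refine ⟨-1, by norm_num, ⟨hT.1.trans (EReal.coe_lt_coe_iff.2 h1), ?_⟩, h1⟩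
      have h3 : ((b.toReal + -1 * r : ℝ) : EReal) < ((b.toReal : ℝ) : EReal) :=
        EReal.coe_lt_coe_iff.2 (by linarith)
      rwa [EReal.coe_toReal hb2.2 hb2.1] at h3
  obtain ⟨θ, hθ, τ, hτ, hθτ, hΩ⟩ := hd.exists_crosscut hσ hr hδ hc ht₁ hγ
  refine ⟨r, hr, δ, hδ, hrV, hc, θ, hθ, τ, hτ, hθτ, hΩ, fun x hx => ?_⟩
  have hmem := hd.circleArc_mem_image hc hτ hθτ hΩ
  by_contra! hle
  -- the second coordinate would take the value `T` on the arc
  have hcont : ContinuousOn (fun x => (Function.invFunOn h (Set.Icc (0 : ℝ) 1 ×ˢ realInterval a b)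
      (circleArc b.toReal r δ σ x)).2) (Set.Icc 0 θ) :=
    continuous_snd.comp_continuousOn (hd.continuousOn_invFunOn.comp
      (continuous_circleArc _ _ _ _).continuousOn hmem)
  have h0 : circleArc b.toReal r δ σ 0 = ((b.toReal + δ * r : ℝ) : ℂ) := by
    simp [circleArc, Complex.ext_iff]
  obtain ⟨y, hy, hyT⟩ := isPreconnected_Icc.intermediate_value hx ⟨le_rfl, hθ.1.le⟩ hcont
    ⟨hle, by rw [h0, hd.invFunOn_bottom hc]; exact hTc.le⟩
  exact invFunOn_ne_of_norm_ne (hmem y hy) (norm_circleArc_sub hr.le hδ hσ y) hTr hyT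

/-- Crosscuts of `Ω` along circles close to the left end point: in the deformation parameters they
stay to the left of a given line `t = T`. -/
theorem exists_crosscut_left (hd : IsDeformation a b σ h γ Ω) (hσ : σ ^ 2 = 1) {V : Set ℂ}
    (hV : V ∈ endFilter a) {T : ℝ} (hT : T ∈ realInterval a b) :
    ∃ r > 0, ∃ δ : ℝ, δ ^ 2 = 1 ∧ (∀ w : ℂ, ‖w - a.toReal‖ = r → w ∈ V) ∧
      a.toReal + δ * r ∈ realInterval a b ∧
      ∃ θ ∈ Set.Ioo 0 Real.pi, ∃ τ ∈ realInterval a b, circleArc a.toReal r δ σ θ = γ τ ∧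
        (∀ x ∈ Set.Ioo 0 θ, circleArc a.toReal r δ σ x ∈ Ω) ∧
        ∀ x ∈ Set.Icc 0 θ, (Function.invFunOn h (Set.Icc (0 : ℝ) 1 ×ˢ realInterval a b)
          (circleArc a.toReal r δ σ x)).2 < T := by
  obtain ⟨r, hr, hrV, hinf, hfin, hTr, t₁, ht₁, hγ⟩ := hd.exists_radius hV (fun V' hV' => by
      obtain ⟨c, hc, hc'⟩ := hd.eventually_left hV'
      exact ⟨c, hc, hd.top c hc ▸ hc' 1 ⟨zero_le_one, le_rfl⟩ c hc le_rfl⟩) hT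
    (fun w hw => hd.disjoint_left hw) (fun h1 h2 => (ne_toReal_left hT h1 h2).ne')
  obtain ⟨δ, hδ, hc, hTc⟩ : ∃ δ : ℝ, δ ^ 2 = 1 ∧ a.toReal + δ * r ∈ realInterval a b ∧
      a.toReal + δ * r < T := by
    by_cases ha : a = ⊥ ∨ a = ⊤
    · have ha' : a = ⊥ := ha.resolve_right (ne_top_of_lt hd.lt)
      have h1 : a.toReal + -1 * r < T := by
        rw [ha', EReal.toReal_bot]
        have := (neg_abs_le T)
        have := hinf ha
        linarith
      exact ⟨-1, by norm_num,
        ⟨ha' ▸ EReal.bot_lt_coe _, (EReal.coe_lt_coe_iff.2 h1).trans hT.2⟩, h1⟩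
    · have ha2 := not_or.1 ha
      have hTa := ne_toReal_left hT ha2.1 ha2.2
      have h2 := hfin ha
      rw [abs_of_neg (sub_neg.2 hTa)] at h2
      have h1 : a.toReal + 1 * r < T := by linarith
      refine ⟨1, by norm_num, ⟨?_, (EReal.coe_lt_coe_iff.2 h1).trans hT.2⟩, h1⟩
      have h3 : ((a.toReal : ℝ) : EReal) < ((a.toReal + 1 * r : ℝ) : EReal) :=
        EReal.coe_lt_coe_iff.2 (by linarith)
      rwa [EReal.coe_toReal ha2.2 ha2.1] at h3
  obtain ⟨θ, hθ, τ, hτ, hθτ, hΩ⟩ := hd.exists_crosscut hσ hr hδ hc ht₁ hγ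
  refine ⟨r, hr, δ, hδ, hrV, hc, θ, hθ, τ, hτ, hθτ, hΩ, fun x hx => ?_⟩
  have hmem := hd.circleArc_mem_image hc hτ hθτ hΩ
  by_contra! hle
  -- the second coordinate would take the value `T` on the arc
  have hcont : ContinuousOn (fun x => (Function.invFunOn h (Set.Icc (0 : ℝ) 1 ×ˢ realInterval a b)
      (circleArc a.toReal r δ σ x)).2) (Set.Icc 0 θ) :=
    continuous_snd.comp_continuousOn (hd.continuousOn_invFunOn.comp
      (continuous_circleArc _ _ _ _).continuousOn hmem)
  have h0 : circleArc a.toReal r δ σ 0 = ((a.toReal + δ * r : ℝ) : ℂ) := by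
    simp [circleArc, Complex.ext_iff]
  obtain ⟨y, hy, hyT⟩ := isPreconnected_Icc.intermediate_value ⟨le_rfl, hθ.1.le⟩ hx hcont
    ⟨by rw [h0, hd.invFunOn_bottom hc]; exact hTc.le, hle⟩
  exact invFunOn_ne_of_norm_ne (hmem y hy) (norm_circleArc_sub hr.le hδ hσ y) hTr hyT

end IsDeformation
end Crosscuts

/-! ### Deformation of the path of integration -/

section DeformationTheorem

variable {a b : EReal} {σ : ℝ} {h : ℝ × ℝ → ℂ} {γ : ℝ → ℂ} {Ω : Set ℂ}

namespace IsDeformation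

/-- The primitive along the deformation changes little along a crosscut on which `f` is small
compared to the reciprocal of the radius. -/
theorem norm_primitive_sub_le (hd : IsDeformation a b σ h γ Ω) (hσ : σ ^ 2 = 1) {f : ℂ → ℂ}
    {U : Set ℂ} (hf : ContinuousOn f U)
    (hQU : h '' (Set.Icc (0 : ℝ) 1 ×ˢ realInterval a b) ⊆ U) {c d : ℝ} {Φ : ℝ × ℝ → ℂ}
    (hΦ : ∀ p ∈ Set.Icc (0 : ℝ) 1 ×ˢ Set.Icc c d,
      IsPrimitiveAlong f h (Set.Icc (0 : ℝ) 1 ×ˢ Set.Icc c d) Φ p)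
    {p r δ θ τ η : ℝ} (hr : 0 < r) (hδ : δ ^ 2 = 1) (hθ : θ ∈ Set.Ioo 0 Real.pi)
    (hc : p + δ * r ∈ realInterval a b)
    (hτ : τ ∈ realInterval a b) (hθτ : circleArc p r δ σ θ = γ τ)
    (hΩ : ∀ x ∈ Set.Ioo 0 θ, circleArc p r δ σ x ∈ Ω)
    (hη : ∀ w ∈ Ω, ‖w - p‖ = r → ‖(w - p) * f w‖ ≤ η)
    (hcd : ∀ x ∈ Set.Icc 0 θ, (Function.invFunOn h (Set.Icc (0 : ℝ) 1 ×ˢ realInterval a b)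
          (circleArc p r δ σ x)).2 ∈ Set.Icc c d) :
    ‖Φ (1, τ) - Φ (0, p + δ * r)‖ ≤ η * Real.pi := by
  set α := circleArc p r δ σ with hα
  set k := Function.invFunOn h (Set.Icc (0 : ℝ) 1 ×ˢ realInterval a b) with hk
  have hmem := hd.circleArc_mem_image hc hτ hθτ hΩ
  have hαc : Continuous α := continuous_circleArc p r δ σ
  have hkα : ContinuousOn (fun x => k (α x)) (Set.Icc 0 θ) :=
    hd.continuousOn_invFunOn.comp hαc.continuousOn hmem
  have hhk : ∀ x ∈ Set.Icc 0 θ, h (k (α x)) = α x := fun x hx => Function.invFunOn_eq (hmem x hx)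
  have hkR : ∀ x ∈ Set.Icc 0 θ, k (α x) ∈ Set.Icc (0 : ℝ) 1 ×ˢ Set.Icc c d := fun x hx =>
    ⟨(Function.invFunOn_mem (hmem x hx)).1, hcd x hx⟩
  -- the primitive along the arc is differentiable
  have hder : ∀ x ∈ Set.Icc 0 θ, HasDerivWithinAt (fun x => Φ (k (α x)))
      (⟨-(δ * r * Real.sin x), σ * r * Real.cos x⟩ * f (α x)) (Set.Icc 0 θ) x := by
    intro x hx
    obtain ⟨F, hF, hΦF⟩ := hΦ _ (hkR x hx)
    rw [hhk x hx] at hF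
    have h1 : HasDerivWithinAt (fun x => F (α x))
        (⟨-(δ * r * Real.sin x), σ * r * Real.cos x⟩ * f (α x)) (Set.Icc 0 θ) x := by
      have := hF.self_of_nhds.scomp x (hasDerivAt_circleArc p r δ σ x)
      rw [smul_eq_mul] at this
      exact this.hasDerivWithinAt
    have h2 : Tendsto (fun x => k (α x)) (𝓝[Set.Icc 0 θ] x)
        (𝓝[Set.Icc (0 : ℝ) 1 ×ˢ Set.Icc c d] (k (α x))) :=
      tendsto_nhdsWithin_iff.2 ⟨hkα x hx, eventually_mem_nhdsWithin.mono hkR⟩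
    have h3 : ∀ᶠ y in 𝓝[Set.Icc 0 θ] x, Φ (k (α y)) = F (α y) := by
      filter_upwards [h2.eventually hΦF, eventually_mem_nhdsWithin] with y hy hy'
      rw [hy, hhk y hy']
    exact h1.congr_of_eventuallyEq h3 (h3.self_of_nhdsWithin hx)
  have hα0 : α 0 = ((p + δ * r : ℝ) : ℂ) := by simp [hα, circleArc, Complex.ext_iff]
  -- the bound for `f` extends to the end points of the arc
  have hbd : ∀ x ∈ Set.Icc 0 θ,
      ‖(⟨-(δ * r * Real.sin x), σ * r * Real.cos x⟩ : ℂ) * f (α x)‖ ≤ η := by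
    have h1 : ∀ x ∈ Set.Icc 0 θ,
        ‖(⟨-(δ * r * Real.sin x), σ * r * Real.cos x⟩ : ℂ) * f (α x)‖ = ‖(α x - p) * f (α x)‖ := by
      intro x _
      rw [norm_mul, norm_mul, norm_deriv_circleArc hr.le hδ hσ, norm_circleArc_sub hr.le hδ hσ]
    have h2 : ContinuousOn (fun x => ‖(α x - p) * f (α x)‖) (Set.Icc 0 θ) :=
      ((hαc.continuousOn.sub continuousOn_const).mul
        (hf.comp hαc.continuousOn fun x hx => hQU (hmem x hx))).norm
    intro x hx
    rw [h1 x hx]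
    have hcl : closure (Set.Ioo 0 θ) = Set.Icc 0 θ := closure_Ioo hθ.1.ne
    have hx' : x ∈ closure (Set.Ioo 0 θ) := hcl ▸ hx
    have hne : (𝓝[Set.Ioo 0 θ] x).NeBot := mem_closure_iff_nhdsWithin_neBot.1 hx'
    refine le_of_tendsto ((h2 x hx).mono_left (nhdsWithin_mono _ Set.Ioo_subset_Icc_self)) ?_
    filter_upwards [self_mem_nhdsWithin] with y hy
    exact hη _ (hΩ y hy) (norm_circleArc_sub hr.le hδ hσ y)
  have hη0 : 0 ≤ η := (norm_nonneg _).trans (hbd 0 ⟨le_rfl, hθ.1.le⟩)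
  have := (convex_Icc (0 : ℝ) θ).norm_image_sub_le_of_norm_hasDerivWithin_le hder hbd
    (⟨le_rfl, hθ.1.le⟩ : (0 : ℝ) ∈ Set.Icc 0 θ) (⟨hθ.1.le, le_rfl⟩ : θ ∈ Set.Icc 0 θ)
  rw [hθτ, hα0, hk, hd.invFunOn_bottom hc, hd.invFunOn_top hτ, sub_zero,
    Real.norm_of_nonneg hθ.1.le] at this
  exact this.trans (mul_le_mul_of_nonneg_left hθ.2.le hη0)

/-- **Deformation of the contour.** The integral of a holomorphic function over the interval agrees
with the integral over the deformed curve, provided that the function is absolutely integrable on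
both and `(w - e) f(w) → 0` at the end points `e` (`w f(w) → 0` at infinity). -/
theorem setIntegral_eq (hd : IsDeformation a b σ h γ Ω) (hσ : σ ^ 2 = 1) {f : ℂ → ℂ}
    {U : Set ℂ} (hU : IsOpen U) (hf : DifferentiableOn ℂ f U)
    (hQU : h '' (Set.Icc (0 : ℝ) 1 ×ˢ realInterval a b) ⊆ U)
    (hγ : LocallyLipschitzOn (realInterval a b) γ)
    (hJ : IntegrableOn (fun t : ℝ => f t) (realInterval a b))
    (hΓ : IntegrableOn (fun t => deriv γ t * f (γ t)) (realInterval a b))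
    (ha : Tendsto (fun w => (w - a.toReal) * f w) (endFilter a ⊓ 𝓟 Ω) (𝓝 0))
    (hb : Tendsto (fun w => (w - b.toReal) * f w) (endFilter b ⊓ 𝓟 Ω) (𝓝 0)) :
    ∫ t in realInterval a b, f t = ∫ t in realInterval a b, deriv γ t * f (γ t) := by
  -- it suffices to bound the difference by an arbitrary multiple of a fixed constant
  suffices key : ∀ η : ℝ, 0 < η → ‖(∫ t in realInterval a b, f t) -
      ∫ t in realInterval a b, deriv γ t * f (γ t)‖ ≤ η * (2 + 2 * Real.pi) by
    have hlim : Tendsto (fun η : ℝ => η * (2 + 2 * Real.pi)) (𝓝[>] 0) (𝓝 0) := by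
      have : Continuous (fun η : ℝ => η * (2 + 2 * Real.pi)) := by fun_prop
      have h := this.tendsto 0
      simp only [zero_mul] at h
      exact h.mono_left nhdsWithin_le_nhds
    have := ge_of_tendsto hlim (eventually_mem_nhdsWithin.mono key)
    exact sub_eq_zero.1 (norm_le_zero_iff.1 this)
  intro η hη
  have hsmall : ∀ e : EReal, Tendsto (fun w => (w - e.toReal) * f w) (endFilter e ⊓ 𝓟 Ω) (𝓝 0) →
      {w : ℂ | w ∈ Ω → ‖(w - e.toReal) * f w‖ ≤ η} ∈ endFilter e := by
    intro e he
    have := (he.norm.eventually_lt_const (by simpa using hη)).mono fun w hw => hw.le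
    exact mem_inf_principal.1 this
  obtain ⟨S₁, hS₁, S₂, hS₂, hS, hSJ⟩ := exists_norm_setIntegral_sub_le isOpen_realInterval
    ordConnected_realInterval hd.nonempty hJ hη
  obtain ⟨T₁, hT₁, T₂, hT₂, hT, hTΓ⟩ := exists_norm_setIntegral_sub_le isOpen_realInterval
    ordConnected_realInterval hd.nonempty hΓ hη
  have hmin : min S₁ T₁ ∈ realInterval a b := by rcases min_choice S₁ T₁ with h | h <;> rwa [h]
  have hmax : max S₂ T₂ ∈ realInterval a b := by rcases max_choice S₂ T₂ with h | h <;> rwa [h]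
  -- the crosscuts reach `J` and the curve beyond the points that control the tails
  obtain ⟨r₁, hr₁, δ₁, hδ₁, hV₁, hc₁, θ₁, hθ₁, τ₁, hτ₁, hθτ₁, hΩ₁, hlt₁⟩ :=
    hd.exists_crosscut_left hσ (hsmall a ha) hmin
  obtain ⟨r₂, hr₂, δ₂, hδ₂, hV₂, hc₂, θ₂, hθ₂, τ₂, hτ₂, hθτ₂, hΩ₂, hlt₂⟩ :=
    hd.exists_crosscut_right hσ (hsmall b hb) hmax
  set c₁ := a.toReal + δ₁ * r₁ with hc₁_def
  set c₂ := b.toReal + δ₂ * r₂ with hc₂_def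
  set k := Function.invFunOn h (Set.Icc (0 : ℝ) 1 ×ˢ realInterval a b) with hk
  have hmem₁ := hd.circleArc_mem_image hc₁ hτ₁ hθτ₁ hΩ₁
  have hmem₂ := hd.circleArc_mem_image hc₂ hτ₂ hθτ₂ hΩ₂
  -- the range of the parameter `t` on the crosscuts
  have hcont₁ : ContinuousOn (fun x => (k (circleArc a.toReal r₁ δ₁ σ x)).2) (Set.Icc 0 θ₁) :=
    continuous_snd.comp_continuousOn (hd.continuousOn_invFunOn.comp
      (continuous_circleArc _ _ _ _).continuousOn hmem₁)
  have hcont₂ : ContinuousOn (fun x => (k (circleArc b.toReal r₂ δ₂ σ x)).2) (Set.Icc 0 θ₂) :=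
    continuous_snd.comp_continuousOn (hd.continuousOn_invFunOn.comp
      (continuous_circleArc _ _ _ _).continuousOn hmem₂)
  have h0₁ : (0 : ℝ) ∈ Set.Icc 0 θ₁ := ⟨le_rfl, hθ₁.1.le⟩
  have h0₂ : (0 : ℝ) ∈ Set.Icc 0 θ₂ := ⟨le_rfl, hθ₂.1.le⟩
  have h1₁ : θ₁ ∈ Set.Icc 0 θ₁ := ⟨hθ₁.1.le, le_rfl⟩
  have h1₂ : θ₂ ∈ Set.Icc 0 θ₂ := ⟨hθ₂.1.le, le_rfl⟩
  obtain ⟨x₁, hx₁, hx₁min⟩ := isCompact_Icc.exists_isMinOn ⟨0, h0₁⟩ hcont₁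
  obtain ⟨x₂, hx₂, hx₂max⟩ := isCompact_Icc.exists_isMaxOn ⟨0, h0₂⟩ hcont₂
  set c := (k (circleArc a.toReal r₁ δ₁ σ x₁)).2 with hc_def
  set d := (k (circleArc b.toReal r₂ δ₂ σ x₂)).2 with hd_def
  have hcJ : c ∈ realInterval a b := (Function.invFunOn_mem (hmem₁ x₁ hx₁)).2
  have hdJ : d ∈ realInterval a b := (Function.invFunOn_mem (hmem₂ x₂ hx₂)).2
  have hmm : min S₁ T₁ ≤ max S₂ T₂ := (min_le_left _ _).trans (hS.trans (le_max_left _ _))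
  have hcd₁ : ∀ x ∈ Set.Icc 0 θ₁, (k (circleArc a.toReal r₁ δ₁ σ x)).2 ∈ Set.Icc c d :=
    fun x hx => ⟨hx₁min hx, (hlt₁ x hx).le.trans (hmm.trans (hlt₂ x₂ hx₂).le)⟩
  have hcd₂ : ∀ x ∈ Set.Icc 0 θ₂, (k (circleArc b.toReal r₂ δ₂ σ x)).2 ∈ Set.Icc c d :=
    fun x hx => ⟨(hlt₁ x₁ hx₁).le.trans (hmm.trans (hlt₂ x hx).le), hx₂max hx⟩
  have hα₁ : circleArc a.toReal r₁ δ₁ σ 0 = (c₁ : ℂ) := by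
    simp [hc₁_def, circleArc, Complex.ext_iff]
  have hα₂ : circleArc b.toReal r₂ δ₂ σ 0 = (c₂ : ℂ) := by
    simp [hc₂_def, circleArc, Complex.ext_iff]
  have hkc₁ : k (circleArc a.toReal r₁ δ₁ σ 0) = (0, c₁) := by rw [hα₁, hk, hd.invFunOn_bottom hc₁]
  have hkc₂ : k (circleArc b.toReal r₂ δ₂ σ 0) = (0, c₂) := by rw [hα₂, hk, hd.invFunOn_bottom hc₂]
  have hkτ₁ : k (circleArc a.toReal r₁ δ₁ σ θ₁) = (1, τ₁) := by rw [hθτ₁, hk, hd.invFunOn_top hτ₁]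
  have hkτ₂ : k (circleArc b.toReal r₂ δ₂ σ θ₂) = (1, τ₂) := by rw [hθτ₂, hk, hd.invFunOn_top hτ₂]
  have hc₁cd := hcd₁ 0 h0₁
  have hc₂cd := hcd₂ 0 h0₂
  have hτ₁cd := hcd₁ θ₁ h1₁
  have hτ₂cd := hcd₂ θ₂ h1₂
  have hc₁lt := hlt₁ 0 h0₁
  have hc₂lt := hlt₂ 0 h0₂
  have hτ₁lt := hlt₁ θ₁ h1₁
  have hτ₂lt := hlt₂ θ₂ h1₂
  rw [hkc₁] at hc₁cd hc₁lt
  rw [hkc₂] at hc₂cd hc₂lt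
  rw [hkτ₁] at hτ₁cd hτ₁lt
  rw [hkτ₂] at hτ₂cd hτ₂lt
  dsimp only at hc₁cd hc₁lt hc₂cd hc₂lt hτ₁cd hτ₁lt hτ₂cd hτ₂lt
  -- the primitive along the deformation computes the integrals over its bottom and its top
  have hsubQ := Icc_prod_subset hcJ hdJ
  have hcd : c ≤ d := hc₁cd.1.trans hc₁cd.2
  obtain ⟨Φ, hΦ⟩ := exists_isPrimitiveAlong_rectangle hU hf zero_le_one hcd
    (hd.continuousOn.mono hsubQ) (fun p hp => hQU ⟨p, hsubQ hp, rfl⟩)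
  have e₁ := hd.norm_primitive_sub_le hσ hf.continuousOn hQU hΦ hr₁ hδ₁ hθ₁ hc₁ hτ₁ hθτ₁ hΩ₁
    (fun w hw hwr => hV₁ w hwr hw) hcd₁
  have e₂ := hd.norm_primitive_sub_le hσ hf.continuousOn hQU hΦ hr₂ hδ₂ hθ₂ hc₂ hτ₂ hθτ₂ hΩ₂
    (fun w hw hwr => hV₂ w hwr hw) hcd₂
  have hside : ∀ (s : ℝ), s ∈ Set.Icc (0 : ℝ) 1 → ∀ g : ℝ → ℂ,
      (∀ t ∈ realInterval a b, h (s, t) = g t) → LocallyLipschitzOn (realInterval a b) g →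
      IntegrableOn (fun t => deriv g t * f (g t)) (realInterval a b) →
      ∀ u v, u ∈ Set.Icc c d → v ∈ Set.Icc c d → u ≤ v →
        ∫ t in u..v, deriv g t * f (g t) = Φ (s, v) - Φ (s, u) := by
    intro s hs g hg hgL hgi u v hu hv huv
    have hsub : Set.Icc u v ⊆ realInterval a b :=
      (Set.Icc_subset_Icc hu.1 hv.2).trans (ordConnected_realInterval.out hcJ hdJ)
    refine intervalIntegral_eq_sub_of_isPrimitiveAlong (φ := fun t => Φ (s, t)) hU hf.continuousOn
      isOpen_realInterval hgL huv hsub ?_ ?_ ?_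
    · intro t ht
      rw [← hg t (hsub ht)]
      exact hQU ⟨(s, t), ⟨hs, hsub ht⟩, rfl⟩
    · intro t ht
      obtain ⟨F, hF, hΦF⟩ := hΦ (s, t) ⟨hs, hu.1.trans ht.1, ht.2.trans hv.2⟩
      rw [hg t (hsub ht)] at hF
      refine ⟨F, hF, ?_⟩
      have h1 : Tendsto (fun t : ℝ => (s, t)) (𝓝[Set.Icc u v] t)
          (𝓝[Set.Icc (0 : ℝ) 1 ×ˢ Set.Icc c d] (s, t)) := by
        refine tendsto_nhdsWithin_iff.2 ⟨?_, ?_⟩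
        · exact (Continuous.prodMk_right s).continuousAt.mono_left nhdsWithin_le_nhds
        · filter_upwards [self_mem_nhdsWithin] with y hy
          exact ⟨hs, hu.1.trans hy.1, hy.2.trans hv.2⟩
      filter_upwards [h1.eventually hΦF, self_mem_nhdsWithin] with y hy hy'
      rw [hy, hg y (hsub hy')]
    · rw [intervalIntegrable_iff_integrableOn_Icc_of_le huv]
      exact hgi.mono_set hsub
  have hderiv : ∀ t : ℝ, deriv (fun t : ℝ => (t : ℂ)) t = 1 := fun t =>
    Complex.ofRealCLM.hasDerivAt.deriv
  have i₁ : ∫ t in c₁..c₂, f t = Φ (0, c₂) - Φ (0, c₁) := by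
    have := hside 0 ⟨le_rfl, zero_le_one⟩ (fun t => (t : ℂ)) hd.bottom
      (fun t _ => ⟨1, Set.univ, univ_mem, Complex.isometry_ofReal.lipschitz.lipschitzOnWith⟩)
      (by simpa only [hderiv, one_mul] using hJ) c₁ c₂ hc₁cd hc₂cd (by linarith)
    simpa only [hderiv, one_mul] using this
  have i₂ := hside 1 ⟨zero_le_one, le_rfl⟩ γ hd.top hγ hΓ τ₁ τ₂ hτ₁cd hτ₂cd (by linarith)
  have j₁ := hSJ c₁ hc₁ c₂ hc₂ (hc₁lt.le.trans (min_le_left _ _))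
    ((le_max_left _ _).trans hc₂lt.le)
  have j₂ := hTΓ τ₁ hτ₁ τ₂ hτ₂ (hτ₁lt.le.trans (min_le_right _ _))
    ((le_max_right _ _).trans hτ₂lt.le)
  rw [i₁] at j₁
  rw [i₂] at j₂
  calc _ = ‖((∫ t in realInterval a b, f t) - (Φ (0, c₂) - Φ (0, c₁)))
        - ((∫ t in realInterval a b, deriv γ t * f (γ t)) - (Φ (1, τ₂) - Φ (1, τ₁)))
        - (Φ (1, τ₂) - Φ (0, c₂)) + (Φ (1, τ₁) - Φ (0, c₁))‖ := by congr 1; ring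
    _ ≤ η + η + η * Real.pi + η * Real.pi :=
        (norm_add_le _ _).trans (add_le_add ((norm_sub_le _ _).trans
          (add_le_add ((norm_sub_le _ _).trans (add_le_add j₁ j₂)) e₂)) e₁)
    _ = _ := by ring

end IsDeformation
end DeformationTheorem

/-! ### Cauchy transforms outside the swept domain -/

section CauchyTransform

/-- The factor `(1 - i σ ε w)^{-(N+1)}`, which decays at infinity, has modulus at most `1` on the
side of the real axis given by `σ`, and tends to `1` as `ε → 0`. -/
def dampingFactor (σ ε : ℝ) (N : ℕ) (w : ℂ) : ℂ :=
  ((1 - Complex.I * ((σ * ε : ℝ) : ℂ) * w)⁻¹) ^ (N + 1)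

theorem one_add_sq_le_norm_sq {σ ε : ℝ} (hσ : σ ^ 2 = 1) (hε : 0 ≤ ε) {w : ℂ}
    (hw : 0 ≤ σ * w.im) :
    1 + ε ^ 2 * ‖w‖ ^ 2 ≤ ‖1 - Complex.I * ((σ * ε : ℝ) : ℂ) * w‖ ^ 2 := by
  rw [← Complex.normSq_eq_norm_sq, ← Complex.normSq_eq_norm_sq, Complex.normSq_apply,
    Complex.normSq_apply]
  simp
  nlinarith [mul_nonneg hε hw, sq_nonneg ε]

theorem norm_dampingFactor_le_one {σ ε : ℝ} (hσ : σ ^ 2 = 1) (hε : 0 ≤ ε) (N : ℕ) {w : ℂ}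
    (hw : 0 ≤ σ * w.im) : ‖dampingFactor σ ε N w‖ ≤ 1 := by
  have h1 := one_add_sq_le_norm_sq hσ hε hw
  have h2 : 1 ≤ ‖1 - Complex.I * ((σ * ε : ℝ) : ℂ) * w‖ := by
    by_contra! hlt
    have h3 := norm_nonneg (1 - Complex.I * ((σ * ε : ℝ) : ℂ) * w)
    have h4 : 0 ≤ ε ^ 2 * ‖w‖ ^ 2 := by positivity
    nlinarith
  rw [dampingFactor, norm_pow, norm_inv]
  exact pow_le_one₀ (by positivity) (inv_le_one_of_one_le₀ h2)

theorem norm_dampingFactor_le {σ ε : ℝ} (hσ : σ ^ 2 = 1) (hε : 0 < ε) (hε1 : ε ≤ 1) (N : ℕ)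
    {w : ℂ}
    (hw : 0 ≤ σ * w.im) : ‖dampingFactor σ ε N w‖ ≤ ((ε / 2 * (1 + ‖w‖))⁻¹) ^ (N + 1) := by
  have h1 := one_add_sq_le_norm_sq hσ hε.le hw
  have h2 : ε / 2 * (1 + ‖w‖) ≤ ‖1 - Complex.I * ((σ * ε : ℝ) : ℂ) * w‖ := by
    refine abs_le_of_sq_le_sq' ?_ (norm_nonneg _) |>.2
    refine le_trans ?_ h1
    have h3 := norm_nonneg w
    have h4 : ε ^ 2 ≤ 1 := by nlinarith
    nlinarith [sq_nonneg (1 - ‖w‖), mul_nonneg (sq_nonneg ε) (sq_nonneg (1 - ‖w‖))]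
  rw [dampingFactor, norm_pow, norm_inv]
  have h3 : 0 < ε / 2 * (1 + ‖w‖) := by positivity
  gcongr

theorem ne_zero_of_side {σ ε : ℝ} (hσ : σ ^ 2 = 1) (hε : 0 ≤ ε) {w : ℂ} (hw : 0 ≤ σ * w.im) :
    1 - Complex.I * ((σ * ε : ℝ) : ℂ) * w ≠ 0 := by
  intro h0
  have := one_add_sq_le_norm_sq hσ hε hw
  rw [h0, norm_zero] at this
  have h4 : 0 ≤ ε ^ 2 * ‖w‖ ^ 2 := by positivity
  norm_num at this
  linarith

theorem tendsto_dampingFactor (σ : ℝ) (N : ℕ) (w : ℂ) :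
    Tendsto (fun n : ℕ => dampingFactor σ (1 / ((n : ℝ) + 1)) N w) atTop (𝓝 1) := by
  have h1 : Tendsto (fun ε : ℝ => dampingFactor σ ε N w) (𝓝 0) (𝓝 1) := by
    have h2 : ContinuousAt (fun ε : ℝ => dampingFactor σ ε N w) 0 := by
      unfold dampingFactor
      refine ContinuousAt.pow (ContinuousAt.inv₀ (by fun_prop) (by simp)) _
    have h3 := h2.tendsto
    simpa [dampingFactor] using h3
  exact h1.comp tendsto_one_div_add_atTop_nhds_zero_nat

variable {a b : EReal} {σ : ℝ} {h : ℝ × ℝ → ℂ} {γ : ℝ → ℂ} {Ω : Set ℂ}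

namespace IsDeformation

theorem image_subset_closure (hd : IsDeformation a b σ h γ Ω) :
    h '' (Set.Icc (0 : ℝ) 1 ×ˢ realInterval a b) ⊆ closure Ω := by
  rw [hd.image_eq]
  rintro w ((hw | ⟨t, ht, rfl⟩) | hw)
  · exact subset_closure hw
  · exact frontier_subset_closure (hd.frontier_eq ▸ Or.inl ⟨t, subset_closure ht, rfl⟩)
  · exact frontier_subset_closure (hd.frontier_eq ▸ Or.inr hw)

/-- The behaviour at an end point that is needed for the deformation of the contour. For an infinite
end point the power `N + 1` of the damping factor is one more than the growth of `q`. -/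
theorem tendsto_mul_dampingFactor (hd : IsDeformation a b σ h γ Ω) (hσ : σ ^ 2 = 1) {q : ℂ → ℂ}
    {z : ℂ} {d : ℝ} (hd0 : 0 < d) (hdz : ∀ w ∈ Ω, d ≤ ‖z - w‖) {C : ℝ} {N : ℕ} {e : EReal}
    (hgrowth : e = ⊥ ∨ e = ⊤ → ∀ w ∈ Ω, ‖q w‖ ≤ C * (1 + ‖w‖) ^ N)
    (hend : ¬ (e = ⊥ ∨ e = ⊤) → ∃ M : ℝ, ∀ᶠ w in endFilter e ⊓ 𝓟 Ω, ‖q w‖ ≤ M)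
    {ε : ℝ} (hε : 0 < ε) (hε1 : ε ≤ 1) :
    Tendsto (fun w => (w - e.toReal) * (dampingFactor σ ε N w * ((z - w)⁻¹ * q w)))
      (endFilter e ⊓ 𝓟 Ω) (𝓝 0) := by
  have hinv : ∀ w ∈ Ω, ‖(z - w)⁻¹‖ ≤ d⁻¹ := fun w hw => by
    rw [norm_inv]; gcongr; exact hdz w hw
  have hΩ : ∀ᶠ w in endFilter e ⊓ 𝓟 Ω, w ∈ Ω := mem_inf_of_right (mem_principal_self Ω)
  by_cases he : e = ⊥ ∨ e = ⊤
  · have hz : e.toReal = 0 := by rcases he with rfl | rfl <;> simp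
    simp only [hz, Complex.ofReal_zero, sub_zero]
    have hlim : Tendsto (fun w : ℂ => ((1 + ‖z‖ / d) * (|C| * ((ε / 2)⁻¹) ^ (N + 1))) * (1 + ‖w‖)⁻¹)
        (endFilter e ⊓ 𝓟 Ω) (𝓝 0) := by
      simp only [endFilter, he, if_true]
      have h1 : Tendsto (fun w : ℂ => 1 + ‖w‖) (cocompact ℂ) atTop :=
        tendsto_atTop_add_const_left _ _ (tendsto_norm_cocompact_atTop (E := ℂ))
      have h2 := (tendsto_inv_atTop_zero.comp h1).const_mul
        ((1 + ‖z‖ / d) * (|C| * ((ε / 2)⁻¹) ^ (N + 1)))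
      rw [mul_zero] at h2
      exact h2.mono_left inf_le_left
    refine squeeze_zero_norm' ?_ hlim
    filter_upwards [hΩ] with w hw
    have hzw : 0 < ‖z - w‖ := hd0.trans_le (hdz w hw)
    have h1 : ‖w‖ * ‖(z - w)⁻¹‖ ≤ 1 + ‖z‖ / d := by
      have h2 : ‖w‖ ≤ ‖z - w‖ + ‖z‖ := by
        have := norm_sub_le z (z - w)
        rw [sub_sub_cancel] at this
        linarith
      calc ‖w‖ * ‖(z - w)⁻¹‖ ≤ (‖z - w‖ + ‖z‖) * ‖(z - w)⁻¹‖ := by gcongr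
        _ = 1 + ‖z‖ * ‖(z - w)⁻¹‖ := by rw [norm_inv]; field_simp
        _ ≤ 1 + ‖z‖ * d⁻¹ := by gcongr; exact hinv w hw
        _ = _ := by rw [div_eq_mul_inv]
    have h3 : ‖dampingFactor σ ε N w‖ * ‖q w‖ ≤ (|C| * ((ε / 2)⁻¹) ^ (N + 1)) * (1 + ‖w‖)⁻¹ := by
      have hpos : 0 < 1 + ‖w‖ := by positivity
      calc _ ≤ ((ε / 2 * (1 + ‖w‖))⁻¹) ^ (N + 1) * (|C| * (1 + ‖w‖) ^ N) := by
            gcongr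
            · exact norm_dampingFactor_le hσ hε hε1 N (hd.side w hw).le
            · exact (hgrowth he w hw).trans (by gcongr; exact le_abs_self C)
        _ = _ := by
          rw [mul_inv, mul_pow, inv_pow (1 + ‖w‖), pow_succ (1 + ‖w‖)]
          field_simp
    calc _ = (‖w‖ * ‖(z - w)⁻¹‖) * (‖dampingFactor σ ε N w‖ * ‖q w‖) := by
          rw [norm_mul, norm_mul, norm_mul]; ring
      _ ≤ (1 + ‖z‖ / d) * ((|C| * ((ε / 2)⁻¹) ^ (N + 1)) * (1 + ‖w‖)⁻¹) := by gcongr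
      _ = _ := by ring
  · obtain ⟨M, hM⟩ := hend he
    have hlim : Tendsto (fun w : ℂ => ‖w - e.toReal‖ * (d⁻¹ * M)) (endFilter e ⊓ 𝓟 Ω) (𝓝 0) := by
      simp only [endFilter, he, if_false]
      have h1 : Continuous (fun w : ℂ => ‖w - e.toReal‖ * (d⁻¹ * M)) := by fun_prop
      have h2 := h1.tendsto (e.toReal : ℂ)
      simp only [sub_self, norm_zero, zero_mul] at h2
      exact h2.mono_left inf_le_left
    refine squeeze_zero_norm' ?_ hlim
    filter_upwards [hΩ, hM] with w hw hwM
    rw [norm_mul, norm_mul, norm_mul]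
    refine mul_le_mul_of_nonneg_left ?_ (norm_nonneg _)
    calc _ ≤ 1 * (d⁻¹ * M) :=
          mul_le_mul (norm_dampingFactor_le_one hσ hε.le N (hd.side w hw).le)
            (mul_le_mul (hinv w hw) hwM (norm_nonneg _) (by positivity)) (by positivity) zero_le_one
      _ = _ := one_mul _

/-- Outside the closure of `Ω`, the Cauchy transforms over the interval and over the curve agree. -/
theorem cauchyTransform_eq (hd : IsDeformation a b σ h γ Ω) (hσ : σ ^ 2 = 1) {q : ℂ → ℂ}
    {U : Set ℂ} (hU : IsOpen U) (hq : DifferentiableOn ℂ q U)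
    (hQU : h '' (Set.Icc (0 : ℝ) 1 ×ˢ realInterval a b) ⊆ U)
    (hγ : LocallyLipschitzOn (realInterval a b) γ)
    (hJ : IntegrableOn (fun t : ℝ => q t) (realInterval a b))
    (hΓ : IntegrableOn (fun t => deriv γ t * q (γ t)) (realInterval a b))
    (hgrowth : a = ⊥ ∨ b = ⊤ → ∃ (C : ℝ) (N : ℕ), ∀ w ∈ Ω, ‖q w‖ ≤ C * (1 + ‖w‖) ^ N)
    (hend : ∀ e, (e = a ∨ e = b) → ¬ (e = ⊥ ∨ e = ⊤) →
      ∃ M : ℝ, ∀ᶠ w in endFilter e ⊓ 𝓟 Ω, ‖q w‖ ≤ M)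
    {z : ℂ} (hz : z ∉ closure Ω) :
    ∫ t in realInterval a b, (z - t)⁻¹ * q t =
      ∫ t in realInterval a b, deriv γ t * ((z - γ t)⁻¹ * q (γ t)) := by
  obtain ⟨d, hd0, hdz⟩ := Metric.isOpen_iff.1 isClosed_closure.isOpen_compl z hz
  have hdz : ∀ w ∈ closure Ω, d ≤ ‖z - w‖ := by
    intro w hw
    by_contra! hlt
    have h' : w ∈ Metric.ball z d := by rwa [Metric.mem_ball, dist_eq_norm, norm_sub_rev]
    exact hdz h' hw
  obtain ⟨C, N, hCN⟩ : ∃ (C : ℝ) (N : ℕ), a = ⊥ ∨ b = ⊤ → ∀ w ∈ Ω, ‖q w‖ ≤ C * (1 + ‖w‖) ^ N := by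
    by_cases hab : a = ⊥ ∨ b = ⊤
    · obtain ⟨C, N, hC⟩ := hgrowth hab
      exact ⟨C, N, fun _ => hC⟩
    · exact ⟨0, 0, fun h => absurd h hab⟩
  have hclQ := hd.image_subset_closure
  have hinv : ∀ w ∈ closure Ω, ‖(z - w)⁻¹‖ ≤ d⁻¹ := fun w hw => by
    rw [norm_inv]; gcongr; exact hdz w hw
  have hJcl : ∀ t ∈ realInterval a b, (t : ℂ) ∈ closure Ω := fun t ht => hclQ (by
    rw [hd.image_eq]; exact Or.inl (Or.inr ⟨t, ht, rfl⟩))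
  have hΓcl : ∀ t ∈ realInterval a b, γ t ∈ closure Ω := fun t ht => hclQ (by
    rw [hd.image_eq]; exact Or.inr ⟨t, ht, rfl⟩)
  have hγm : AEMeasurable γ (volume.restrict (realInterval a b)) :=
    hd.continuousOn_curve.aemeasurable measurableSet_realInterval
  have hmeas : ∀ ε : ℝ, Measurable (fun w : ℂ => dampingFactor σ ε N w) := fun ε => by
    unfold dampingFactor; fun_prop
  have hmeas' : Measurable (fun w : ℂ => (z - w)⁻¹) := by fun_prop
  have hJi : IntegrableOn (fun t : ℝ => (z - t)⁻¹ * q t) (realInterval a b) := by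
    refine Integrable.bdd_mul (c := d⁻¹) hJ
      (hmeas'.comp Complex.measurable_ofReal).aestronglyMeasurable ?_
    filter_upwards [ae_restrict_mem measurableSet_realInterval] with t ht
    exact hinv _ (hJcl t ht)
  have hΓi : IntegrableOn (fun t : ℝ => deriv γ t * ((z - γ t)⁻¹ * q (γ t)))
      (realInterval a b) := by
    have h1 : IntegrableOn (fun t : ℝ => (z - γ t)⁻¹ * (deriv γ t * q (γ t)))
        (realInterval a b) := by
      refine Integrable.bdd_mul (c := d⁻¹) hΓ (hmeas'.comp_aemeasurable hγm).aestronglyMeasurable ?_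
      filter_upwards [ae_restrict_mem measurableSet_realInterval] with t ht
      exact hinv _ (hΓcl t ht)
    refine h1.congr_fun (fun t _ => ?_) measurableSet_realInterval
    ring
  have hside : ∀ w ∈ closure Ω, 0 ≤ σ * w.im := fun w hw => hd.closure_subset_side hw
  -- the damped identity
  have hdamp : ∀ n : ℕ, ∫ t in realInterval a b,
        dampingFactor σ (1 / ((n : ℝ) + 1)) N t * ((z - t)⁻¹ * q t) =
      ∫ t in realInterval a b,
        dampingFactor σ (1 / ((n : ℝ) + 1)) N (γ t) * (deriv γ t * ((z - γ t)⁻¹ * q (γ t))) := by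
    intro n
    set ε : ℝ := 1 / ((n : ℝ) + 1) with hε_def
    have hε : 0 < ε := by positivity
    have hε1 : ε ≤ 1 := by
      rw [hε_def, div_le_one (by positivity)]
      have : (0 : ℝ) ≤ n := by positivity
      linarith
    set f : ℂ → ℂ := fun w => dampingFactor σ ε N w * ((z - w)⁻¹ * q w) with hf_def
    set U' : Set ℂ := (U ∩ {z}ᶜ) ∩ {w | 1 - Complex.I * ((σ * ε : ℝ) : ℂ) * w ≠ 0} with hU'
    have hU'o : IsOpen U' := (hU.inter isOpen_compl_singleton).inter
      (isOpen_ne_fun (by fun_prop) continuous_const)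
    have hfd : DifferentiableOn ℂ f U' := by
      intro w hw
      have h1 : DifferentiableWithinAt ℂ (fun w => (z - w)⁻¹) U' w :=
        (DifferentiableWithinAt.inv (by fun_prop) (sub_ne_zero.2 fun h => hw.1.2 h.symm))
      have h2 : DifferentiableWithinAt ℂ (fun w => dampingFactor σ ε N w) U' w := by
        have h0 : DifferentiableWithinAt ℂ
            (fun w : ℂ => 1 - Complex.I * ((σ * ε : ℝ) : ℂ) * w) U' w := by fun_prop
        exact (h0.fun_inv hw.2).fun_pow _
      exact h2.mul (h1.mul ((hq w hw.1.1).mono (fun x hx => hx.1.1)))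
    have hQU' : h '' (Set.Icc (0 : ℝ) 1 ×ˢ realInterval a b) ⊆ U' := fun w hw =>
      ⟨⟨hQU hw, fun h => hz (h ▸ hclQ hw)⟩, ne_zero_of_side hσ hε.le (hside w (hclQ hw))⟩
    have hfJ : IntegrableOn (fun t : ℝ => f t) (realInterval a b) := by
      refine Integrable.bdd_mul (c := 1) hJi
        ((hmeas ε).comp Complex.measurable_ofReal).aestronglyMeasurable ?_
      filter_upwards [ae_restrict_mem measurableSet_realInterval] with t ht
      exact norm_dampingFactor_le_one hσ hε.le N (hside _ (hJcl t ht))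
    have hcomm : ∀ t, dampingFactor σ ε N (γ t) * (deriv γ t * ((z - γ t)⁻¹ * q (γ t)))
        = deriv γ t * f (γ t) := fun t => by rw [hf_def]; ring
    have hfΓ : IntegrableOn (fun t : ℝ => deriv γ t * f (γ t)) (realInterval a b) := by
      simp only [← hcomm]
      refine Integrable.bdd_mul (c := 1) hΓi
        ((hmeas ε).comp_aemeasurable hγm).aestronglyMeasurable ?_
      filter_upwards [ae_restrict_mem measurableSet_realInterval] with t ht
      exact norm_dampingFactor_le_one hσ hε.le N (hside _ (hΓcl t ht))
    have hdzΩ : ∀ w ∈ Ω, d ≤ ‖z - w‖ := fun w hw => hdz w (subset_closure hw)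
    simp only [hcomm]
    refine hd.setIntegral_eq hσ hU'o hfd hQU' hγ hfJ hfΓ ?_ ?_
    · exact hd.tendsto_mul_dampingFactor hσ hd0 hdzΩ
        (fun h => hCN (Or.inl (h.resolve_right (ne_top_of_lt hd.lt)))) (hend a (Or.inl rfl)) hε hε1
    · exact hd.tendsto_mul_dampingFactor hσ hd0 hdzΩ
        (fun h => hCN (Or.inr (h.resolve_left (ne_bot_of_gt hd.lt)))) (hend b (Or.inr rfl)) hε hε1
  -- pass to the limit
  have hlim : ∀ (c : ℝ → ℂ) (φ : ℝ → ℂ), AEMeasurable c (volume.restrict (realInterval a b)) →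
      (∀ t ∈ realInterval a b, c t ∈ closure Ω) → IntegrableOn φ (realInterval a b) →
      Tendsto (fun n : ℕ => ∫ t in realInterval a b,
        dampingFactor σ (1 / ((n : ℝ) + 1)) N (c t) * φ t) atTop
        (𝓝 (∫ t in realInterval a b, φ t)) := by
    intro c φ hc hcl hφ
    refine tendsto_integral_of_dominated_convergence (fun t => ‖φ t‖) ?_ hφ.norm ?_ ?_
    · intro n
      exact ((hmeas _).comp_aemeasurable hc).aestronglyMeasurable.mul hφ.1
    · intro n
      filter_upwards [ae_restrict_mem measurableSet_realInterval] with t ht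
      rw [norm_mul]
      exact mul_le_of_le_one_left (norm_nonneg _)
        (norm_dampingFactor_le_one hσ (by positivity) N (hside _ (hcl t ht)))
    · refine Eventually.of_forall fun t => ?_
      have := (tendsto_dampingFactor σ N (c t)).mul_const (φ t)
      rwa [one_mul] at this
  have l₁ := hlim (fun t => (t : ℂ)) _ Complex.measurable_ofReal.aemeasurable hJcl hJi
  have l₂ := hlim γ _ hγm hΓcl hΓi
  simp only [hdamp] at l₁
  exact tendsto_nhds_unique l₁ l₂

end IsDeformation
end CauchyTransform

/-! ### The jump of the Cauchy transform -/

section RealLine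

/-- The real line is removable for continuous functions: cut a rectangle along the real line and
apply the Cauchy-Goursat theorem to both halves, then use Morera's theorem. -/
theorem differentiableOn_of_continuousOn_of_im_ne_zero {f : ℂ → ℂ} {U : Set ℂ} (hU : IsOpen U)
    (hc : ContinuousOn f U) (hf : DifferentiableOn ℂ f (U ∩ {z | z.im ≠ 0})) :
    DifferentiableOn ℂ f U := by
  refine (Complex.isConservativeOn_and_continuousOn_iff_isDifferentiableOn hU).1 ⟨?_, hc⟩
  -- rectangles which the real line does not cut
  have key : ∀ z w : ℂ, Complex.Rectangle z w ⊆ U →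
      (0 : ℝ) ∉ Set.Ioo (min z.im w.im) (max z.im w.im) →
      (∫ x : ℝ in z.re..w.re, f (x + z.im * Complex.I))
        - (∫ x : ℝ in z.re..w.re, f (x + w.im * Complex.I))
        + Complex.I • (∫ y : ℝ in z.im..w.im, f (w.re + y * Complex.I))
        - Complex.I • (∫ y : ℝ in z.im..w.im, f (z.re + y * Complex.I)) = 0 := by
    intro z w hzw h0
    refine Complex.integral_boundary_rect_eq_zero_of_continuousOn_of_differentiableOn f z w
      (hc.mono hzw) (hf.mono fun v hv => ?_)
    rw [Complex.mem_reProdIm] at hv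
    refine ⟨hzw ?_, fun h => h0 (h ▸ hv.2)⟩
    rw [Complex.Rectangle, Complex.mem_reProdIm]
    exact ⟨Set.Ioo_subset_Icc_self hv.1, Set.Ioo_subset_Icc_self hv.2⟩
  intro z w hzw
  rw [← add_eq_zero_iff_eq_neg, Complex.wedgeIntegral_add_wedgeIntegral_eq]
  by_cases h0 : (0 : ℝ) ∈ Set.Ioo (min z.im w.im) (max z.im w.im)
  · have h0' : (0 : ℝ) ∈ Set.uIcc z.im w.im := Set.Ioo_subset_Icc_self h0
    have hsub1 : Complex.Rectangle z (w.re : ℂ) ⊆ Complex.Rectangle z w := fun v hv => by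
      rw [Complex.Rectangle, Complex.mem_reProdIm] at hv ⊢
      simp only [Complex.ofReal_re, Complex.ofReal_im] at hv
      exact ⟨hv.1, Set.uIcc_subset_uIcc Set.left_mem_uIcc h0' hv.2⟩
    have hsub2 : Complex.Rectangle (z.re : ℂ) w ⊆ Complex.Rectangle z w := fun v hv => by
      rw [Complex.Rectangle, Complex.mem_reProdIm] at hv ⊢
      simp only [Complex.ofReal_re, Complex.ofReal_im] at hv
      exact ⟨hv.1, Set.uIcc_subset_uIcc h0' Set.right_mem_uIcc hv.2⟩
    have h1 := key z (w.re : ℂ) (hsub1.trans hzw) (by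
      simp only [Complex.ofReal_im, Set.mem_Ioo, not_and, inf_lt_iff, lt_sup_iff]
      grind)
    have h2 := key (z.re : ℂ) w (hsub2.trans hzw) (by
      simp only [Complex.ofReal_im, Set.mem_Ioo, not_and, inf_lt_iff, lt_sup_iff]
      grind)
    simp only [Complex.ofReal_im, Complex.ofReal_re] at h1 h2
    have hint : ∀ x ∈ Set.uIcc z.re w.re, ∀ y₁ ∈ Set.uIcc z.im w.im, ∀ y₂ ∈ Set.uIcc z.im w.im,
        IntervalIntegrable (fun y : ℝ => f (x + y * Complex.I)) volume y₁ y₂ := by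
      intro x hx y₁ hy₁ y₂ hy₂
      refine ContinuousOn.intervalIntegrable ?_
      refine hc.comp (by fun_prop) fun y hy => hzw ?_
      rw [Complex.Rectangle, Complex.mem_reProdIm]
      simpa using ⟨hx, Set.uIcc_subset_uIcc hy₁ hy₂ hy⟩
    have h3 : ∀ x ∈ Set.uIcc z.re w.re, (∫ y : ℝ in z.im..w.im, f (x + y * Complex.I))
        = (∫ y : ℝ in z.im..0, f (x + y * Complex.I))
          + ∫ y : ℝ in (0 : ℝ)..w.im, f (x + y * Complex.I) := fun x hx =>
      (intervalIntegral.integral_add_adjacent_intervals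
        (hint x hx _ Set.left_mem_uIcc _ h0') (hint x hx _ h0' _ Set.right_mem_uIcc)).symm
    rw [h3 _ Set.left_mem_uIcc, h3 _ Set.right_mem_uIcc]
    simp only [smul_eq_mul] at h1 h2 ⊢
    linear_combination h1 + h2
  · exact key z w hzw h0

end RealLine

section CauchyTransform

variable {F : Type*} [NormedAddCommGroup F] [NormedSpace ℂ F] {μ : Measure ℝ} {k : ℝ → F}
  {c : ℝ → ℂ} {S : Set ℂ}

theorem exists_forall_le_norm_sub {z : ℂ} (hS : IsClosed S) (hz : z ∉ S) :
    ∃ d > 0, ∀ w ∈ S, d ≤ ‖z - w‖ := by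
  obtain ⟨d, hd0, hd⟩ := Metric.isOpen_iff.1 hS.isOpen_compl z hz
  refine ⟨d, hd0, fun w hw => ?_⟩
  by_contra! hlt
  exact hd (show w ∈ Metric.ball z d by rwa [Metric.mem_ball, dist_eq_norm, norm_sub_rev]) hw

theorem norm_inv_le_of_le {d : ℝ} (hd : 0 < d) {w : ℂ} (hw : d ≤ ‖w‖) : ‖w⁻¹‖ ≤ d⁻¹ := by
  rw [norm_inv]; gcongr

theorem integrable_sub_inv_smul (hk : Integrable k μ) (hc : AEMeasurable c μ) (hS : IsClosed S)
    (hcS : ∀ᵐ t ∂μ, c t ∈ S) {z : ℂ} (hz : z ∉ S) :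
    Integrable (fun t => (z - c t)⁻¹ • k t) μ := by
  obtain ⟨d, hd0, hd⟩ := exists_forall_le_norm_sub hS hz
  refine hk.bdd_smul d⁻¹ (AEMeasurable.aestronglyMeasurable (by fun_prop)) ?_
  filter_upwards [hcS] with t ht
  exact norm_inv_le_of_le hd0 (hd _ ht)

theorem differentiableOn_integral_sub_inv_smul (hk : Integrable k μ) (hc : AEMeasurable c μ)
    (hS : IsClosed S) (hcS : ∀ᵐ t ∂μ, c t ∈ S) :
    DifferentiableOn ℂ (fun z => ∫ t, (z - c t)⁻¹ • k t ∂μ) Sᶜ := by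
  intro z hz
  obtain ⟨d, hd0, hd⟩ := exists_forall_le_norm_sub hS hz
  have hball : ∀ w ∈ Metric.ball z (d / 2), ∀ t, c t ∈ S → d / 2 ≤ ‖w - c t‖ := by
    intro w hw t ht
    have h1 := hd _ ht
    have h2 : ‖z - c t‖ ≤ ‖z - w‖ + ‖w - c t‖ := norm_sub_le_norm_sub_add_norm_sub _ _ _
    rw [Metric.mem_ball, dist_comm, dist_eq_norm] at hw
    linarith
  have hd2 : 0 < d / 2 := by positivity
  have h := hasDerivAt_integral_of_dominated_loc_of_deriv_le (μ := μ) (𝕜 := ℂ)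
    (F := fun z t => (z - c t)⁻¹ • k t) (F' := fun z t => (-((z - c t) ^ 2)⁻¹) • k t)
    (bound := fun t => ((d / 2)⁻¹) ^ 2 * ‖k t‖) (x₀ := z)
    (Metric.ball_mem_nhds z hd2)
    (Eventually.of_forall fun w => AEStronglyMeasurable.smul
      (AEMeasurable.aestronglyMeasurable (by fun_prop)) hk.aestronglyMeasurable)
    (integrable_sub_inv_smul hk hc hS hcS hz)
    (AEStronglyMeasurable.smul
      (AEMeasurable.aestronglyMeasurable (by fun_prop)) hk.aestronglyMeasurable)
    ?_ (hk.norm.const_mul _) ?_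
  · exact h.2.differentiableAt.differentiableWithinAt
  · filter_upwards [hcS] with t ht w hw
    rw [norm_smul, norm_neg, norm_inv, norm_pow, ← inv_pow, ← norm_inv]
    gcongr
    exact norm_inv_le_of_le hd2 (hball w hw t ht)
  · filter_upwards [hcS] with t ht w hw
    have h0 : w - c t ≠ 0 := norm_pos_iff.1 (hd2.trans_le (hball w hw t ht))
    have h1 := ((hasDerivAt_id w).sub_const (c t)).fun_inv h0
    have h2 := h1.smul_const (k t)
    rwa [neg_div, one_div] at h2

end CauchyTransform

section Jump

theorem dslope_comm {q : ℂ → ℂ} (z w : ℂ) : dslope q z w = dslope q w z := by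
  rcases eq_or_ne z w with rfl | h
  · rfl
  · rw [dslope_of_ne _ h.symm, dslope_of_ne _ h, slope_comm]

theorem norm_dslope_le {q : ℂ → ℂ} {s : Set ℂ} (hs : Convex ℝ s)
    (hq : ∀ z ∈ s, DifferentiableAt ℂ q z) {M : ℝ} (hM : ∀ z ∈ s, ‖deriv q z‖ ≤ M) {z w : ℂ}
    (hz : z ∈ s) (hw : w ∈ s) : ‖dslope q z w‖ ≤ M := by
  rcases eq_or_ne w z with rfl | h
  · rw [dslope_same]; exact hM _ hw
  · have h1 := hs.norm_image_sub_le_of_norm_deriv_le hq hM hz hw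
    rw [dslope_of_ne _ h, slope_def_module, norm_smul, norm_inv]
    have h2 : 0 < ‖w - z‖ := norm_pos_iff.2 (sub_ne_zero.2 h)
    rw [inv_mul_le_iff₀ h2]
    linarith

theorem integral_sub_inv {c d : ℝ} {z : ℂ} (hz : z.im ≠ 0) :
    ∫ t in c..d, (z - t)⁻¹ = Complex.log (z - c) - Complex.log (z - d) := by
  have hne : ∀ t : ℝ, z - t ∈ Complex.slitPlane := fun t =>
    Complex.mem_slitPlane_iff.2 (Or.inr (by simpa using hz))
  have h1 : ∀ t ∈ Set.uIcc c d,
      HasDerivAt (fun t : ℝ => -Complex.log (z - t)) ((z - t)⁻¹) t := by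
    intro t _
    have h2 : HasDerivAt (fun t : ℝ => z - t) (-1) t := by
      simpa using (Complex.ofRealCLM.hasDerivAt (x := t)).const_sub z
    have h3 := (h2.clog_real (hne t)).fun_neg
    rwa [neg_div, neg_neg, one_div] at h3
  rw [intervalIntegral.integral_eq_sub_of_hasDerivAt h1]
  · ring
  · refine ContinuousOn.intervalIntegrable fun t _ => ContinuousAt.continuousWithinAt ?_
    exact ContinuousAt.inv₀ (by fun_prop) (Complex.slitPlane_ne_zero (hne t))

theorem log_sub_of_im_pos {d : ℝ} {z : ℂ} (hz : 0 < z.im) :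
    Complex.log (z - d) = Complex.log (d - z) + Real.pi * Complex.I := by
  have h := Complex.arg_neg_eq_arg_add_pi_of_im_neg (x := d - z) (by simpa using hz)
  rw [neg_sub] at h
  rw [Complex.log, Complex.log, h, norm_sub_rev]
  push_cast
  ring

theorem log_sub_of_im_neg {d : ℝ} {z : ℂ} (hz : z.im < 0) :
    Complex.log (z - d) = Complex.log (d - z) - Real.pi * Complex.I := by
  have h := Complex.arg_neg_eq_arg_sub_pi_of_im_pos (x := d - z) (by simpa using hz)
  rw [neg_sub] at h
  rw [Complex.log, Complex.log, h, norm_sub_rev]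
  push_cast
  ring

/-- The Plemelj formula in a local form: the Cauchy transform of a density that is holomorphic near
a point of the real line is, near that point and up to `∓ π i` times the density, given on both
sides of the real line by the same holomorphic function. -/
theorem exists_differentiableOn_cauchyTransform {q : ℂ → ℂ} {J : Set ℝ} (hJm : MeasurableSet J)
    (hJ : IntegrableOn (fun t : ℝ => q t) J) {t₀ r R : ℝ} (hr : 0 < r) (hrR : r < R)
    (hq : DifferentiableOn ℂ q (Metric.ball (t₀ : ℂ) R))
    (hrJ : Set.Ioc (t₀ - r) (t₀ + r) ⊆ J) :
    ∃ N : ℂ → ℂ, DifferentiableOn ℂ N (Metric.ball (t₀ : ℂ) r) ∧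
      (∀ z ∈ Metric.ball (t₀ : ℂ) r, 0 < z.im →
        ∫ t in J, (z - t)⁻¹ * q t = N z - Real.pi * Complex.I * q z) ∧
      ∀ z ∈ Metric.ball (t₀ : ℂ) r, z.im < 0 →
        ∫ t in J, (z - t)⁻¹ * q t = N z + Real.pi * Complex.I * q z := by
  set c := t₀ - r with hc_def
  set d := t₀ + r with hd_def
  have hcd : c ≤ d := by linarith
  set I := Set.Ioc c d with hI_def
  set P := Metric.ball (t₀ : ℂ) r with hP_def
  have hPR : Metric.closedBall (t₀ : ℂ) r ⊆ Metric.ball (t₀ : ℂ) R :=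
    Metric.closedBall_subset_ball hrR
  have hIP : ∀ t ∈ I, (t : ℂ) ∈ Metric.closedBall (t₀ : ℂ) r := fun t ht => by
    rw [Metric.mem_closedBall, Complex.dist_eq, ← Complex.ofReal_sub, Complex.norm_real,
      Real.norm_eq_abs, abs_le]
    constructor <;> linarith [ht.1, ht.2]
  have hPre : ∀ z ∈ P, c < z.re ∧ z.re < d := fun z hz => by
    have h1 : |(z - t₀).re| < r := (Complex.abs_re_le_norm _).trans_lt (by
      rwa [hP_def, Metric.mem_ball, Complex.dist_eq] at hz)
    rw [Complex.sub_re, Complex.ofReal_re, abs_lt] at h1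
    constructor <;> linarith [h1.1, h1.2]
  have hqd : ∀ z ∈ Metric.closedBall (t₀ : ℂ) r, DifferentiableAt ℂ q z := fun z hz =>
    hq.differentiableAt (Metric.isOpen_ball.mem_nhds (hPR hz))
  have hqP : DifferentiableOn ℂ q P := hq.mono (Metric.ball_subset_ball hrR.le)
  obtain ⟨M, hM⟩ : ∃ M, ∀ z ∈ Metric.closedBall (t₀ : ℂ) r, ‖deriv q z‖ ≤ M :=
    (isCompact_closedBall _ _).exists_bound_of_continuousOn
      ((hq.deriv Metric.isOpen_ball).continuousOn.mono hPR)
  have hqI : IntegrableOn (fun t : ℝ => q t) I := hJ.mono_set hrJ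
  have hmeas : Measurable (fun t : ℝ => (t : ℂ)) := Complex.measurable_ofReal
  -- the regular part, holomorphic off the real line and continuous
  set F : ℂ → ℂ := fun z => ∫ t in I, dslope q z t with hF_def
  have hFc : ContinuousOn F P := by
    refine continuousOn_of_dominated (bound := fun _ => M) ?_ ?_ ?_ ?_
    · intro z hz
      have h1 : ContinuousOn (dslope q z) (Metric.ball (t₀ : ℂ) R) :=
        (continuousOn_dslope (Metric.isOpen_ball.mem_nhds
          (hPR (Metric.ball_subset_closedBall hz)))).2
          ⟨hq.continuousOn, hqd z (Metric.ball_subset_closedBall hz)⟩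
      exact (h1.comp Complex.continuous_ofReal.continuousOn
        fun t ht => hPR (hIP t ht)).aestronglyMeasurable measurableSet_Ioc
    · intro z hz
      filter_upwards [ae_restrict_mem measurableSet_Ioc] with t ht
      exact norm_dslope_le (convex_closedBall _ _) hqd hM (Metric.ball_subset_closedBall hz)
        (hIP t ht)
    · simp
    · filter_upwards [ae_restrict_mem measurableSet_Ioc] with t ht
      simp_rw [dslope_comm _ (t : ℂ)]
      exact ((continuousOn_dslope (Metric.isOpen_ball.mem_nhds (hPR (hIP t ht)))).2
          ⟨hq.continuousOn, hqd _ (hIP t ht)⟩).mono (Metric.ball_subset_ball hrR.le)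
  have hreal : IsClosed {z : ℂ | z.im = 0} := isClosed_eq Complex.continuous_im continuous_const
  have hint1 : ∀ z : ℂ, z.im ≠ 0 → IntegrableOn (fun t : ℝ => (z - t)⁻¹ * q t) J := fun z hz =>
    integrable_sub_inv_smul hJ hmeas.aemeasurable hreal (Eventually.of_forall fun t => by simp) hz
  have hint2 : ∀ z : ℂ, z.im ≠ 0 → IntegrableOn (fun t : ℝ => (z - t)⁻¹) I := fun z hz => by
    simpa [IntegrableOn] using integrable_sub_inv_smul (μ := volume.restrict I)
      (k := fun _ => (1 : ℂ)) (by simp) hmeas.aemeasurable hreal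
      (Eventually.of_forall fun t => by simp) hz
  have hFeq : ∀ z : ℂ, z.im ≠ 0 →
      F z = q z * (∫ t in I, (z - t)⁻¹) - ∫ t in I, (z - t)⁻¹ * q t := by
    intro z hz
    rw [hF_def, ← integral_const_mul, ← integral_sub ((hint2 z hz).const_mul _)
      ((hint1 z hz).mono_set hrJ)]
    refine integral_congr_ae (Eventually.of_forall fun t => ?_)
    have h1 : (t : ℂ) ≠ z := fun h => hz (by rw [← h, Complex.ofReal_im])
    change dslope q z t = _
    rw [dslope_of_ne _ h1, slope_comm, slope_def_field]
    ring
  have hFd : DifferentiableOn ℂ F P := by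
    refine differentiableOn_of_continuousOn_of_im_ne_zero Metric.isOpen_ball hFc ?_
    have h1 : DifferentiableOn ℂ (fun z : ℂ => ∫ t in I, (z - (t : ℂ))⁻¹) {z | z.im = 0}ᶜ := by
      simpa using differentiableOn_integral_sub_inv_smul (μ := volume.restrict I)
        (k := fun _ => (1 : ℂ)) (by simp) hmeas.aemeasurable hreal
        (Eventually.of_forall fun t => by simp)
    have h2 : DifferentiableOn ℂ (fun z : ℂ => ∫ t in I, (z - (t : ℂ))⁻¹ * q t) {z | z.im = 0}ᶜ :=
      differentiableOn_integral_sub_inv_smul hqI hmeas.aemeasurable hreal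
        (Eventually.of_forall fun t => by simp)
    exact (((hqP.mono Set.inter_subset_left).mul (h1.mono Set.inter_subset_right)).sub
      (h2.mono Set.inter_subset_right)).congr fun z hz => hFeq z hz.2
  -- the distant part
  have hJI : IntegrableOn (fun t : ℝ => q t) (J \ I) := hJ.mono_set Set.sdiff_subset
  have hfar : ∀ t ∈ J \ I, (t : ℂ) ∈ Pᶜ := fun t ht htP => ht.2 (by
    have := hPre _ htP
    rw [Complex.ofReal_re] at this
    exact ⟨this.1, this.2.le⟩)
  have hfard : DifferentiableOn ℂ (fun z : ℂ => ∫ t in J \ I, (z - (t : ℂ))⁻¹ * q t) P := by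
    have h := differentiableOn_integral_sub_inv_smul hJI hmeas.aemeasurable
      Metric.isOpen_ball.isClosed_compl ((ae_restrict_mem (hJm.diff measurableSet_Ioc)).mono hfar)
    rw [compl_compl] at h
    exact h
  have hsplit : ∀ z : ℂ, z.im ≠ 0 → ∫ t in J, (z - t)⁻¹ * q t
      = (∫ t in J \ I, (z - (t : ℂ))⁻¹ * q t)
        + (q z * (Complex.log (z - c) - Complex.log (z - d)) - F z) := by
    intro z hz
    have h1 := integral_sub_inv (c := c) (d := d) hz
    rw [intervalIntegral.integral_of_le hcd] at h1
    rw [hFeq z hz, h1, sub_sub_cancel, add_comm]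
    rw [← setIntegral_union Set.disjoint_sdiff_right (hJm.diff measurableSet_Ioc)
      ((hint1 z hz).mono_set hrJ) ((hint1 z hz).mono_set Set.sdiff_subset),
      Set.union_sdiff_cancel hrJ]
  refine ⟨fun z => (∫ t in J \ I, (z - (t : ℂ))⁻¹ * q t)
    + (q z * (Complex.log (z - c) - Complex.log (d - z)) - F z), ?_, ?_, ?_⟩
  · refine hfard.add ((hqP.mul (DifferentiableOn.sub ?_ ?_)).sub hFd)
    · refine DifferentiableOn.clog (by fun_prop) fun z hz => Complex.mem_slitPlane_iff.2 (Or.inl ?_)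
      simpa using (hPre z hz).1
    · refine DifferentiableOn.clog (by fun_prop) fun z hz => Complex.mem_slitPlane_iff.2 (Or.inl ?_)
      simpa using (hPre z hz).2
  · intro z _ hz
    rw [hsplit z hz.ne', log_sub_of_im_pos (d := d) hz]
    ring
  · intro z _ hz
    rw [hsplit z hz.ne, log_sub_of_im_neg (d := d) hz]
    ring


variable {a b : EReal} {σ : ℝ} {h : ℝ × ℝ → ℂ} {γ : ℝ → ℂ} {Ω : Set ℂ}

/-- In `Ω`, the Cauchy transforms over the interval and over the curve differ by the residue. -/
theorem IsDeformation.cauchyTransform_sub_eq (hd : IsDeformation a b σ h γ Ω) (hσ : σ = 1 ∨ σ = -1)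
    {q : ℂ → ℂ} {U : Set ℂ} (hU : IsOpen U) (hq : DifferentiableOn ℂ q U)
    (hQU : h '' (Set.Icc (0 : ℝ) 1 ×ˢ realInterval a b) ⊆ U)
    (hγ : LocallyLipschitzOn (realInterval a b) γ)
    (hJ : IntegrableOn (fun t : ℝ => q t) (realInterval a b))
    (hΓ : IntegrableOn (fun t => deriv γ t * q (γ t)) (realInterval a b))
    (hgrowth : a = ⊥ ∨ b = ⊤ → ∃ (C : ℝ) (N : ℕ), ∀ w ∈ Ω, ‖q w‖ ≤ C * (1 + ‖w‖) ^ N)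
    (hend : ∀ e, (e = a ∨ e = b) → ¬ (e = ⊥ ∨ e = ⊤) →
      ∃ M : ℝ, ∀ᶠ w in endFilter e ⊓ 𝓟 Ω, ‖q w‖ ≤ M)
    {z : ℂ} (hz : z ∈ Ω) :
    ∫ t in realInterval a b, deriv γ t * ((z - γ t)⁻¹ * q (γ t)) =
      (∫ t in realInterval a b, (z - t)⁻¹ * q t) + 2 * Real.pi * Complex.I * σ * q z := by
  have hσ2 : σ ^ 2 = 1 := by rcases hσ with rfl | rfl <;> norm_num
  set VJ : ℂ → ℂ := fun z => ∫ t in realInterval a b, (z - t)⁻¹ * q t with hVJ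
  set VΓ : ℂ → ℂ := fun z => ∫ t in realInterval a b, deriv γ t * ((z - γ t)⁻¹ * q (γ t)) with hVΓ
  have hmeas : Measurable (fun t : ℝ => (t : ℂ)) := Complex.measurable_ofReal
  have hVJd : DifferentiableOn ℂ VJ {z | z.im = 0}ᶜ :=
    differentiableOn_integral_sub_inv_smul hJ hmeas.aemeasurable
      (isClosed_eq Complex.continuous_im continuous_const)
      (Eventually.of_forall fun t => Complex.ofReal_im t)
  have hVΓd : DifferentiableOn ℂ VΓ (closure (γ '' realInterval a b))ᶜ := by
    refine (differentiableOn_integral_sub_inv_smul hΓ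
      (hd.continuousOn_curve.aemeasurable measurableSet_realInterval) isClosed_closure
      ((ae_restrict_mem measurableSet_realInterval).mono
        fun t ht => subset_closure (Set.mem_image_of_mem γ ht))).congr fun z _ => ?_
    refine integral_congr_ae (Eventually.of_forall fun t => ?_)
    simp only [smul_eq_mul]
    ring
  have hΩU : Ω ⊆ U := fun w hw => hQU (hd.image_eq ▸ Or.inl (Or.inl hw))
  have hJU : ∀ t ∈ realInterval a b, (t : ℂ) ∈ U := fun t ht =>
    hQU (hd.image_eq ▸ Or.inl (Or.inr ⟨t, ht, rfl⟩))
  have hΩim : Ω ⊆ {z | z.im = 0}ᶜ := fun w hw h0 => by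
    have h0 : w.im = 0 := h0
    have := hd.side w hw
    rw [h0, mul_zero] at this
    exact this.false
  have hbelow : ∀ w : ℂ, σ * w.im < 0 → VΓ w = VJ w := fun w hw =>
    (hd.cauchyTransform_eq hσ2 hU hq hQU hγ hJ hΓ hgrowth hend fun hcl => by
      have : 0 ≤ σ * w.im := hd.closure_subset_side hcl
      linarith).symm
  -- a small disk around a point of the interval
  obtain ⟨t₀, ht₀⟩ := hd.nonempty
  obtain ⟨R₁, hR₁, hJ₁, hΩ₁⟩ := hd.exists_halfBall_subset ht₀
  obtain ⟨R₂, hR₂, hU₂⟩ := Metric.isOpen_iff.1 hU _ (hJU t₀ ht₀)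
  obtain ⟨R₃, hR₃, hΓ₃⟩ := Metric.isOpen_iff.1 isClosed_closure.isOpen_compl _
    (hd.ofReal_notMem_closure_curve ht₀)
  set R := min R₁ (min R₂ R₃) with hR_def
  have hR : 0 < R := by positivity
  set r := R / 2 with hr_def
  have hr : 0 < r := by positivity
  have hrR : r < R := by linarith
  have hsub : ∀ {s : ℝ}, R ≤ s → Metric.ball (t₀ : ℂ) r ⊆ Metric.ball (t₀ : ℂ) s := fun hs =>
    Metric.ball_subset_ball (hrR.le.trans hs)
  have hR1 : R ≤ R₁ := min_le_left _ _
  have hR2 : R ≤ R₂ := (min_le_right _ _).trans (min_le_left _ _)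
  have hR3 : R ≤ R₃ := (min_le_right _ _).trans (min_le_right _ _)
  obtain ⟨N, hN, hN₁, hN₂⟩ := exists_differentiableOn_cauchyTransform measurableSet_realInterval hJ
    hr hrR (hq.mono ((Metric.ball_subset_ball hR2).trans hU₂)) (fun t ht => hJ₁ t (by
      rw [abs_lt]; constructor <;> linarith [ht.1, ht.2]))
  set P := Metric.ball (t₀ : ℂ) r with hP
  have hqP : DifferentiableOn ℂ q P := hq.mono ((hsub hR2).trans hU₂)
  have hsideN : ∀ w ∈ P, σ * w.im < 0 → VJ w = N w + Real.pi * Complex.I * σ * q w := by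
    intro w hw hs
    rcases hσ with rfl | rfl
    · simpa using hN₂ w hw (by linarith)
    · exact (hN₁ w hw (by linarith)).trans (by push_cast; ring)
  have hsideN' : ∀ w ∈ P, 0 < σ * w.im → VJ w = N w - Real.pi * Complex.I * σ * q w := by
    intro w hw hs
    rcases hσ with rfl | rfl
    · simpa using hN₁ w hw (by linarith)
    · exact (hN₂ w hw (by linarith)).trans (by push_cast; ring)
  have hvert : ∀ y : ℝ, ((t₀ : ℂ) + (y * σ : ℝ) * Complex.I).im = y * σ := fun y => by simp
  have hvertP : ∀ y : ℝ, |y| < r → (t₀ : ℂ) + (y * σ : ℝ) * Complex.I ∈ P := fun y hy => by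
    have h1 : |σ| = 1 := by rcases hσ with rfl | rfl <;> simp
    rw [hP, Metric.mem_ball, Complex.dist_eq, add_sub_cancel_left, norm_mul, Complex.norm_I,
      mul_one, Complex.norm_real, Real.norm_eq_abs, abs_mul, h1, mul_one]
    exact hy
  have hr2 : |r / 2| < r := by rw [abs_of_pos (by positivity)]; linarith
  have hopen : ∀ {f g : ℂ → ℂ} {A S : Set ℂ} {w₀ : ℂ}, IsOpen A → IsPreconnected A →
      DifferentiableOn ℂ f A → DifferentiableOn ℂ g A → IsOpen S → w₀ ∈ A → w₀ ∈ S →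
      (∀ w ∈ A ∩ S, f w = g w) → Set.EqOn f g A := by
    intro f g A S w₀ hA hAc hf hg hS h1 h2 hfg
    exact (hf.analyticOnNhd hA).eqOn_of_preconnected_of_eventuallyEq (hg.analyticOnNhd hA) hAc h1
      (mem_of_superset ((hA.inter hS).mem_nhds ⟨h1, h2⟩) hfg)
  -- by the identity theorem, the formula on the far side of the real line holds in the disk
  have hloc : Set.EqOn VΓ (fun w => N w + Real.pi * Complex.I * σ * q w) P := by
    refine hopen (S := {w | σ * w.im < 0}) (w₀ := (t₀ : ℂ) + (-(r / 2) * σ : ℝ) * Complex.I)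
      Metric.isOpen_ball (convex_ball _ _).isPreconnected (hVΓd.mono ((hsub hR3).trans hΓ₃))
      (hN.add (hqP.const_mul _)) (isOpen_lt (by fun_prop) continuous_const) (hvertP _ ?_) ?_ ?_
    · rwa [abs_neg]
    · rw [Set.mem_ofPred_eq, hvert]; nlinarith
    · rintro w ⟨hw, hs⟩
      rw [hbelow w hs, hsideN w hw hs]
  have hfin : Set.EqOn VΓ (fun w => VJ w + 2 * Real.pi * Complex.I * σ * q w) Ω := by
    refine hopen (S := P) (w₀ := (t₀ : ℂ) + (r / 2 * σ : ℝ) * Complex.I) hd.isOpen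
      hd.isPreconnected (hVΓd.mono fun w hw => hd.disjoint_closure_curve hw)
      ((hVJd.mono hΩim).add ((hq.mono hΩU).const_mul _)) Metric.isOpen_ball
      (hΩ₁ ⟨hsub hR1 (hvertP _ hr2), ?_⟩) (hvertP _ hr2) ?_
    · rw [Set.mem_ofPred_eq, hvert]; nlinarith
    · rintro w ⟨hw, hwP⟩
      have h1 := hloc hwP
      have h2 := hsideN' w hwP (hd.side w hw)
      simp only at h1 ⊢
      rw [h1, h2]
      ring
  exact hfin hz

end Jump

/-! ### Reflection of the kernel -/

section Reflection

/-- The Schwarz reflection principle. -/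
theorem differentiableOn_reflection {g : ℂ → ℂ} {D : Set ℂ} {J : Set ℝ} (hDo : IsOpen D)
    (hD : ∀ z ∈ D, z.im < 0) (hg : DifferentiableOn ℂ g D)
    (hgc : ContinuousOn g (D ∪ (fun t : ℝ => (t : ℂ)) '' J)) (hgJ : ∀ t ∈ J, (g (t : ℂ)).im = 0)
    (hU : IsOpen (D ∪ {z | conj z ∈ D} ∪ (fun t : ℝ => (t : ℂ)) '' J)) :
    DifferentiableOn ℂ (fun z => if z.im ≤ 0 then g z else conj (g (conj z)))
      (D ∪ {z | conj z ∈ D} ∪ (fun t : ℝ => (t : ℂ)) '' J) := by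
  set q : ℂ → ℂ := fun z => if z.im ≤ 0 then g z else conj (g (conj z)) with hq
  set U := D ∪ {z | conj z ∈ D} ∪ (fun t : ℝ => (t : ℂ)) '' J with hU_def
  have hoff : ∀ z ∈ U, z.im ≠ 0 → DifferentiableAt ℂ q z := by
    rintro z ((hz | hz) | ⟨t, ht, rfl⟩) h0
    · refine (hg.differentiableAt (hDo.mem_nhds hz)).congr_of_eventuallyEq ?_
      filter_upwards [hDo.mem_nhds hz] with w hw
      simp [hq, (hD w hw).le]
    · have h1 : DifferentiableAt ℂ (conj ∘ g ∘ conj) z := by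
        have h2 := (hg.differentiableAt (hDo.mem_nhds hz)).conj_conj
        rwa [Complex.conj_conj] at h2
      refine h1.congr_of_eventuallyEq ?_
      filter_upwards [(hDo.preimage Complex.continuous_conj).mem_nhds hz] with w hw
      have h3 := hD _ hw
      rw [Complex.conj_im] at h3
      simp only [hq, Function.comp_apply]
      rw [if_neg (by linarith)]
    · exact absurd (Complex.ofReal_im t) h0
  have hreal : ∀ z ∈ U, z.im = 0 → ∃ t ∈ J, (t : ℂ) = z := by
    rintro z ((hz | hz) | ⟨t, ht, rfl⟩) h0
    · exact absurd h0 (hD z hz).ne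
    · exact absurd (by rw [Complex.conj_im, h0, neg_zero]) (hD _ hz).ne
    · exact ⟨t, ht, rfl⟩
  refine differentiableOn_of_continuousOn_of_im_ne_zero hU ?_
    fun z hz => (hoff z hz.1 hz.2).differentiableWithinAt
  intro z hz
  by_cases h0 : z.im = 0
  · obtain ⟨t, ht, rfl⟩ := hreal z hz h0
    have hlow : ContinuousWithinAt q (U ∩ {w | w.im ≤ 0}) t := by
      have h1 : ContinuousWithinAt g (U ∩ {w | w.im ≤ 0}) t := by
        refine (hgc t (Or.inr ⟨t, ht, rfl⟩)).mono ?_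
        rintro w ⟨(hw | hw) | hw, hw0⟩
        · exact Or.inl hw
        · have := hD _ hw
          rw [Complex.conj_im] at this
          have hw0 : w.im ≤ 0 := hw0
          linarith
        · exact Or.inr hw
      exact h1.congr (fun w hw => if_pos hw.2) (if_pos (Complex.ofReal_im t).le)
    have hup : ContinuousWithinAt q (U ∩ {w | 0 ≤ w.im}) t := by
      have h1 : ContinuousWithinAt (fun w => conj (g (conj w))) (U ∩ {w | 0 ≤ w.im}) t := by
        have h2 : ContinuousWithinAt g (D ∪ (fun t : ℝ => (t : ℂ)) '' J) (conj (t : ℂ)) := by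
          rw [Complex.conj_ofReal]
          exact hgc t (Or.inr ⟨t, ht, rfl⟩)
        refine Complex.continuous_conj.continuousAt.comp_continuousWithinAt
          (h2.comp Complex.continuous_conj.continuousWithinAt ?_)
        rintro w ⟨(hw | hw) | ⟨s, hs, rfl⟩, hw0⟩
        · have := hD _ hw
          have hw0 : 0 ≤ w.im := hw0
          linarith
        · exact Or.inl hw
        · exact Or.inr ⟨s, hs, (Complex.conj_ofReal s).symm⟩
      have h3 : ∀ w ∈ U, 0 ≤ w.im → q w = conj (g (conj w)) := by
        intro w hw hw0
        rcases hw0.eq_or_lt with hw0 | hw0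
        · obtain ⟨s, hs, rfl⟩ := hreal w hw hw0.symm
          simp only [hq, Complex.ofReal_im, le_refl, if_true, Complex.conj_ofReal]
          exact (Complex.conj_eq_iff_im.2 (hgJ s hs)).symm
        · exact if_neg hw0.not_ge
      exact h1.congr (fun w hw => h3 w hw.1 hw.2) (h3 _ hz (Complex.ofReal_im t).ge)
    refine (hlow.union hup).mono fun w hw => ?_
    rcases le_total w.im 0 with h | h
    · exact Or.inl ⟨hw, h⟩
    · exact Or.inr ⟨hw, h⟩
  · exact (hoff z hz h0).continuousAt.continuousWithinAt

end Reflection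

section Kernel

variable {H₀ H₁ : Type*} [NormedAddCommGroup H₀] [InnerProductSpace ℂ H₀] [CompleteSpace H₀]
  [NormedAddCommGroup H₁] [InnerProductSpace ℂ H₁] [CompleteSpace H₁]

theorem inner_reflectedKernel (G : ℂ → H₁ →L[ℂ] H₁) (x : H₁) (z : ℂ) :
    ⟪x, reflectedKernel G z x⟫_ℂ
      = if z.im ≤ 0 then ⟪x, G z x⟫_ℂ else conj ⟪x, G (conj z) x⟫_ℂ := by
  unfold reflectedKernel
  split_ifs
  · rfl
  · rw [ContinuousLinearMap.adjoint_inner_right, inner_conj_symm]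

theorem reflectedKernel_ofReal (G : ℂ → H₁ →L[ℂ] H₁) (t : ℝ) : reflectedKernel G t = G t :=
  if_pos (Complex.ofReal_im t).le

theorem norm_inner_apply_le {H : Type*} [NormedAddCommGroup H]
    [InnerProductSpace ℂ H] (T : H →L[ℂ] H) (x : H) : ‖⟪x, T x⟫_ℂ‖ ≤ ‖T‖ * ‖x‖ ^ 2 :=
  calc ‖⟪x, T x⟫_ℂ‖ ≤ ‖x‖ * ‖T x‖ := norm_inner_le_norm _ _
    _ ≤ ‖x‖ * (‖T‖ * ‖x‖) := by gcongr; exact T.le_opNorm x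
    _ = _ := by ring

theorem sheetDomain_subset (D : Set ℂ) (l : ℤ) : sheetDomain D l ⊆ D ∪ {z | conj z ∈ D} := by
  unfold sheetDomain
  split_ifs
  · exact Set.subset_union_right
  · exact Set.subset_union_left

variable {E : ProjectionValuedMeasure H₀} {B : H₀ →L[ℂ] H₁} {a b : EReal} {D : Set ℂ}
  {G : ℂ → H₁ →L[ℂ] H₁} {l : ℤ} {γ : ℝ → ℂ} {Ω : Set ℂ} {h : ℝ × ℝ → ℂ}

theorem exists_isDeformation (hab : a < b)
    (hγ : IsDeformedInterval a b D γ Ω) {σ : ℝ} (hside : ∀ z ∈ D, 0 < σ * z.im) :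
    ∃ h, IsDeformation a b σ h γ Ω := by
  obtain ⟨h, h1, h2, h3, h4, h5, h6, h7⟩ := hγ.deformation
  exact ⟨h, hab, h1, h2, h3, h4, h5, h6, h7, hγ.isOpen, hγ.frontier_eq,
    fun z hz => hside z (hγ.subset hz), fun t ht => hside _ (hγ.maps ht)⟩

namespace IsContinuedDerivative

section

variable {H : Type*} [NormedAddCommGroup H] [InnerProductSpace ℂ H] {K : ℝ → H →L[ℂ] H}
  {G : ℂ → H →L[ℂ] H} (hG : IsContinuedDerivative K a b D G)
include hG

theorem side_of_mem_sheetDomain (hl : l = 1 ∨ l = -1) {z : ℂ} (hz : z ∈ sheetDomain D l) :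
    0 < (l : ℝ) * z.im := by
  rcases hl with rfl | rfl
  · have h1 := hG.lower (conj z) (by simpa [sheetDomain] using hz)
    rw [Complex.conj_im] at h1
    push_cast
    linarith
  · have h1 := hG.lower z (by simpa [sheetDomain] using hz)
    push_cast
    linarith

/-- The two sheets and the interval form an open set, since a half disk on one side of the interval
lies in one sheet, and its mirror image in the other one. -/
theorem isOpen_sheets_union (hl : l = 1 ∨ l = -1)
    (hd : IsDeformation a b l h γ Ω) (hΩ : Ω ⊆ sheetDomain D l) :
    IsOpen (D ∪ {z | conj z ∈ D} ∪ (fun t : ℝ => (t : ℂ)) '' realInterval a b) := by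
  have hV : IsOpen (D ∪ {z | conj z ∈ D}) :=
    hG.isOpen.union (hG.isOpen.preimage Complex.continuous_conj)
  have hconj : ∀ z, conj z ∈ D ∪ {z | conj z ∈ D} → z ∈ D ∪ {z | conj z ∈ D} := by
    rintro z (hz | hz)
    · exact Or.inr hz
    · exact Or.inl (by simpa using hz)
  rw [isOpen_iff_mem_nhds]
  rintro z (hz | ⟨t, ht, rfl⟩)
  · exact mem_of_superset (hV.mem_nhds hz) Set.subset_union_left
  · obtain ⟨r, hr, hJ, hr'⟩ := hd.exists_halfBall_subset ht
    have hmem : ∀ w ∈ Metric.ball (t : ℂ) r, 0 < l * w.im → w ∈ D ∪ {z | conj z ∈ D} :=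
      fun w hw h0 => sheetDomain_subset D l (hΩ (hr' ⟨hw, h0⟩))
    refine mem_of_superset (Metric.ball_mem_nhds _ hr) fun w hw => ?_
    rcases lt_trichotomy (l * w.im) 0 with h0 | h0 | h0
    · refine Or.inl (hconj w (hmem _ ?_ (by rw [Complex.conj_im]; linarith)))
      rw [Metric.mem_ball, Complex.dist_eq] at hw ⊢
      rwa [← Complex.conj_ofReal t, ← map_sub, Complex.norm_conj]
    · have h1 : w.im = 0 := by
        rcases mul_eq_zero.1 h0 with h0 | h0
        · rcases hl with rfl | rfl <;> norm_num at h0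
        · exact h0
      have h2 : ((w.re : ℝ) : ℂ) = w := Complex.ext (by simp) (by simp [h1])
      refine Or.inr ⟨w.re, hJ _ ?_, h2⟩
      rw [Metric.mem_ball, ← h2, Complex.dist_eq, ← Complex.ofReal_sub, Complex.norm_real] at hw
      exact hw
    · exact Or.inl (hmem w hw h0)

end

section

variable {K : ℝ → H₁ →L[ℂ] H₁} (hG : IsContinuedDerivative K a b D G)
include hG

theorem continuousOn_reflectedKernel (hl : l = 1 ∨ l = -1) :
    ContinuousOn (reflectedKernel G) (sheetDomain D l) := by
  have hGD : ContinuousOn G D := hG.continuousOn.mono Set.subset_union_left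
  rcases hl with rfl | rfl
  · have h1 : ContinuousOn (fun z => (G (conj z)).adjoint) (sheetDomain D 1) :=
      (ContinuousLinearMap.adjoint (𝕜 := ℂ) (E := H₁) (F := H₁)).continuous.comp_continuousOn
        (hGD.comp Complex.continuous_conj.continuousOn
          fun z hz => by simpa [sheetDomain] using hz)
    refine h1.congr fun z hz => if_neg ?_
    have := hG.side_of_mem_sheetDomain (Or.inl rfl) hz
    push_cast at this
    linarith
  · have h1 : ContinuousOn G (sheetDomain D (-1)) := hGD.mono fun z hz => by
      simpa [sheetDomain] using hz
    refine h1.congr fun z hz => if_pos ?_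
    have := hG.side_of_mem_sheetDomain (Or.inr rfl) hz
    push_cast at this
    linarith

/-- The reflected kernel is bounded near a finite end point. -/
theorem eventually_norm_reflectedKernel_le (hab : a < b) {e : EReal}
    (he : e = a ∨ e = b) (he' : ¬ (e = ⊥ ∨ e = ⊤)) :
    ∃ M : ℝ, ∀ᶠ w in endFilter e ⊓ 𝓟 (sheetDomain D l), ‖reflectedKernel G w‖ ≤ M := by
  have hecl : e.toReal ∈ closure (realInterval a b) := by
    rw [not_or] at he'
    have hcoe := EReal.coe_toReal he'.2 he'.1
    rw [Metric.mem_closure_iff]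
    intro ε hε
    rcases he with rfl | rfl
    · have h1 : e < min b ((e.toReal + ε : ℝ) : EReal) := by
        refine lt_min hab ?_
        rw [← hcoe, EReal.coe_lt_coe_iff, EReal.toReal_coe]
        linarith
      obtain ⟨s, hs1, hs2⟩ := EReal.exists_between_coe_real h1
      refine ⟨s, ⟨hs1, hs2.trans_le (min_le_left _ _)⟩, ?_⟩
      have h2 := hs2.trans_le (min_le_right _ _)
      rw [← hcoe] at hs1
      rw [EReal.coe_lt_coe_iff] at h2 hs1
      rw [Real.dist_eq, abs_lt]
      constructor <;> linarith
    · have h1 : max a ((e.toReal - ε : ℝ) : EReal) < e := by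
        refine max_lt hab ?_
        rw [← hcoe, EReal.coe_lt_coe_iff, EReal.toReal_coe]
        linarith
      obtain ⟨s, hs1, hs2⟩ := EReal.exists_between_coe_real h1
      refine ⟨s, ⟨(le_max_left _ _).trans_lt hs1, hs2⟩, ?_⟩
      have h2 := (le_max_right _ _).trans_lt hs1
      rw [← hcoe] at hs2
      rw [EReal.coe_lt_coe_iff] at h2 hs2
      rw [Real.dist_eq, abs_lt]
      constructor <;> linarith
  have h1 := (hG.continuousOn _ (Or.inr ⟨_, hecl, rfl⟩)).norm
  refine ⟨‖G e.toReal‖ + 1, ?_⟩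
  have h2 : ∀ᶠ w in 𝓝[D ∪ (fun t : ℝ => (t : ℂ)) '' closure (realInterval a b)] (e.toReal : ℂ),
      ‖G w‖ ≤ ‖G e.toReal‖ + 1 :=
    (h1.eventually_lt_const (lt_add_one _)).mono fun w hw => hw.le
  rw [eventually_nhdsWithin_iff] at h2
  simp only [endFilter, he', if_false, eventually_inf_principal]
  have h3 : Tendsto (conj : ℂ → ℂ) (𝓝 (e.toReal : ℂ)) (𝓝 (e.toReal : ℂ)) := by
    have := Complex.continuous_conj.tendsto (e.toReal : ℂ)
    rwa [Complex.conj_ofReal] at this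
  filter_upwards [h2, h3.eventually h2] with w hw1 hw2 hw
  unfold reflectedKernel
  split_ifs with h0
  · refine hw1 (Or.inl ?_)
    rcases sheetDomain_subset D l hw with h4 | h4
    · exact h4
    · have := hG.lower _ h4
      rw [Complex.conj_im] at this
      linarith
  · rw [LinearIsometryEquiv.norm_map]
    refine hw2 (Or.inl ?_)
    rcases sheetDomain_subset D l hw with h4 | h4
    · exact absurd (hG.lower _ h4).le h0
    · exact h4

/-- The kernel is integrable along the curve. -/
theorem integrableOn_deriv_smul_reflectedKernel (hl : l = 1 ∨ l = -1)
    (hγ : IsDeformedInterval a b (sheetDomain D l) γ Ω)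
    (hbdd : kernelVariation (reflectedKernel G) (realInterval a b) γ < ∞) :
    IntegrableOn (fun t => deriv γ t • reflectedKernel G (γ t)) (realInterval a b) := by
  refine ⟨AEStronglyMeasurable.smul (measurable_deriv γ).aestronglyMeasurable ?_, ?_⟩
  · exact ((hG.continuousOn_reflectedKernel hl).comp hγ.locallyLipschitz.continuousOn
      hγ.maps).aestronglyMeasurable measurableSet_realInterval
  · simpa only [HasFiniteIntegral, enorm_smul, kernelVariation] using hbdd

end

variable (hG : IsContinuedDerivative (kernelFunction E B) a b D G)
include hG

/-- The quadratic forms of the continued kernel are holomorphic on both sheets and across the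
interval. -/
theorem differentiableOn_inner_reflectedKernel (hl : l = 1 ∨ l = -1)
    (hd : IsDeformation a b l h γ Ω) (hΩ : Ω ⊆ sheetDomain D l) (x : H₁) :
    DifferentiableOn ℂ (fun z => ⟪x, reflectedKernel G z x⟫_ℂ)
      (D ∪ {z | conj z ∈ D} ∪ (fun t : ℝ => (t : ℂ)) '' realInterval a b) := by
  simp only [inner_reflectedKernel]
  exact differentiableOn_reflection hG.isOpen hG.lower (hG.differentiableOn_inner x)
    ((hG.continuousOn_inner x).mono
      (Set.union_subset_union_right _ (Set.image_mono subset_closure)))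
    (fun t ht => hG.inner_im_eq_zero x ht) (hG.isOpen_sheets_union hl hd hΩ)

end IsContinuedDerivative

end Kernel

/-! ### The transfer function on the contour -/

section Contour

section

variable {H : Type*} [NormedAddCommGroup H] [InnerProductSpace ℂ H]

theorem ContinuousLinearMap.ext_inner_apply_self {S T : H →L[ℂ] H}
    (h : ∀ x, ⟪x, S x⟫_ℂ = ⟪x, T x⟫_ℂ) : S = T := by
  refine ContinuousLinearMap.coe_injective ((ext_inner_map _ _).1 fun x => ?_)
  have h1 := congrArg conj (h x)
  rwa [inner_conj_symm, inner_conj_symm] at h1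

theorem LinearPMap.IsClosed.vadd {A : H →ₗ.[ℂ] H} (hA : A.IsClosed) (T : H →L[ℂ] H) :
    ((T : H →ₗ[ℂ] H) +ᵥ A).IsClosed := by
  have h : (((T : H →ₗ[ℂ] H) +ᵥ A).graph : Set (H × H))
      = (fun p : H × H => (p.1, p.2 - T p.1)) ⁻¹' (A.graph : Set (H × H)) := by
    ext ⟨x, y⟩
    simp only [SetLike.mem_coe, LinearPMap.mem_graph_iff, Set.mem_preimage]
    constructor
    · rintro ⟨u, rfl, rfl⟩
      exact ⟨u, rfl, by rw [LinearPMap.vadd_apply]; simp⟩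
    · rintro ⟨u, rfl, hu⟩
      refine ⟨u, rfl, ?_⟩
      rw [LinearPMap.vadd_apply, hu]
      simp
  unfold LinearPMap.IsClosed
  rw [h]
  exact _root_.IsClosed.preimage (by fun_prop) hA

/-- A holomorphic bounded perturbation of a closed operator is a holomorphic family. -/
theorem holomorphicFamilyOn_transferFunction {A : H →ₗ.[ℂ] H} (hA : A.IsClosed)
    {V : ℂ → H →L[ℂ] H} {U : Set ℂ}
    (hV : DifferentiableOn ℂ V U) : HolomorphicFamilyOn (transferFunction A V) U := by
  refine ⟨A.domain, fun z _ => ⟨hA.vadd _, rfl⟩, fun x hx =>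
    ⟨fun z => (V z x - z • x) + A ⟨x, hx⟩, ?_, ?_⟩⟩
  · exact ((hV.clm_apply (differentiableOn_const x)).sub
      (differentiableOn_id.smul_const x)).add_const _
  · rintro z _ ⟨y, hy⟩ rfl
    rfl

theorem contourIntegrand_eq (G : ℂ → H →L[ℂ] H) (γ : ℝ → ℂ) (z : ℂ) (t : ℝ) :
    contourIntegrand G γ z t = (z - γ t)⁻¹ • (deriv γ t • G (γ t)) :=
  smul_comm _ _ _

end

variable {H₀ H₁ : Type*} [NormedAddCommGroup H₀] [InnerProductSpace ℂ H₀] [CompleteSpace H₀]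
  [NormedAddCommGroup H₁] [InnerProductSpace ℂ H₁] [CompleteSpace H₁]

section

variable {G : ℂ → H₁ →L[ℂ] H₁} {γ : ℝ → ℂ} {J : Set ℝ}

theorem integrableOn_contourIntegrand
    (hk : IntegrableOn (fun t => deriv γ t • G (γ t)) J) (hJ : MeasurableSet J)
    (hγ : ContinuousOn γ J) {z : ℂ} (hz : z ∉ closure (γ '' J)) :
    IntegrableOn (contourIntegrand G γ z) J := by
  have h := integrable_sub_inv_smul hk (hγ.aemeasurable hJ) isClosed_closure
    ((ae_restrict_mem hJ).mono fun t ht => subset_closure (Set.mem_image_of_mem γ ht)) hz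
  exact h.congr (Eventually.of_forall fun t => (contourIntegrand_eq G γ z t).symm)

theorem differentiableOn_contourV
    (hk : IntegrableOn (fun t => deriv γ t • G (γ t)) J) (hJ : MeasurableSet J)
    (hγ : ContinuousOn γ J) :
    DifferentiableOn ℂ (contourV G J γ) (closure (γ '' J))ᶜ :=
  (differentiableOn_integral_sub_inv_smul hk (hγ.aemeasurable hJ) isClosed_closure
    ((ae_restrict_mem hJ).mono fun _ ht => subset_closure (Set.mem_image_of_mem γ ht))).congr
    fun z _ => integral_congr_ae (Eventually.of_forall fun t => contourIntegrand_eq G γ z t)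

theorem inner_contourV
    (hk : IntegrableOn (fun t => deriv γ t • G (γ t)) J) (hJ : MeasurableSet J)
    (hγ : ContinuousOn γ J) {z : ℂ} (hz : z ∉ closure (γ '' J)) (x : H₁) :
    ⟪x, contourV G J γ z x⟫_ℂ
      = ∫ t in J, deriv γ t * ((z - γ t)⁻¹ * ⟪x, G (γ t) x⟫_ℂ) := by
  have h := ((innerSL ℂ x).comp (ContinuousLinearMap.apply ℂ H₁ x)).integral_comp_comm
    (integrableOn_contourIntegrand hk hJ hγ hz)
  refine Eq.trans h.symm (integral_congr_ae (Eventually.of_forall fun t => ?_))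
  simp [contourIntegrand]

end

section

variable {E : ProjectionValuedMeasure H₀} {B : H₀ →L[ℂ] H₁} {a b : EReal} {D : Set ℂ}
  {G : ℂ → H₁ →L[ℂ] H₁} {l : ℤ} {γ : ℝ → ℂ} {Ω : Set ℂ} {h : ℝ × ℝ → ℂ} {A₀ : H₀ →ₗ.[ℂ] H₀}

/-- The contour integral differs from `V₁` by the residue in `Ω`, and agrees with it outside the
closure of `Ω`. -/
theorem IsContinuedDerivative.contourV_eq
    (hG : IsContinuedDerivative (kernelFunction E B) a b D G)
    (hA₀ : IsSelfAdjoint A₀) (hE : IsSpectralMeasure A₀ E)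
    (hac : ∀ x, (E.scalarMeasure x).AbsolutelyContinuous volume)
    (hσ₀ : opSpectrum A₀ = (fun t : ℝ => (t : ℂ)) '' closure (realInterval a b))
    (hl : l = 1 ∨ l = -1) (hγ : IsDeformedInterval a b (sheetDomain D l) γ Ω)
    (hd : IsDeformation a b l h γ Ω)
    (hbdd : kernelVariation (reflectedKernel G) (realInterval a b) γ < ∞)
    (hgrowth : a = ⊥ ∨ b = ⊤ → ∃ (C : ℝ) (N : ℕ), ∀ μ ∈ Ω,
      ‖reflectedKernel G μ‖ ≤ C * (1 + ‖μ‖) ^ N) :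
    (∀ z ∉ closure Ω,
      contourV (reflectedKernel G) (realInterval a b) γ z = physicalV A₀ B z) ∧
    ∀ z ∈ Ω, contourV (reflectedKernel G) (realInterval a b) γ z
      = physicalV A₀ B z + (2 * Real.pi * Complex.I * (l : ℂ)) • reflectedKernel G z := by
  have hk := hG.integrableOn_deriv_smul_reflectedKernel hl hγ hbdd
  have hσ : (l : ℝ) = 1 ∨ (l : ℝ) = -1 := by rcases hl with rfl | rfl <;> simp
  have hσ2 : (l : ℝ) ^ 2 = 1 := by rcases hσ with h | h <;> rw [h] <;> norm_num
  have hU := hG.isOpen_sheets_union hl hd hγ.subset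
  have hQU : h '' (Set.Icc (0 : ℝ) 1 ×ˢ realInterval a b)
      ⊆ D ∪ {z | conj z ∈ D} ∪ (fun t : ℝ => (t : ℂ)) '' realInterval a b := by
    rw [hd.image_eq]
    rintro w ((hw | hw) | ⟨t, ht, rfl⟩)
    · exact Or.inl (sheetDomain_subset D l (hγ.subset hw))
    · exact Or.inr hw
    · exact Or.inl (sheetDomain_subset D l (hγ.maps ht))
  -- the data of the scalar problem for the quadratic form at `x`
  have hq := hG.differentiableOn_inner_reflectedKernel hl hd hγ.subset
  have hJ : ∀ x : H₁, IntegrableOn (fun t : ℝ => ⟪x, reflectedKernel G t x⟫_ℂ)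
      (realInterval a b) := fun x => by
    simpa only [reflectedKernel_ofReal] using hG.integrableOn_inner x
  have hΓ : ∀ x : H₁, IntegrableOn (fun t : ℝ => deriv γ t * ⟪x, reflectedKernel G (γ t) x⟫_ℂ)
      (realInterval a b) := fun x => by
    have h1 := ((innerSL ℂ x).comp (ContinuousLinearMap.apply ℂ H₁ x)).integrable_comp hk
    exact h1.congr (Eventually.of_forall fun t => by simp)
  have hgr : ∀ x : H₁, a = ⊥ ∨ b = ⊤ → ∃ (C : ℝ) (N : ℕ), ∀ w ∈ Ω,
      ‖⟪x, reflectedKernel G w x⟫_ℂ‖ ≤ C * (1 + ‖w‖) ^ N := by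
    intro x hab
    obtain ⟨C, N, hC⟩ := hgrowth hab
    refine ⟨C * ‖x‖ ^ 2, N, fun w hw => (norm_inner_apply_le _ x).trans ?_⟩
    calc _ ≤ (C * (1 + ‖w‖) ^ N) * ‖x‖ ^ 2 := by gcongr; exact hC w hw
      _ = _ := by ring
  have hend : ∀ x : H₁, ∀ e, (e = a ∨ e = b) → ¬ (e = ⊥ ∨ e = ⊤) →
      ∃ M : ℝ, ∀ᶠ w in endFilter e ⊓ 𝓟 Ω, ‖⟪x, reflectedKernel G w x⟫_ℂ‖ ≤ M := by
    intro x e he he'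
    obtain ⟨M, hM⟩ := hG.eventually_norm_reflectedKernel_le (l := l) hd.lt he he'
    refine ⟨M * ‖x‖ ^ 2, ?_⟩
    filter_upwards [hM.filter_mono (inf_le_inf_left _ (principal_mono.2 hγ.subset))] with w hw
    exact (norm_inner_apply_le _ x).trans (by gcongr)
  have hJcl : (fun t : ℝ => (t : ℂ)) '' closure (realInterval a b) ⊆ closure Ω := fun w hw =>
    frontier_subset_closure (hd.frontier_eq ▸ Or.inl hw)
  have hphys : ∀ x z, z ∉ (fun t : ℝ => (t : ℂ)) '' closure (realInterval a b) →
      ⟪x, physicalV A₀ B z x⟫_ℂ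
        = ∫ t in realInterval a b, (z - t)⁻¹ * ⟪x, reflectedKernel G t x⟫_ℂ := by
    intro x z hz
    simp only [reflectedKernel_ofReal]
    exact hG.inner_physicalV hA₀ hE hac hσ₀ x hz
  refine ⟨fun z hz => ?_, fun z hz => ?_⟩
  · refine ContinuousLinearMap.ext_inner_apply_self fun x => ?_
    have hzΓ : z ∉ closure (γ '' realInterval a b) := fun h =>
      hz (frontier_subset_closure (hd.closure_curve_subset_frontier h))
    rw [inner_contourV hk measurableSet_realInterval hd.continuousOn_curve hzΓ,
      hphys x z fun h => hz (hJcl h)]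
    exact (hd.cauchyTransform_eq hσ2 hU (hq x) hQU hγ.locallyLipschitz (hJ x) (hΓ x) (hgr x)
      (hend x) hz).symm
  · refine ContinuousLinearMap.ext_inner_apply_self fun x => ?_
    have hzJ : z ∉ (fun t : ℝ => (t : ℂ)) '' closure (realInterval a b) := by
      rintro ⟨t, -, rfl⟩
      have := hd.side _ hz
      simp at this
    rw [inner_contourV hk measurableSet_realInterval hd.continuousOn_curve
      (hd.disjoint_closure_curve hz), hd.cauchyTransform_sub_eq hσ hU (hq x) hQU
      hγ.locallyLipschitz (hJ x) (hΓ x) (hgr x) (hend x) hz]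
    simp [hphys x z hzJ]

end

end Contour

end

theorem mainTheorem4 {H₀ H₁ : Type*}
    [NormedAddCommGroup H₀] [InnerProductSpace ℂ H₀] [CompleteSpace H₀]
    [NormedAddCommGroup H₁] [InnerProductSpace ℂ H₁] [CompleteSpace H₁]
    (a b : EReal) (hab : a < b)
    (A₀ : H₀ →ₗ.[ℂ] H₀) (hA₀ : IsSelfAdjoint A₀)
    (A₁ : H₁ →ₗ.[ℂ] H₁) (hA₁ : IsSelfAdjoint A₁)
    (B : H₀ →L[ℂ] H₁)
    (E : ProjectionValuedMeasure H₀) (hE : IsSpectralMeasure A₀ E)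
    (hac : ∀ x, (E.scalarMeasure x).AbsolutelyContinuous volume)
    (hσ₀ : opSpectrum A₀ = (fun t : ℝ => (t : ℂ)) '' closure (realInterval a b))
    (hσ₁ : opSpectrum A₁ ⊆ (fun t : ℝ => (t : ℂ)) '' realInterval a b)
    (D : Set ℂ) (G : ℂ → H₁ →L[ℂ] H₁)
    (hG : IsContinuedDerivative (kernelFunction E B) a b D G)
    (l : ℤ) (hl : l = 1 ∨ l = -1)
    (γ : ℝ → ℂ) (Ω : Set ℂ) (hγ : IsDeformedInterval a b (sheetDomain D l) γ Ω)
    (hbdd : kernelVariation (reflectedKernel G) (realInterval a b) γ < ∞)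
    (hgrowth : a = ⊥ ∨ b = ⊤ → ∃ (C : ℝ) (N : ℕ), ∀ μ ∈ Ω,
      ‖reflectedKernel G μ‖ ≤ C * (1 + ‖μ‖) ^ N) :
    -- the integral over the contour converges
    (∀ z ∉ closure (γ '' realInterval a b),
      IntegrableOn (contourIntegrand (reflectedKernel G) γ z) (realInterval a b)) ∧
    -- it is holomorphic off the contour, in operator norm
    DifferentiableOn ℂ (contourV (reflectedKernel G) (realInterval a b) γ)
      (closure (γ '' realInterval a b))ᶜ ∧
    -- continuation from the opposite half-plane through the interval into `Ω`
    IsAnalyticContinuation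
      (transferFunction A₁ (physicalV A₀ B))
      (transferFunction A₁ (contourV (reflectedKernel G) (realInterval a b) γ))
      {z : ℂ | (l : ℝ) * z.im < 0}
      ({z : ℂ | (l : ℝ) * z.im < 0} ∪ (fun t : ℝ => (t : ℂ)) '' realInterval a b ∪ Ω) ∧
    -- no change outside the closure of `Ω`
    (∀ z ∉ closure Ω,
      transferFunction A₁ (contourV (reflectedKernel G) (realInterval a b) γ) z =
        transferFunction A₁ (physicalV A₀ B) z) ∧
    -- the values in `Ω`
    (∀ z ∈ sheetDomain D l ∩ Ω,
      transferFunction A₁ (contourV (reflectedKernel G) (realInterval a b) γ) z =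
        (((2 * Real.pi * Complex.I * (l : ℂ)) • reflectedKernel G z : H₁ →L[ℂ] H₁) :
          H₁ →ₗ[ℂ] H₁) +ᵥ transferFunction A₁ (physicalV A₀ B) z) := by

  have hside := fun z (hz : z ∈ sheetDomain D l) => hG.side_of_mem_sheetDomain hl hz
  obtain ⟨h, hd⟩ := exists_isDeformation hab hγ hside
  have hk := hG.integrableOn_deriv_smul_reflectedKernel hl hγ hbdd
  obtain ⟨hout, hin⟩ := hG.contourV_eq hA₀ hE hac hσ₀ hl hγ hd hbdd hgrowth
  have hdiff := differentiableOn_contourV hk measurableSet_realInterval hd.continuousOn_curve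
  have houtM : ∀ z ∉ closure Ω,
      transferFunction A₁ (contourV (reflectedKernel G) (realInterval a b) γ) z =
        transferFunction A₁ (physicalV A₀ B) z := fun z hz => by
    rw [transferFunction, transferFunction, hout z hz]
  refine ⟨fun z hz => integrableOn_contourIntegrand hk measurableSet_realInterval
    hd.continuousOn_curve hz, hdiff, ?_, houtM, ?_⟩
  · refine ⟨isOpen_lt (by fun_prop) continuous_const, ⟨-(l : ℝ) * Complex.I, ?_⟩,
      fun z hz => Or.inl (Or.inl hz), hd.isOpen_union, hd.isConnected_union,
      holomorphicFamilyOn_transferFunction hA₁.isClosed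
        (hdiff.mono fun z hz => hd.disjoint_union_closure_curve hz),
      fun z hz => houtM z fun hcl => ?_⟩
    · rcases hl with rfl | rfl <;> simp
    · have h1 : 0 ≤ (l : ℝ) * z.im := hd.closure_subset_side hcl
      have h2 : (l : ℝ) * z.im < 0 := hz
      linarith
  · rintro z ⟨-, hz⟩
    rw [transferFunction, transferFunction, hin z hz, vadd_vadd]
    congr 1
    ext x
    simp
    abel
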